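/- Let $S>0$ and, for $0<h<S$, let $(\|t^j\|_h)_{j\ge 0}$ be positive real numbers; put $R(h,j)=\|t^{j+1}\|_h/\|t^j\|_h$. Assume that for all $0<h<S$ and all $j,l\ge 0$ (a) $\|t^{j+l}\|_h\le \|t^j\|_h\,\|t^l\|_h$; (b) $\|t^j\|_h\le 1$ and $R(h,j)\le 1$; (c) $R(h,j)\to 0$ as $j\to\infty$; and that (d) for all $0<h<k<S$ there is a constant $K_{h,k}>0$ such that $\|t^j\|_h\le K_{h,k}\,\min\{j^{-1},R(k,j)\}\,\|t^j\|_k$ for all $j\ge 0$ (where $j^{-1}$ is read as $+\infty$ for $j=0$). For $0<h<S$ let $A_h\subset\mathbb C[[t]]$ be the Banach algebra of all $\sum_j a_jt^j$ with $\|\sum_j a_jt^j\|_h:=\sum_j|a_j|\,\|t^j\|_h<\infty$. Let $$A=\varinjlim_{h>0}A_h=\bigcup_{0<h<S}A_h\qquad\text{and, for } 0<h<S,\qquad A_{\check h}=\varinjlim_{k>h}A_k=\bigcup_{h<k<S}A_k ,$$ equipped with the locally convex direct limit topologies. For a complex manifold $X$ let $\mathcal A_X$ and $\mathcal A_X^{\check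 h}$ be the sheaves of rings of holomorphic functions on $X$ with values in the topological rings $A$ and $A_{\check h}$, respectively. Theorem. For every complex manifold $X$, every point $x\in X$ and every $0<h<S$, the stalks $\mathcal A_{X,x}$ and $\mathcal A_{X,x}^{\check h}$ are regular local rings (in particular, they are Noetherian local rings). -/

import Mathlib

open scoped Topology Manifold ContDiff PowerSeries NNReal

universe u

noncomputable section

/-! ### Holomorphic functions with values in a topological `ℂ`-algebra -/

section Holomorphic

variable {R : Type} [CommRing R] [Algebra ℂ R] [TopologicalSpace R]
variable {E : Type} [NormedAddCommGroup E] [NormedSpace ℂ E]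

/-- Complex differentiability at a point of a complex manifold of dimension `n`, for functions
with values in a topological `ℂ`-algebra, read in the preferred chart at that point. The derivative
is the Fréchet derivative for maps into topological vector spaces. -/
def ComplexDifferentiableAt (n : ℕ) {X : Type u} [TopologicalSpace X]
    [ChartedSpace (EuclideanSpace ℂ (Fin n)) X] (f : X → R) (x : X) : Prop :=
  DifferentiableAt ℂ (f ∘ (chartAt (EuclideanSpace ℂ (Fin n)) x).symm)
    (chartAt (EuclideanSpace ℂ (Fin n)) x x)

/-- A function on an open set `U` is holomorphic if it is complex differentiable at every point
of `U` (the values of the extension by zero outside `U` are irrelevant). -/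
def IsHolomorphic (n : ℕ) {X : Type u} [TopologicalSpace X]
    [ChartedSpace (EuclideanSpace ℂ (Fin n)) X] {U : TopologicalSpace.Opens X} (f : U → R) : Prop :=
  ∀ y : U, ComplexDifferentiableAt n (Function.extend ((↑) : U → X) f 0) (y : X)

open Asymptotics Filter in
theorem isLittleOTVS_mul_of_tendsto [IsTopologicalRing R] {α : Type*} {l : Filter α}
    {a b : α → R} {g : α → E} {b₀ : R} (ha : a =o[ℂ; l] g) (hb : Tendsto b l (𝓝 b₀)) :
    (fun x => a x * b x) =o[ℂ; l] g := by
  constructor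
  intro U hU
  have hc : Tendsto (fun p : R × R => p.1 * p.2) (𝓝 (0, b₀)) (𝓝 0) := by
    have := (continuous_mul (M := R)).tendsto (0, b₀)
    simpa using this
  have hm := hc hU
  rw [nhds_prod_eq] at hm
  obtain ⟨V, hV, W, hW, hVW⟩ := Filter.mem_prod_iff.1 hm
  obtain ⟨Z, hZ, h⟩ := ha.exists_eventuallyLE_mul V hV
  refine ⟨Z, hZ, fun ε hε => ?_⟩
  filter_upwards [h ε hε, hb hW] with x hx hbx
  refine le_trans ?_ hx
  rw [le_egauge_iff]
  rintro c ⟨v, hv, hvx⟩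
  refine egauge_le_of_mem_smul ⟨v * b x, hVW (Set.mk_mem_prod hv hbx), ?_⟩
  simp only at hvx ⊢
  rw [← hvx, smul_mul_assoc]

open Asymptotics Filter in
theorem isLittleOTVS_mul_of_isBigOTVS [IsTopologicalRing R] [ContinuousSMul ℂ R]
    {α : Type*} {l : Filter α}
    {a b : α → R} {g : α → E} (ha : a =O[ℂ; l] g) (hb : Tendsto b l (𝓝 0)) :
    (fun x => a x * b x) =o[ℂ; l] g := by
  constructor
  intro U hU
  have hc : Tendsto (fun p : R × R => p.1 * p.2) (𝓝 (0, 0)) (𝓝 0) := by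
    have := (continuous_mul (M := R)).tendsto (0, 0)
    simpa using this
  have hm := hc hU
  rw [nhds_prod_eq] at hm
  obtain ⟨V, hV, W, hW, hVW⟩ := Filter.mem_prod_iff.1 hm
  obtain ⟨Z, hZ, h⟩ := ha.exists_eventuallyLE V hV
  refine ⟨Z, hZ, fun ε hε => ?_⟩
  have hε' : (((ε : ℝ) : ℂ)) ≠ 0 := by simpa using hε
  have hεn : ‖(((ε : ℝ) : ℂ))‖ₑ = (ε : ENNReal) := by
    rw [enorm_eq_nnnorm, Complex.nnnorm_real, NNReal.nnnorm_eq]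
  filter_upwards [h, hb ((set_smul_mem_nhds_zero_iff hε').2 hW)] with x hx hbx
  refine le_trans ?_ (mul_le_mul_right hx _)
  obtain ⟨w, hw, hwx⟩ := hbx
  simp only at hwx
  have e : a x * b x = (((ε : ℝ) : ℂ)) • (a x * w) := by
    rw [← hwx, mul_smul_comm]
  rw [e, egauge_smul_right (fun h0 => absurd h0 hε'), hεn]
  refine mul_le_mul_right ?_ _
  rw [le_egauge_iff]
  rintro c ⟨v, hv, hvx⟩
  refine egauge_le_of_mem_smul ⟨v * w, hVW (Set.mk_mem_prod hv hw), ?_⟩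
  simp only at hvx ⊢
  rw [← hvx, smul_mul_assoc]

open Asymptotics Filter in
theorem DifferentiableAt.constTVS (c : R) (x : E) :
    DifferentiableAt ℂ (fun _ : E => c) x := by
  refine ⟨0, ?_⟩
  rw [hasFDerivAt_iff_isLittleOTVS]
  exact (IsLittleOTVS.zero (𝕜 := ℂ) (E := R) (fun y : E => y - x) (𝓝 x)).congr_left
    fun y => by simp

variable [IsTopologicalRing R] [ContinuousSMul ℂ R]

open Asymptotics Filter in
theorem DifferentiableAt.mulTVS {f g : E → R} {x : E}
    (hf : DifferentiableAt ℂ f x) (hg : DifferentiableAt ℂ g x) :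
    DifferentiableAt ℂ (fun y => f y * g y) x := by
  obtain ⟨f', hf⟩ := hf
  obtain ⟨g', hg⟩ := hg
  have hgc : Tendsto g (𝓝 x) (𝓝 (g x)) := hg.continuousAt
  have hgc0 : Tendsto (fun y => g y - g x) (𝓝 x) (𝓝 0) := by
    simpa using hgc.sub_const (g x)
  let Lm : R →L[ℂ] R := ⟨LinearMap.mulLeft ℂ (f x), continuous_const_mul (f x)⟩
  let Rm : R →L[ℂ] R := ⟨LinearMap.mulRight ℂ (g x), continuous_mul_const (g x)⟩
  refine ⟨Lm.comp g' + Rm.comp f', ?_⟩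
  rw [hasFDerivAt_iff_isLittleOTVS] at hf hg ⊢
  have h1 := isLittleOTVS_mul_of_tendsto hf hgc
  have h2 := isLittleOTVS_mul_of_tendsto hg
    (tendsto_const_nhds : Tendsto (fun _ : E => f x) (𝓝 x) (𝓝 (f x)))
  have h3 := isLittleOTVS_mul_of_isBigOTVS
    (f'.isBigOTVS_fun_comp (f := fun y : E => y - x) (l := 𝓝 x)) hgc0
  refine ((h1.add h2).add h3).congr_left fun y => ?_
  have e1 : ∀ r, Lm r = f x * r := fun _ => rfl
  have e2 : ∀ r, Rm r = r * g x := fun _ => rfl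
  simp only [Pi.add_apply, add_apply, ContinuousLinearMap.comp_apply, e1, e2]
  ring

open Asymptotics Filter in
theorem DifferentiableAt.addTVS {f g : E → R} {x : E}
    (hf : DifferentiableAt ℂ f x) (hg : DifferentiableAt ℂ g x) :
    DifferentiableAt ℂ (fun y => f y + g y) x := by
  obtain ⟨f', hf⟩ := hf
  obtain ⟨g', hg⟩ := hg
  refine ⟨f' + g', ?_⟩
  rw [hasFDerivAt_iff_isLittleOTVS] at hf hg ⊢
  refine (hf.add hg).congr_left fun y => ?_
  simp
  ring

end Holomorphic

section Sheaf

variable (n : ℕ)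

theorem ComplexDifferentiableAt.congr {n : ℕ} {X : Type u} [TopologicalSpace X]
    [ChartedSpace (EuclideanSpace ℂ (Fin n)) X]
    {R : Type} [CommRing R] [Algebra ℂ R] [TopologicalSpace R] {f g : X → R} {x : X}
    (hf : ComplexDifferentiableAt n f x) (h : g =ᶠ[𝓝 x] f) : ComplexDifferentiableAt n g x := by
  unfold ComplexDifferentiableAt at *
  set φ := chartAt (EuclideanSpace ℂ (Fin n)) x
  have hx : x ∈ φ.source := mem_chart_source _ x
  have ht : Filter.Tendsto φ.symm (𝓝 (φ x)) (𝓝 x) := by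
    have := φ.continuousAt_symm (φ.map_source hx)
    rwa [ContinuousAt, φ.left_inv hx] at this
  exact hf.congr_of_eventuallyEq (ht.eventually h)

theorem extend_zero_apply {X R : Type*} [TopologicalSpace X] [Zero R]
    {U : TopologicalSpace.Opens X} (f : U → R) {z : X} (hz : z ∈ U) :
    Function.extend ((↑) : U → X) f 0 z = f ⟨z, hz⟩ :=
  Subtype.val_injective.extend_apply f 0 ⟨z, hz⟩

theorem extend_restrict_eventuallyEq {X R : Type*} [TopologicalSpace X] [Zero R]
    {U V : TopologicalSpace.Opens X} (i : V ≤ U) (f : U → R) {x : X} (hx : x ∈ V) :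
    Function.extend ((↑) : V → X) (fun y : V => f ⟨y, i y.2⟩) 0 =ᶠ[𝓝 x]
      Function.extend ((↑) : U → X) f 0 := by
  filter_upwards [V.isOpen.mem_nhds hx] with y hy
  rw [extend_zero_apply _ hy, extend_zero_apply _ (i hy)]

/-- Being holomorphic is a local condition on functions on open subsets. -/
def holomorphicLocalPredicate (X : Type u) [TopologicalSpace X]
    [ChartedSpace (EuclideanSpace ℂ (Fin n)) X]
    (R : Type) [CommRing R] [Algebra ℂ R] [TopologicalSpace R] :
    TopCat.LocalPredicate (X := TopCat.of X) (fun _ => R) where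
  pred {U} f := IsHolomorphic n (X := X) (U := U) f
  res {U V} i f hf y := by
    exact (hf ⟨y, i.le y.2⟩).congr (extend_restrict_eventuallyEq (X := X) i.le f y.2)
  locality {U} f w y := by
    obtain ⟨V, hV, i, h⟩ := w y
    exact (h ⟨y, hV⟩).congr (extend_restrict_eventuallyEq (X := X) i.le f hV).symm

/-- The ring of holomorphic functions `U → R`, with pointwise operations. -/
def holomorphicSections {X : Type u} [TopologicalSpace X]
    [ChartedSpace (EuclideanSpace ℂ (Fin n)) X]
    (R : Type) [CommRing R] [Algebra ℂ R] [TopologicalSpace R]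
    [IsTopologicalRing R] [ContinuousSMul ℂ R] (U : TopologicalSpace.Opens X) :
    Subring (U → R) where
  carrier := {f | IsHolomorphic n f}
  mul_mem' {f g} hf hg y := by
    refine ComplexDifferentiableAt.congr (f := fun z => Function.extend ((↑) : U → X) f 0 z *
      Function.extend ((↑) : U → X) g 0 z) (DifferentiableAt.mulTVS (hf y) (hg y)) ?_
    filter_upwards [U.isOpen.mem_nhds y.2] with z hz
    simp only [extend_zero_apply _ hz, Pi.mul_apply]
  one_mem' y := by
    refine ComplexDifferentiableAt.congr (f := fun _ => 1) (DifferentiableAt.constTVS 1 _) ?_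
    filter_upwards [U.isOpen.mem_nhds y.2] with z hz
    simp only [extend_zero_apply _ hz, Pi.one_apply]
  add_mem' {f g} hf hg y := by
    refine ComplexDifferentiableAt.congr (f := fun z => Function.extend ((↑) : U → X) f 0 z +
      Function.extend ((↑) : U → X) g 0 z) (DifferentiableAt.addTVS (hf y) (hg y)) ?_
    filter_upwards [U.isOpen.mem_nhds y.2] with z hz
    simp only [extend_zero_apply _ hz, Pi.add_apply]
  zero_mem' y := by
    refine ComplexDifferentiableAt.congr (f := fun _ => 0) (DifferentiableAt.constTVS 0 _) ?_
    filter_upwards [U.isOpen.mem_nhds y.2] with z hz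
    simp only [extend_zero_apply _ hz, Pi.zero_apply]
  neg_mem' {f} hf y := by
    refine ComplexDifferentiableAt.congr (f := fun z => (-1) * Function.extend ((↑) : U → X) f 0 z)
      (DifferentiableAt.mulTVS (DifferentiableAt.constTVS (-1) _) (hf y)) ?_
    filter_upwards [U.isOpen.mem_nhds y.2] with z hz
    simp only [extend_zero_apply _ hz, Pi.neg_apply, neg_one_mul]

open CategoryTheory in
/-- The presheaf of rings of holomorphic functions with values in `R`. -/
def holomorphicPresheaf (X : Type u) [TopologicalSpace X]
    [ChartedSpace (EuclideanSpace ℂ (Fin n)) X]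
    (R : Type) [CommRing R] [Algebra ℂ R] [TopologicalSpace R]
    [IsTopologicalRing R] [ContinuousSMul ℂ R] :
    TopCat.Presheaf CommRingCat.{u} (TopCat.of X) where
  obj U := CommRingCat.of (holomorphicSections n (X := X) R U.unop)
  map i := CommRingCat.ofHom
    { toFun := fun f => ⟨fun y => f.1 ⟨y, i.unop.le y.2⟩,
        (holomorphicLocalPredicate n X R).res i.unop f.1 f.2⟩
      map_one' := rfl
      map_mul' := fun _ _ => rfl
      map_zero' := rfl
      map_add' := fun _ _ => rfl }
  map_id _ := rfl
  map_comp _ _ := rfl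

open CategoryTheory in
/-- The sheaf of rings of holomorphic functions on `X` with values in the topological
algebra `R`. -/
def holomorphicSheaf (X : Type u) [TopologicalSpace X]
    [ChartedSpace (EuclideanSpace ℂ (Fin n)) X]
    (R : Type) [CommRing R] [Algebra ℂ R] [TopologicalSpace R]
    [IsTopologicalRing R] [ContinuousSMul ℂ R] :
    TopCat.Sheaf CommRingCat.{u} (TopCat.of X) where
  obj := holomorphicPresheaf n X R
  property := by
    rw [CategoryTheory.Presheaf.isSheaf_iff_isSheaf_forget _ _
      (CategoryTheory.forget CommRingCat)]
    exact (TopCat.subsheafToTypes (holomorphicLocalPredicate n X R)).property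

end Sheaf

/-! ### The rings `A_h`, `A_ȟ` and `A` -/

/-- The norms `w h j = ‖t ^ j‖_h`, for `0 < h < S`, from which the Banach algebras `A_h` are built,
subject to: compatibility with multiplication (Banach algebra), normalization, locality and
controlled nuclearity. With `R(k, j) = ‖t ^ (j + 1)‖_k / ‖t ^ j‖_k`, the last condition says
`‖t ^ j‖_h ≤ K_{h,k} min {1 / j, R(k, j)} ‖t ^ j‖_k`, where `1 / j` is omitted for `j = 0`. -/
structure LevelNorms where
  /-- the bound `S` for the levels -/
  S : ℝ
  S_pos : 0 < S
  /-- `w h j = ‖t ^ j‖_h` -/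
  w : ℝ → ℕ → ℝ
  pos : ∀ h ∈ Set.Ioo 0 S, ∀ j, 0 < w h j
  banach_algebra : ∀ h ∈ Set.Ioo 0 S, ∀ j l, w h (j + l) ≤ w h j * w h l
  le_one : ∀ h ∈ Set.Ioo 0 S, ∀ j, w h j ≤ 1
  ratio_le_one : ∀ h ∈ Set.Ioo 0 S, ∀ j, w h (j + 1) / w h j ≤ 1
  locality : ∀ h ∈ Set.Ioo 0 S,
    Filter.Tendsto (fun j => w h (j + 1) / w h j) Filter.atTop (𝓝 0)
  controlled_nuclearity : ∀ h ∈ Set.Ioo 0 S, ∀ k ∈ Set.Ioo 0 S, h < k →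
    ∃ K : ℝ, 0 < K ∧ ∀ j : ℕ, (j ≠ 0 → w h j ≤ K * (j : ℝ)⁻¹ * w k j) ∧
      w h j ≤ K * (w k (j + 1) / w k j) * w k j

theorem weighted_summable_mul {u v : ℕ → ℝ} (hv : ∀ j, 0 ≤ v j)
    (H : ∀ i j, v (i + j) ≤ u i * u j) {f g : ℂ⟦X⟧}
    (hf : Summable fun j => ‖PowerSeries.coeff j f‖ * u j)
    (hg : Summable fun j => ‖PowerSeries.coeff j g‖ * u j) :
    (Summable fun j => ‖PowerSeries.coeff j (f * g)‖ * v j) ∧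
    ∑' j, ‖PowerSeries.coeff j (f * g)‖ * v j ≤
      (∑' j, ‖PowerSeries.coeff j f‖ * u j) * ∑' j, ‖PowerSeries.coeff j g‖ * u j := by
  have hle : ∀ n, ‖PowerSeries.coeff n (f * g)‖ * v n ≤ ∑ kl ∈ Finset.HasAntidiagonal.antidiagonal n,
      (‖PowerSeries.coeff kl.1 f‖ * u kl.1) * (‖PowerSeries.coeff kl.2 g‖ * u kl.2) := by
    intro n
    rw [PowerSeries.coeff_mul]
    refine (mul_le_mul_of_nonneg_right (norm_sum_le _ _) (hv n)).trans ?_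
    rw [Finset.sum_mul]
    refine Finset.sum_le_sum fun kl hkl => ?_
    rw [← Finset.HasAntidiagonal.mem_antidiagonal.1 hkl, norm_mul]
    calc _ ≤ ‖PowerSeries.coeff kl.1 f‖ * ‖PowerSeries.coeff kl.2 g‖ * (u kl.1 * u kl.2) := by
          gcongr; exact H _ _
      _ = _ := by ring
  have hf' : Summable fun j => ‖‖PowerSeries.coeff j f‖ * u j‖ := hf.norm
  have hg' : Summable fun j => ‖‖PowerSeries.coeff j g‖ * u j‖ := hg.norm
  have hs := (summable_norm_sum_mul_antidiagonal_of_summable_norm hf' hg').of_norm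
  have hs2 : Summable fun j => ‖PowerSeries.coeff j (f * g)‖ * v j :=
    Summable.of_nonneg_of_le (fun j => mul_nonneg (norm_nonneg _) (hv j)) hle hs
  refine ⟨hs2, ?_⟩
  rw [tsum_mul_tsum_eq_tsum_sum_antidiagonal_of_summable_norm hf' hg']
  exact hs2.tsum_le_tsum hle hs

theorem weighted_summable_add {u : ℕ → ℝ} (hu : ∀ j, 0 ≤ u j) {f g : ℂ⟦X⟧}
    (hf : Summable fun j => ‖PowerSeries.coeff j f‖ * u j)
    (hg : Summable fun j => ‖PowerSeries.coeff j g‖ * u j) :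
    (Summable fun j => ‖PowerSeries.coeff j (f + g)‖ * u j) ∧
    ∑' j, ‖PowerSeries.coeff j (f + g)‖ * u j ≤
      (∑' j, ‖PowerSeries.coeff j f‖ * u j) + ∑' j, ‖PowerSeries.coeff j g‖ * u j := by
  have hle : ∀ j, ‖PowerSeries.coeff j (f + g)‖ * u j ≤
      ‖PowerSeries.coeff j f‖ * u j + ‖PowerSeries.coeff j g‖ * u j := by
    intro j
    rw [map_add, ← add_mul]
    exact mul_le_mul_of_nonneg_right (norm_add_le _ _) (hu j)
  have hs : Summable fun j => ‖PowerSeries.coeff j (f + g)‖ * u j :=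
    Summable.of_nonneg_of_le (fun j => mul_nonneg (norm_nonneg _) (hu j)) hle (hf.add hg)
  refine ⟨hs, ?_⟩
  rw [← hf.tsum_add hg]
  exact hs.tsum_le_tsum hle (hf.add hg)

theorem weighted_summable_finite (u : ℕ → ℝ) {f : ℂ⟦X⟧} {N : ℕ}
    (hf : ∀ j, N ≤ j → PowerSeries.coeff j f = 0) :
    Summable fun j => ‖PowerSeries.coeff j f‖ * u j := by
  refine summable_of_ne_finset_zero (s := Finset.range N) fun j hj => ?_
  rw [hf j (by simpa using hj)]
  simp

namespace LevelNorms

variable (N : LevelNorms)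

/-- `‖∑ a_j t ^ j‖_h = ∑ |a_j| ‖t ^ j‖_h` -/
def norm (h : ℝ) (f : ℂ⟦X⟧) : ℝ := ∑' j, ‖PowerSeries.coeff j f‖ * N.w h j

/-- `‖∑ a_j t ^ j‖_h < ∞` -/
def NormFinite (h : ℝ) (f : ℂ⟦X⟧) : Prop := Summable fun j => ‖PowerSeries.coeff j f‖ * N.w h j

/-- The Banach algebra `A_h`, as a subalgebra of `ℂ⟦t⟧`. -/
def level (h : Set.Ioo 0 N.S) : Subalgebra ℂ ℂ⟦X⟧ where
  carrier := {f | N.NormFinite h f}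
  mul_mem' hf hg := (weighted_summable_mul (fun j => (N.pos h h.2 j).le) (N.banach_algebra h h.2) hf hg).1
  add_mem' hf hg := (weighted_summable_add (fun j => (N.pos h h.2 j).le) hf hg).1
  algebraMap_mem' c := weighted_summable_finite (N := 1) _ fun j hj => by
    simp [PowerSeries.coeff_C, show j ≠ 0 by omega]

theorem exists_le_mul {h k : ℝ} (hh : h ∈ Set.Ioo 0 N.S) (hk : k ∈ Set.Ioo 0 N.S) (hhk : h ≤ k) :
    ∃ K : ℝ, 0 < K ∧ ∀ j, N.w h j ≤ K * N.w k j := by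
  rcases hhk.eq_or_lt with rfl | hlt
  · exact ⟨1, one_pos, fun j => by simp⟩
  · obtain ⟨K, hK, H⟩ := N.controlled_nuclearity h hh k hk hlt
    refine ⟨K, hK, fun j => (H j).2.trans ?_⟩
    have := N.ratio_le_one k hk j
    have := N.pos k hk j
    gcongr
    exact mul_le_of_le_one_right hK.le ‹_›

theorem level_anti {h k : Set.Ioo 0 N.S} (hhk : h ≤ k) : N.level k ≤ N.level h := by
  intro f hf
  obtain ⟨K, -, H⟩ := N.exists_le_mul h.2 k.2 hhk
  refine Summable.of_nonneg_of_le (fun j => mul_nonneg (norm_nonneg _) (N.pos h h.2 j).le)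
    (fun j => ?_) (Summable.mul_left K hf)
  calc _ ≤ ‖PowerSeries.coeff j f‖ * (K * N.w k j) := by gcongr; exact H j
    _ = _ := by ring

theorem exists_level (h : Set.Ico 0 N.S) : ∃ k : Set.Ioo 0 N.S, (h : ℝ) < k :=
  ⟨⟨(h + N.S) / 2, by have := h.2.1; have := N.S_pos; constructor <;> linarith [h.2.2]⟩, by
    change (h : ℝ) < (h + N.S) / 2
    linarith [h.2.2]⟩

/-- The ring `A_ȟ`, the direct limit (here: the union) of the `A_k`, `k > h`. -/
def dirLim (h : Set.Ico 0 N.S) : Subalgebra ℂ ℂ⟦X⟧ where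
  carrier := {f | ∃ k : Set.Ioo 0 N.S, (h : ℝ) < k ∧ f ∈ N.level k}
  mul_mem' := by
    rintro f g ⟨k, hk, hf⟩ ⟨l, hl, hg⟩
    exact ⟨min k l, by rcases min_choice k l with e | e <;> rwa [e],
      mul_mem (N.level_anti (min_le_left k l) hf) (N.level_anti (min_le_right k l) hg)⟩
  add_mem' := by
    rintro f g ⟨k, hk, hf⟩ ⟨l, hl, hg⟩
    exact ⟨min k l, by rcases min_choice k l with e | e <;> rwa [e],
      add_mem (N.level_anti (min_le_left k l) hf) (N.level_anti (min_le_right k l) hg)⟩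
  algebraMap_mem' c := by
    obtain ⟨k, hk⟩ := N.exists_level h
    exact ⟨k, hk, algebraMap_mem _ c⟩

/-- The seminorms on `A_ȟ` whose restriction to every Banach space `A_k`, `k > h`, is
continuous. -/
def limitSeminorms (h : Set.Ico 0 N.S) : Set (Seminorm ℂ (N.dirLim h)) :=
  {p | ∀ k : Set.Ioo 0 N.S, (h : ℝ) < k →
    ∃ C : ℝ, ∀ f : N.dirLim h, (f : ℂ⟦X⟧) ∈ N.level k → p f ≤ C * N.norm k f}

/-- The family of all the seminorms in `limitSeminorms`. -/
def seminormFamily (h : Set.Ico 0 N.S) : SeminormFamily ℂ (N.dirLim h) (N.limitSeminorms h) :=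
  Subtype.val

instance (h : Set.Ico 0 N.S) : Nonempty (N.limitSeminorms h) :=
  ⟨⟨0, fun _ _ => ⟨0, fun _ _ => by simp⟩⟩⟩

/-- The locally convex direct limit topology on `A_ȟ`. -/
instance topology (h : Set.Ico 0 N.S) : TopologicalSpace (N.dirLim h) :=
  (N.seminormFamily h).moduleFilterBasis.topology

theorem withSeminorms (h : Set.Ico 0 N.S) : WithSeminorms (N.seminormFamily h) := ⟨rfl⟩

instance (h : Set.Ico 0 N.S) : IsTopologicalAddGroup (N.dirLim h) :=
  (N.withSeminorms h).topologicalAddGroup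

instance (h : Set.Ico 0 N.S) : ContinuousSMul ℂ (N.dirLim h) :=
  (N.withSeminorms h).continuousSMul

theorem X_pow_mem_level (k : Set.Ioo 0 N.S) (j : ℕ) : (PowerSeries.X ^ j : ℂ⟦X⟧) ∈ N.level k :=
  weighted_summable_finite (N := j + 1) _ fun i hi => by
    simp [PowerSeries.coeff_X_pow, show i ≠ j by omega]

/-- The element `t ^ j` of `A_ȟ`. -/
def tPow (h : Set.Ico 0 N.S) (j : ℕ) : N.dirLim h :=
  ⟨PowerSeries.X ^ j, by
    obtain ⟨k, hk⟩ := N.exists_level h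
    exact ⟨k, hk, N.X_pow_mem_level k j⟩⟩

theorem norm_X_pow (k : ℝ) (j : ℕ) : N.norm k (PowerSeries.X ^ j) = N.w k j := by
  unfold norm
  rw [tsum_eq_single j fun i hi => by simp [PowerSeries.coeff_X_pow, hi]]
  simp [PowerSeries.coeff_X_pow]

theorem seminorm_le_tsum (h : Set.Ico 0 N.S) {p : Seminorm ℂ (N.dirLim h)}
    (hp : p ∈ N.limitSeminorms h) (f : N.dirLim h) :
    (Summable fun j => ‖PowerSeries.coeff j (f : ℂ⟦X⟧)‖ * p (N.tPow h j)) ∧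
    p f ≤ ∑' j, ‖PowerSeries.coeff j (f : ℂ⟦X⟧)‖ * p (N.tPow h j) := by
  obtain ⟨k, hk, hf⟩ := f.2
  obtain ⟨C, hC⟩ := hp k hk
  have ht : ∀ j, p (N.tPow h j) ≤ C * N.w k j := fun j => by
    have := hC (N.tPow h j) (N.X_pow_mem_level k j)
    rwa [show ((N.tPow h j : N.dirLim h) : ℂ⟦X⟧) = PowerSeries.X ^ j from rfl,
      N.norm_X_pow] at this
  have hf' : Summable fun j => ‖PowerSeries.coeff j (f : ℂ⟦X⟧)‖ * N.w k j := hf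
  have hs : Summable fun j => ‖PowerSeries.coeff j (f : ℂ⟦X⟧)‖ * p (N.tPow h j) := by
    refine Summable.of_nonneg_of_le (fun j => mul_nonneg (norm_nonneg _) (apply_nonneg p _))
      (fun j => ?_) (hf'.mul_left C)
    calc _ ≤ ‖PowerSeries.coeff j (f : ℂ⟦X⟧)‖ * (C * N.w k j) := by gcongr; exact ht j
      _ = _ := by ring
  refine ⟨hs, ?_⟩
  let s : ℕ → N.dirLim h := fun M =>
    ∑ j ∈ Finset.range M, PowerSeries.coeff j (f : ℂ⟦X⟧) • N.tPow h j
  have hsc : ∀ M i, PowerSeries.coeff i ((s M : N.dirLim h) : ℂ⟦X⟧) =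
      if i < M then PowerSeries.coeff i (f : ℂ⟦X⟧) else 0 := by
    intro M i
    simp only [s, AddSubmonoidClass.coe_finsetSum, map_sum]
    simp [tPow, PowerSeries.coeff_X_pow]
  have hlev : ∀ M, ((f - s M : N.dirLim h) : ℂ⟦X⟧) ∈ N.level k := by
    intro M
    refine sub_mem hf (weighted_summable_finite (N := M) _ fun i hi => ?_)
    rw [hsc, if_neg (by omega)]
  have hnorm : ∀ M, N.norm k ((f - s M : N.dirLim h) : ℂ⟦X⟧) =
      ∑' j, ‖PowerSeries.coeff (j + M) (f : ℂ⟦X⟧)‖ * N.w k (j + M) := by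
    intro M
    unfold norm
    have h1 : Summable fun j =>
      ‖PowerSeries.coeff j ((f - s M : N.dirLim h) : ℂ⟦X⟧)‖ * N.w k j := hlev M
    rw [← h1.sum_add_tsum_nat_add M, Finset.sum_eq_zero, zero_add]
    · refine tsum_congr fun j => ?_
      rw [AddSubgroupClass.coe_sub, map_sub, hsc, if_neg (by omega), sub_zero]
    · intro i hi
      rw [AddSubgroupClass.coe_sub, map_sub, hsc, if_pos (by simpa using hi)]
      simp
  have hbound : ∀ M, p f ≤ C * (∑' j, ‖PowerSeries.coeff (j + M) (f : ℂ⟦X⟧)‖ * N.w k (j + M)) +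
      ∑' j, ‖PowerSeries.coeff j (f : ℂ⟦X⟧)‖ * p (N.tPow h j) := by
    intro M
    have h1 : p f ≤ p (f - s M) + p (s M) := by
      simpa using map_add_le_add p (f - s M) (s M)
    have h2 : p (s M) ≤ ∑ j ∈ Finset.range M,
        ‖PowerSeries.coeff j (f : ℂ⟦X⟧)‖ * p (N.tPow h j) := by
      refine (Finset.le_sum_of_subadditive p (map_zero p).le (map_add_le_add p) _ _).trans
        (le_of_eq ?_)
      exact Finset.sum_congr rfl fun j _ => map_smul_eq_mul p _ _
    have h3 := hs.sum_le_tsum (Finset.range M)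
      (fun j _ => mul_nonneg (norm_nonneg _) (apply_nonneg p _))
    have h4 := hC _ (hlev M)
    rw [hnorm] at h4
    linarith
  have hlim := ((tendsto_sum_nat_add
    (fun j => ‖PowerSeries.coeff j (f : ℂ⟦X⟧)‖ * N.w k j)).const_mul C).add_const
      (∑' j, ‖PowerSeries.coeff j (f : ℂ⟦X⟧)‖ * p (N.tPow h j))
  rw [mul_zero, zero_add] at hlim
  exact ge_of_tendsto' hlim hbound

theorem exists_weights (h : Set.Ico 0 N.S) {v : ℕ → ℝ} (hv : ∀ j, 0 ≤ v j)
    (H : ∀ k : Set.Ioo 0 N.S, (h : ℝ) < k → ∃ C : ℝ, ∀ j, v j ≤ C * N.w k j) :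
    ∃ u : ℕ → ℝ, (∀ j, 0 ≤ u j) ∧ (∀ i j, v (i + j) ≤ u i * u j) ∧
      ∀ k : Set.Ioo 0 N.S, (h : ℝ) < k → ∃ C : ℝ, ∀ j, u j ≤ C * N.w k j := by
  have hS : 0 < N.S - h := sub_pos.2 h.2.2
  have h0 : (0 : ℝ) ≤ h := h.2.1
  let k : ℕ → Set.Ioo 0 N.S := fun m => ⟨h + (N.S - h) / (m + 2), by positivity, by
    have : (N.S - h) / (m + 2) < N.S - h := div_lt_self hS (by linarith [m.cast_nonneg (α := ℝ)])
    linarith⟩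
  have hk : ∀ m, (h : ℝ) < k m := fun m => by
    change (h : ℝ) < h + (N.S - h) / (m + 2)
    have : 0 < (N.S - h) / (m + 2) := by positivity
    linarith
  have hanti : ∀ m n, m ≤ n → (k n : ℝ) ≤ k m := fun m n hmn => by
    change h + (N.S - h) / (n + 2) ≤ h + (N.S - h) / (m + 2)
    have : (m : ℝ) ≤ n := by exact_mod_cast hmn
    gcongr
  have hlim : ∀ l : Set.Ioo 0 N.S, (h : ℝ) < l → ∃ m, (k m : ℝ) ≤ l := fun l hl => by
    obtain ⟨m, hm⟩ := exists_nat_gt ((N.S - h) / (l - h))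
    refine ⟨m, ?_⟩
    change h + (N.S - h) / (m + 2) ≤ l
    have hl' : 0 < (l : ℝ) - h := sub_pos.2 hl
    have : (N.S - h) / (m + 2) ≤ l - h := by
      rw [div_le_iff₀ (by positivity)]
      rw [div_lt_iff₀ hl'] at hm
      nlinarith
    linarith
  choose C hC using fun m => H (k m) (hk m)
  have hK : ∀ m n, ∃ K : ℝ, 0 < K ∧ (m ≤ n → ∀ j, N.w (k n) j ≤ K * N.w (k m) j) := fun m n => by
    by_cases hmn : m ≤ n
    · obtain ⟨K, hK, hK'⟩ := N.exists_le_mul (k n).2 (k m).2 (hanti m n hmn)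
      exact ⟨K, hK, fun _ => hK'⟩
    · exact ⟨1, one_pos, fun h => absurd h hmn⟩
  choose K hK0 hK using hK
  let D : ℕ → ℝ := fun n => 1 + ∑ m ∈ Finset.range (n + 1), |C n| * K m n
  have hD1 : ∀ n, 1 ≤ D n := fun n => by
    have : 0 ≤ ∑ m ∈ Finset.range (n + 1), |C n| * K m n :=
      Finset.sum_nonneg fun m _ => mul_nonneg (abs_nonneg _) (hK0 m n).le
    simp only [D]; linarith
  have hD : ∀ m n, m ≤ n → |C n| * K m n ≤ D n := fun m n hmn => by
    have := Finset.single_le_sum (f := fun m => |C n| * K m n)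
      (fun m _ => mul_nonneg (abs_nonneg _) (hK0 m n).le)
      (Finset.mem_range.2 (Nat.lt_succ_of_le hmn))
    simp only [D]; linarith
  have hw : ∀ m j, 0 < N.w (k m) j := fun m j => N.pos _ (k m).2 j
  have hDw : ∀ m j, 0 ≤ D m * N.w (k m) j := fun m j =>
    mul_nonneg (zero_le_one.trans (hD1 m)) (hw m j).le
  have key : ∀ i j m n, m ≤ n →
      v (i + j) ≤ (D m * N.w (k m) i) * (D n * N.w (k n) j) := fun i j m n hmn => by
    calc v (i + j) ≤ C n * N.w (k n) (i + j) := hC n _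
      _ ≤ |C n| * N.w (k n) (i + j) := by gcongr; exact (hw n _).le; exact le_abs_self _
      _ ≤ |C n| * (N.w (k n) i * N.w (k n) j) := by
          gcongr; exact N.banach_algebra _ (k n).2 i j
      _ ≤ |C n| * ((K m n * N.w (k m) i) * N.w (k n) j) := by
          gcongr
          · exact (hw n j).le
          · exact hK m n hmn i
      _ = (|C n| * K m n) * (N.w (k m) i * N.w (k n) j) := by ring
      _ ≤ D n * (N.w (k m) i * N.w (k n) j) := by
          gcongr
          · exact mul_nonneg (hw m i).le (hw n j).le
          · exact hD m n hmn
      _ ≤ D m * (D n * (N.w (k m) i * N.w (k n) j)) :=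
          le_mul_of_one_le_left (mul_nonneg (zero_le_one.trans (hD1 n))
            (mul_nonneg (hw m i).le (hw n j).le)) (hD1 m)
      _ = _ := by ring
  let u : ℕ → ℝ≥0 := fun j => ⨅ m, (⟨D m * N.w (k m) j, hDw m j⟩ : ℝ≥0)
  refine ⟨fun j => u j, fun j => (u j).2, fun i j => ?_, fun l hl => ?_⟩
  · have : (⟨v (i + j), hv _⟩ : ℝ≥0) ≤ u i * u j := by
      refine NNReal.le_iInf_mul_iInf fun m n => ?_
      change v (i + j) ≤ (D m * N.w (k m) i) * (D n * N.w (k n) j)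
      rcases le_total m n with hmn | hmn
      · exact key i j m n hmn
      · rw [mul_comm, add_comm]
        exact key j i n m hmn
    exact_mod_cast this
  · obtain ⟨m, hm⟩ := hlim l hl
    obtain ⟨K', hK', hK''⟩ := N.exists_le_mul (k m).2 l.2 hm
    refine ⟨D m * K', fun j => ?_⟩
    have h1 : u j ≤ (⟨D m * N.w (k m) j, hDw m j⟩ : ℝ≥0) := ciInf_le (OrderBot.bddBelow _) m
    have h2 : (u j : ℝ) ≤ D m * N.w (k m) j := h1
    calc (u j : ℝ) ≤ D m * N.w (k m) j := h2
      _ ≤ D m * (K' * N.w l j) := by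
          gcongr
          · exact zero_le_one.trans (hD1 m)
          · exact hK'' j
      _ = _ := by ring

theorem exists_seminorm_mul_le (h : Set.Ico 0 N.S) {p : Seminorm ℂ (N.dirLim h)}
    (hp : p ∈ N.limitSeminorms h) :
    ∃ q ∈ N.limitSeminorms h, ∀ f g, p (f * g) ≤ q f * q g := by
  obtain ⟨u, hu0, hu, hu'⟩ := N.exists_weights h (v := fun j => p (N.tPow h j))
    (fun j => apply_nonneg p _) (fun k hk => by
      obtain ⟨C, hC⟩ := hp k hk
      refine ⟨C, fun j => ?_⟩
      have := hC (N.tPow h j) (N.X_pow_mem_level k j)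
      rwa [show ((N.tPow h j : N.dirLim h) : ℂ⟦X⟧) = PowerSeries.X ^ j from rfl,
        N.norm_X_pow] at this)
  have hle : ∀ k : Set.Ioo 0 N.S, (h : ℝ) < k → ∃ C : ℝ, ∀ f : ℂ⟦X⟧, f ∈ N.level k →
      (Summable fun j => ‖PowerSeries.coeff j f‖ * u j) ∧
      ∑' j, ‖PowerSeries.coeff j f‖ * u j ≤ C * N.norm k f := by
    intro k hk
    obtain ⟨C, hC⟩ := hu' k hk
    refine ⟨C, fun f hf => ?_⟩
    have hf' : Summable fun j => ‖PowerSeries.coeff j f‖ * N.w k j := hf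
    have hle : ∀ j, ‖PowerSeries.coeff j f‖ * u j ≤
        C * (‖PowerSeries.coeff j f‖ * N.w k j) := fun j => by
      calc _ ≤ ‖PowerSeries.coeff j f‖ * (C * N.w k j) := by gcongr; exact hC j
        _ = _ := by ring
    have hs := Summable.of_nonneg_of_le (fun j => mul_nonneg (norm_nonneg _) (hu0 j)) hle
      (hf'.mul_left C)
    refine ⟨hs, ?_⟩
    unfold norm
    rw [← tsum_mul_left]
    exact hs.tsum_le_tsum hle (hf'.mul_left C)
  have hsum : ∀ f : N.dirLim h, Summable fun j => ‖PowerSeries.coeff j (f : ℂ⟦X⟧)‖ * u j := by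
    intro f
    obtain ⟨k, hk, hf⟩ := f.2
    obtain ⟨C, hC⟩ := hle k hk
    exact (hC f hf).1
  let q : Seminorm ℂ (N.dirLim h) := Seminorm.of
    (fun f => ∑' j, ‖PowerSeries.coeff j (f : ℂ⟦X⟧)‖ * u j)
    (fun f g => (weighted_summable_add hu0 (hsum f) (hsum g)).2)
    (fun c f => by
      rw [← tsum_mul_left]
      refine tsum_congr fun j => ?_
      change ‖PowerSeries.coeff j (c • (f : ℂ⟦X⟧))‖ * u j = _
      rw [PowerSeries.coeff_smul, norm_smul, mul_assoc])
  refine ⟨q, fun k hk => ?_, fun f g => ?_⟩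
  · obtain ⟨C, hC⟩ := hle k hk
    exact ⟨C, fun f hf => (hC f hf).2⟩
  · exact (N.seminorm_le_tsum h hp (f * g)).2.trans
      (weighted_summable_mul (fun j => apply_nonneg p _) hu (hsum f) (hsum g)).2

open Filter in
instance (h : Set.Ico 0 N.S) : IsTopologicalRing (N.dirLim h) := by
  have hq : ∀ q ∈ N.limitSeminorms h, Tendsto q (𝓝 0) (𝓝 0) := fun q hq => by
    have := ((N.withSeminorms h).continuous_seminorm ⟨q, hq⟩).tendsto 0
    rwa [show N.seminormFamily h ⟨q, hq⟩ 0 = 0 from map_zero _] at this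
  have hleft : ∀ x₀ : N.dirLim h, Tendsto (fun x => x₀ * x) (𝓝 0) (𝓝 0) := by
    intro x₀
    rw [(N.withSeminorms h).tendsto_nhds]
    rintro ⟨p, hp⟩ ε hε
    obtain ⟨q, hqm, hpq⟩ := N.exists_seminorm_mul_le h hp
    have := (hq q hqm).const_mul (q x₀)
    rw [mul_zero] at this
    filter_upwards [this (Iio_mem_nhds hε)] with x hx
    rw [sub_zero]
    exact (hpq x₀ x).trans_lt hx
  refine IsTopologicalRing.of_addGroup_of_nhds_zero ?_ hleft ?_
  · rw [(N.withSeminorms h).tendsto_nhds]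
    rintro ⟨p, hp⟩ ε hε
    obtain ⟨q, hqm, hpq⟩ := N.exists_seminorm_mul_le h hp
    have := ((hq q hqm).comp tendsto_fst).mul ((hq q hqm).comp
      (tendsto_snd (f := 𝓝 (0 : N.dirLim h)) (g := 𝓝 (0 : N.dirLim h))))
    rw [mul_zero] at this
    filter_upwards [this (Iio_mem_nhds hε)] with x hx
    rw [sub_zero]
    exact (hpq x.1 x.2).trans_lt hx
  · intro x₀
    simpa only [mul_comm] using hleft x₀

/-- The topological ring `A`, the direct limit of the `A_h`, `h > 0`. -/
abbrev A : Subalgebra ℂ ℂ⟦X⟧ := N.dirLim ⟨0, le_rfl, N.S_pos⟩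

/-- The topological ring `A_ȟ`, the direct limit of the `A_k`, `k > h`. -/
abbrev Acheck (h : Set.Ioo 0 N.S) : Subalgebra ℂ ℂ⟦X⟧ := N.dirLim ⟨h, h.2.1.le, h.2.2⟩

end LevelNorms

end

/-! ### Weighted ℓ¹-norms of series in `t` and `z`. -/

noncomputable section


open scoped ENNReal
open Finset (HasAntidiagonal)

/-! The rings `A` and `A_ȟ` are both of the form `dirLim h` with `0 ≤ h < S`, so one argument serves
for both. In coordinates centred at `x`, germs of holomorphic functions with values in `dirLim h`
correspond to series `∑ F_α(t) z^α` whose weighted ℓ¹-norm is finite for some level `k > h` and some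
polydisc; these form the ring `germSeries`, and it suffices to prove that this ring is regular.

Analysis (`nonempty_stalk_equiv_germSeries`). A holomorphic function is continuous, hence bounded
for every continuous seminorm on a compact polydisc. A gliding hump argument (`exists_level_bound`)
shows that the coefficients of its values are then bounded in a single level, and Cauchy estimates
together with nuclearity give a finite ℓ¹-norm at a slightly lower level and on a smaller polydisc.
Conversely, a series of finite norm converges to a holomorphic map into a single Banach space `A_k`,
which maps continuously into `dirLim h`.

Algebra (`exists_division`). This is a division theorem of Grauert–Hironaka type, with leading
exponents taken modulo `t`. Exponents are ordered by the integer `∏ p_i^{α_i}`, and the radii are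
`p_i^{-s}`: the weight of `z^α` is this integer to the power `-s`, so for large `s` the leading
monomial outweighs all later ones. Because `R(k, j) → 0`, the norm in `t` is equivalent to one for
which multiplication by `t` is as small as desired (`renorm`). With both choices a Neumann series
carries out the division, and the level `k` does not change.

Division of `1` by a series with nonzero constant term shows that the ring is local; division by the
`z_i` shows that `t, z_1, …, z_n` generate the maximal ideal. Division by elements with the minimal
leading exponents of a prime ideal, combined with Cohen's theorem, gives noetherianity. A chain of
primes of length `n + 1` bounds the dimension from below, and regularity follows. -/

theorem ENNReal.tsum_sum_antidiagonal {A : Type*} [AddCommMonoid A] [HasAntidiagonal A]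
    (φ : A × A → ℝ≥0∞) :
    ∑' a, ∑ p ∈ HasAntidiagonal.antidiagonal a, φ p = ∑' p, φ p := by
  rw [← HasAntidiagonal.sigmaAntidiagonalEquivProd.tsum_eq, ENNReal.tsum_sigma']
  exact tsum_congr fun a => (Finset.tsum_subtype _ φ).symm

/-- Dominated convergence to zero for sums in `ℝ≥0∞`. -/
theorem ENNReal.tendsto_tsum_mul_zero {ι : Type*} {a : ι → ℝ≥0∞} (ha : ∑' i, a i ≠ ⊤)
    {c : ℕ → ι → ℝ≥0∞} (hc : ∀ m i, a i ≠ 0 → c m i ≤ 1)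
    (hlim : ∀ i, a i ≠ 0 → Filter.Tendsto (fun m => c m i) Filter.atTop (𝓝 0)) :
    Filter.Tendsto (fun m => ∑' i, a i * c m i) Filter.atTop (𝓝 0) := by
  let _ : MeasurableSpace ι := ⊤
  have hb : ∀ m i, a i * c m i ≤ a i := fun m i => by
    by_cases hi : a i = 0
    · simp [hi]
    · exact mul_le_of_le_one_right' (hc m i hi)
  have h := MeasureTheory.tendsto_lintegral_of_dominated_convergence
    (μ := MeasureTheory.Measure.count) (F := fun m i => a i * c m i) (f := fun _ => 0) a
    (fun m => measurable_from_top) (fun m => Filter.Eventually.of_forall (hb m))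
    (by rwa [MeasureTheory.lintegral_count]) (Filter.Eventually.of_forall fun i => by
      by_cases hi : a i = 0
      · simp [hi]
      · simpa using ENNReal.Tendsto.const_mul (hlim i hi)
          (Or.inr (ENNReal.ne_top_of_tsum_ne_top ha i)))
  simpa [MeasureTheory.lintegral_count] using h

/-- The weighted `ℓ¹`-norm of a power series. -/
def wnorm (u : ℕ → ℝ≥0∞) (f : ℂ⟦X⟧) : ℝ≥0∞ := ∑' j, ‖PowerSeries.coeff j f‖ₑ * u j

theorem wnorm_mono {u v : ℕ → ℝ≥0∞} (h : u ≤ v) (f : ℂ⟦X⟧) : wnorm u f ≤ wnorm v f :=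
  ENNReal.tsum_le_tsum fun j => by gcongr; exact h j

theorem wnorm_const_mul (c : ℝ≥0∞) (u : ℕ → ℝ≥0∞) (f : ℂ⟦X⟧) :
    wnorm (fun j => c * u j) f = c * wnorm u f := by
  simp_rw [wnorm, ← ENNReal.tsum_mul_left, mul_left_comm]

@[simp]
theorem wnorm_zero (u : ℕ → ℝ≥0∞) : wnorm u 0 = 0 := by simp [wnorm]

@[simp]
theorem wnorm_neg (u : ℕ → ℝ≥0∞) (f : ℂ⟦X⟧) : wnorm u (-f) = wnorm u f := by simp [wnorm]

theorem wnorm_add_le (u : ℕ → ℝ≥0∞) (f g : ℂ⟦X⟧) : wnorm u (f + g) ≤ wnorm u f + wnorm u g := by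
  simp_rw [wnorm, ← ENNReal.tsum_add, ← add_mul, map_add]
  exact ENNReal.tsum_le_tsum fun j => by gcongr; exact enorm_add_le _ _

theorem wnorm_sum_le {ι : Type*} (u : ℕ → ℝ≥0∞) (s : Finset ι) (f : ι → ℂ⟦X⟧) :
    wnorm u (∑ i ∈ s, f i) ≤ ∑ i ∈ s, wnorm u (f i) :=
  Finset.le_sum_of_subadditive _ (wnorm_zero u).le (wnorm_add_le u) _ _

/-- Three separate weights are allowed because the contraction estimate in the division theorem
measures one factor by `renorm` and the other by the smaller `shiftWeight`. -/
theorem wnorm_mul_le {u v w : ℕ → ℝ≥0∞} (H : ∀ i j, u (i + j) ≤ v i * w j) (f g : ℂ⟦X⟧) :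
    wnorm u (f * g) ≤ wnorm v f * wnorm w g := by
  simp_rw [wnorm, ← ENNReal.tsum_mul_right, ← ENNReal.tsum_mul_left]
  rw [← ENNReal.tsum_prod, ← ENNReal.tsum_sum_antidiagonal]
  refine ENNReal.tsum_le_tsum fun j => ?_
  rw [PowerSeries.coeff_mul]
  refine (mul_le_mul_left (enorm_sum_le _ _) _).trans ?_
  rw [Finset.sum_mul]
  refine Finset.sum_le_sum fun p hp => ?_
  rw [← HasAntidiagonal.mem_antidiagonal.1 hp, enorm_mul, mul_mul_mul_comm]
  gcongr
  exact H _ _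

theorem wnorm_C (u : ℕ → ℝ≥0∞) (c : ℂ) : wnorm u (PowerSeries.C c) = ‖c‖ₑ * u 0 := by
  rw [wnorm, tsum_eq_single 0 fun j hj => by simp [PowerSeries.coeff_C, hj]]
  simp

/-- The weighted `ℓ¹`-norm of a power series in several variables, with coefficients in `ℂ⟦t⟧`. -/
def gnorm {n : ℕ} (u : ℕ → ℝ≥0∞) (θ : (Fin n →₀ ℕ) → ℝ≥0∞) (F : MvPowerSeries (Fin n) ℂ⟦X⟧) :
    ℝ≥0∞ := ∑' α, wnorm u (MvPowerSeries.coeff α F) * θ α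

section

variable {n : ℕ} {u v w : ℕ → ℝ≥0∞} {θ η : (Fin n →₀ ℕ) → ℝ≥0∞}

theorem gnorm_mono (h : u ≤ v) (h' : θ ≤ η) (F : MvPowerSeries (Fin n) ℂ⟦X⟧) :
    gnorm u θ F ≤ gnorm v η F :=
  ENNReal.tsum_le_tsum fun α => mul_le_mul' (wnorm_mono h _) (h' α)

theorem gnorm_const_mul (c : ℝ≥0∞) (F : MvPowerSeries (Fin n) ℂ⟦X⟧) :
    gnorm (fun j => c * u j) θ F = c * gnorm u θ F := by
  simp_rw [gnorm, ← ENNReal.tsum_mul_left, wnorm_const_mul, mul_assoc]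

@[simp]
theorem gnorm_zero : gnorm u θ 0 = 0 := by simp [gnorm]

@[simp]
theorem gnorm_neg (F : MvPowerSeries (Fin n) ℂ⟦X⟧) : gnorm u θ (-F) = gnorm u θ F := by
  simp [gnorm]

theorem gnorm_add_le (F G : MvPowerSeries (Fin n) ℂ⟦X⟧) :
    gnorm u θ (F + G) ≤ gnorm u θ F + gnorm u θ G := by
  simp_rw [gnorm, ← ENNReal.tsum_add, ← add_mul, map_add]
  exact ENNReal.tsum_le_tsum fun j => by gcongr; exact wnorm_add_le _ _ _

theorem gnorm_sum_le {ι : Type*} (s : Finset ι) (F : ι → MvPowerSeries (Fin n) ℂ⟦X⟧) :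
    gnorm u θ (∑ i ∈ s, F i) ≤ ∑ i ∈ s, gnorm u θ (F i) :=
  Finset.le_sum_of_subadditive _ gnorm_zero.le gnorm_add_le _ _

theorem gnorm_mul_le (H : ∀ i j, u (i + j) ≤ v i * w j) (Hθ : ∀ α β, θ (α + β) ≤ θ α * θ β)
    (F G : MvPowerSeries (Fin n) ℂ⟦X⟧) :
    gnorm u θ (F * G) ≤ gnorm v θ F * gnorm w θ G := by
  classical
  simp_rw [gnorm, ← ENNReal.tsum_mul_right, ← ENNReal.tsum_mul_left]
  rw [← ENNReal.tsum_prod, ← ENNReal.tsum_sum_antidiagonal]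
  refine ENNReal.tsum_le_tsum fun α => ?_
  rw [MvPowerSeries.coeff_mul]
  refine (mul_le_mul_left (wnorm_sum_le _ _ _) _).trans ?_
  rw [Finset.sum_mul]
  refine Finset.sum_le_sum fun p hp => ?_
  rw [← HasAntidiagonal.mem_antidiagonal.1 hp, mul_mul_mul_comm]
  gcongr
  · exact wnorm_mul_le H _ _
  · exact Hθ _ _

theorem gnorm_monomial (α : Fin n →₀ ℕ) (f : ℂ⟦X⟧) :
    gnorm u θ (MvPowerSeries.monomial α f) = wnorm u f * θ α := by
  classical
  rw [gnorm, tsum_eq_single α fun β hβ => by simp [MvPowerSeries.coeff_monomial, hβ]]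
  simp

theorem gnorm_eq_tsum_prod (F : MvPowerSeries (Fin n) ℂ⟦X⟧) :
    gnorm u θ F = ∑' p : (Fin n →₀ ℕ) × ℕ,
      ‖PowerSeries.coeff p.2 (MvPowerSeries.coeff p.1 F)‖ₑ * u p.2 * θ p.1 := by
  simp_rw [ENNReal.tsum_prod', gnorm, wnorm, ENNReal.tsum_mul_right]

theorem enorm_coeff_le_gnorm (F : MvPowerSeries (Fin n) ℂ⟦X⟧) (α : Fin n →₀ ℕ) (j : ℕ) :
    ‖PowerSeries.coeff j (MvPowerSeries.coeff α F)‖ₑ * u j * θ α ≤ gnorm u θ F := by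
  rw [gnorm_eq_tsum_prod]
  exact ENNReal.le_tsum (f := fun p : (Fin n →₀ ℕ) × ℕ =>
    ‖PowerSeries.coeff p.2 (MvPowerSeries.coeff p.1 F)‖ₑ * u p.2 * θ p.1) (α, j)

end

/-! ### Monomial order and polyradii from prime numbers. -/

/-- The monomial `z ^ α` with the `i`-th variable replaced by the `i`-th prime number. -/
def primeMonomial {n : ℕ} (α : Fin n →₀ ℕ) : ℕ := ∏ i : Fin n, Nat.nth Nat.Prime i ^ α i

section

variable {n : ℕ}

theorem prime_nth (i : ℕ) : (Nat.nth Nat.Prime i).Prime :=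
  Nat.nth_mem_of_infinite Nat.infinite_setOfPred_prime i

theorem primeMonomial_pos (α : Fin n →₀ ℕ) : 0 < primeMonomial α :=
  Finset.prod_pos fun i _ => pow_pos (prime_nth i).pos _

@[simp]
theorem primeMonomial_zero : primeMonomial (0 : Fin n →₀ ℕ) = 1 := by simp [primeMonomial]

theorem primeMonomial_add (α β : Fin n →₀ ℕ) :
    primeMonomial (α + β) = primeMonomial α * primeMonomial β := by
  simp [primeMonomial, pow_add, Finset.prod_mul_distrib]

/-- Unique factorization. Hence comparing values of `primeMonomial` is a total well-order on
exponents, compatible with addition. -/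
theorem primeMonomial_injective : Function.Injective (primeMonomial (n := n)) := by
  have hinj : Function.Injective fun i : Fin n => Nat.nth Nat.Prime i := fun i j h =>
    Fin.ext (Nat.nth_injective Nat.infinite_setOfPred_prime h)
  have key : ∀ α : Fin n →₀ ℕ, (primeMonomial α).factorization =
      α.mapDomain fun i : Fin n => Nat.nth Nat.Prime i := fun α => by
    have h1 : primeMonomial α =
        (α.mapDomain fun i : Fin n => Nat.nth Nat.Prime i).prod (· ^ ·) := by
      rw [Finsupp.prod_mapDomain_index (by simp) (by simp [pow_add]), Finsupp.prod_fintype _ _ (by simp)]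
      rfl
    rw [h1]
    refine Nat.prod_pow_factorization_eq_self fun p hp => ?_
    obtain ⟨i, -, rfl⟩ := Finset.mem_image.1 (Finsupp.mapDomain_support hp)
    exact prime_nth i
  intro α β h
  refine Finsupp.mapDomain_injective hinj ?_
  rw [← key, ← key, h]

/-- The weight `|z ^ α|` at the point `z_i = p_i ^ (-s)`. -/
def primeWeight (s : ℕ) (α : Fin n →₀ ℕ) : ℝ≥0∞ := ((primeMonomial α : ℝ≥0∞) ^ s)⁻¹

theorem primeWeight_ne_zero (s : ℕ) (α : Fin n →₀ ℕ) : primeWeight s α ≠ 0 :=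
  ENNReal.inv_ne_zero.2 (ENNReal.pow_ne_top (ENNReal.natCast_ne_top _))

theorem primeWeight_ne_top (s : ℕ) (α : Fin n →₀ ℕ) : primeWeight s α ≠ ⊤ :=
  ENNReal.inv_ne_top.2 (pow_ne_zero _ (Nat.cast_ne_zero.2 (primeMonomial_pos α).ne'))

theorem primeWeight_add (s : ℕ) (α β : Fin n →₀ ℕ) :
    primeWeight s (α + β) = primeWeight s α * primeWeight s β := by
  rw [primeWeight, primeWeight, primeWeight, primeMonomial_add, Nat.cast_mul, mul_pow,
    ENNReal.mul_inv (Or.inr (ENNReal.pow_ne_top (ENNReal.natCast_ne_top _)))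
    (Or.inl (ENNReal.pow_ne_top (ENNReal.natCast_ne_top _)))]

theorem primeWeight_add_left (s t : ℕ) (α : Fin n →₀ ℕ) :
    primeWeight (s + t) α = primeWeight s α * primeWeight t α := by
  rw [primeWeight, primeWeight, primeWeight, pow_add,
    ENNReal.mul_inv (Or.inr (ENNReal.pow_ne_top (ENNReal.natCast_ne_top _)))
    (Or.inl (ENNReal.pow_ne_top (ENNReal.natCast_ne_top _)))]

theorem primeWeight_le_one (s : ℕ) (α : Fin n →₀ ℕ) : primeWeight s α ≤ 1 :=
  ENNReal.inv_le_one.2 (one_le_pow₀ (by exact_mod_cast primeMonomial_pos α))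

theorem primeWeight_anti {s t : ℕ} (h : s ≤ t) :
    primeWeight t ≤ (primeWeight s : (Fin n →₀ ℕ) → ℝ≥0∞) := fun α => by
  obtain ⟨m, rfl⟩ := Nat.exists_eq_add_of_le h
  rw [primeWeight_add_left]
  exact mul_le_of_le_one_right' (primeWeight_le_one _ _)

/-- By injectivity of `primeMonomial` the sum is dominated by `∑ 1 / m²`. Raising the exponent of
the radii by two thus turns bounded coefficients into summable ones. -/
theorem tsum_primeWeight_two_ne_top : ∑' α : Fin n →₀ ℕ, primeWeight 2 α ≠ ⊤ := by
  have h : ∑' m : ℕ, ((m : ℝ≥0∞) ^ 2)⁻¹ * (if m = 0 then 0 else 1) ≠ ⊤ := by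
    have h1 : Summable fun m : ℕ => ((m : ℝ≥0) ^ 2)⁻¹ := by
      rw [← NNReal.summable_coe]
      simp
    refine ne_top_of_le_ne_top (ENNReal.tsum_coe_ne_top_iff_summable.2 h1)
      (ENNReal.tsum_le_tsum fun m => ?_)
    split_ifs with hm
    · simp
    · rw [mul_one, ENNReal.coe_inv (by positivity)]
      simp
  refine ne_top_of_le_ne_top h (le_trans (ENNReal.tsum_le_tsum fun α => ?_)
    (ENNReal.tsum_comp_le_tsum_of_injective primeMonomial_injective _))
  simp [primeWeight, (primeMonomial_pos α).ne']

/-- Weights at higher exponents of a series all of whose exponents lie beyond `a` become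
negligible compared with the weight at `a`. -/
theorem tendsto_tsum_primeWeight_div (a : Fin n →₀ ℕ) {c : (Fin n →₀ ℕ) → ℝ≥0∞} {s : ℕ}
    (hc : ∑' α, c α * primeWeight s α ≠ ⊤)
    (ha : ∀ α, c α ≠ 0 → primeMonomial a < primeMonomial α) :
    Filter.Tendsto (fun m => ∑' α, c α * primeWeight (s + m) α / primeWeight (s + m) a)
      Filter.atTop (𝓝 0) := by
  -- Each further power of the radii multiplies the term at `α` by the fixed ratio of the integers
  -- at `a` and `α`, which is less than one wherever `c α ≠ 0`; dominated convergence applies.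
  have h : ∀ m α, c α * primeWeight (s + m) α / primeWeight (s + m) a =
      (c α * primeWeight s α) * (primeWeight s a)⁻¹ *
        ((primeMonomial a : ℝ≥0∞) / primeMonomial α) ^ m := fun m α => by
    have h0 : (primeMonomial α : ℝ≥0∞) ≠ 0 := by exact_mod_cast (primeMonomial_pos α).ne'
    have h1 : (primeMonomial α : ℝ≥0∞) ≠ ⊤ := ENNReal.natCast_ne_top _
    rw [primeWeight_add_left, primeWeight_add_left, div_eq_mul_inv, div_eq_mul_inv, mul_pow,
      ENNReal.mul_inv (Or.inl (primeWeight_ne_zero _ _)) (Or.inl (primeWeight_ne_top _ _)),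
      primeWeight, primeWeight, primeWeight, primeWeight, inv_inv, inv_inv, ENNReal.inv_pow,
      ENNReal.inv_pow]
    ring
  simp_rw [h]
  refine ENNReal.tendsto_tsum_mul_zero ?_ (fun m α hα => ?_) (fun α hα => ?_)
  · rw [ENNReal.tsum_mul_right]
    exact ENNReal.mul_ne_top hc (ENNReal.inv_ne_top.2 (primeWeight_ne_zero _ _))
  all_goals
    have hlt : (primeMonomial a : ℝ≥0∞) / primeMonomial α < 1 := by
      refine ENNReal.div_lt_of_lt_mul' ?_
      rw [mul_one]
      exact_mod_cast ha α fun h => hα (by simp [h])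
  · exact pow_le_one₀ (by simp) hlt.le
  · exact ENNReal.tendsto_pow_atTop_nhds_zero_of_lt_one hlt

end

/-! ### Equivalent norms for which `t` is small. -/

/-- A submultiplicative weight, equivalent to `w` if `w` decays faster than any geometric
sequence, for which multiplication by `t` has norm at most `M⁻¹`. -/
def renorm (w : ℕ → ℝ≥0∞) (M : ℕ) (j : ℕ) : ℝ≥0∞ := ⨆ l, w (j + l) * (M : ℝ≥0∞) ^ l

theorem le_renorm (w : ℕ → ℝ≥0∞) (M j : ℕ) : w j ≤ renorm w M j :=
  le_iSup_of_le (f := fun l => w (j + l) * (M : ℝ≥0∞) ^ l) 0 (by simp)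

/-- Together with `le_renorm` this makes the two weights equivalent as soon as `renorm w M 0` is
finite. -/
theorem renorm_le {w : ℕ → ℝ≥0∞} (hw : ∀ i j, w (i + j) ≤ w i * w j) (M j : ℕ) :
    renorm w M j ≤ renorm w M 0 * w j := by
  refine iSup_le fun l => ?_
  calc _ ≤ w j * w l * (M : ℝ≥0∞) ^ l := by gcongr; exact hw _ _
    _ = (w (0 + l) * (M : ℝ≥0∞) ^ l) * w j := by rw [zero_add]; ring
    _ ≤ _ := by gcongr; exact le_iSup (fun l => w (0 + l) * (M : ℝ≥0∞) ^ l) l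

/-- The factor `w j` comes from submultiplicativity of `w`, the factor `M^{-j}` from reindexing the
supremum by `l ↦ j + l`. -/
theorem renorm_add_le {w : ℕ → ℝ≥0∞} (hw : ∀ i j, w (i + j) ≤ w i * w j) {M : ℕ} (hM : M ≠ 0)
    (i j : ℕ) : renorm w M (i + j) ≤ renorm w M i * min (w j) (((M : ℝ≥0∞) ^ j)⁻¹) := by
  have h0 : (M : ℝ≥0∞) ^ j ≠ 0 := pow_ne_zero _ (by exact_mod_cast hM)
  have h1 : (M : ℝ≥0∞) ^ j ≠ ⊤ := ENNReal.pow_ne_top (ENNReal.natCast_ne_top _)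
  rcases min_choice (w j) (((M : ℝ≥0∞) ^ j)⁻¹) with h | h <;> rw [h]
  · refine iSup_le fun l => ?_
    calc _ = w ((i + l) + j) * (M : ℝ≥0∞) ^ l := by rw [add_right_comm]
      _ ≤ w (i + l) * w j * (M : ℝ≥0∞) ^ l := by gcongr; exact hw _ _
      _ = (w (i + l) * (M : ℝ≥0∞) ^ l) * w j := by ring
      _ ≤ _ := by gcongr; exact le_iSup (fun l => w (i + l) * (M : ℝ≥0∞) ^ l) l
  · refine iSup_le fun l => ?_
    rw [← div_eq_mul_inv, ENNReal.le_div_iff_mul_le (Or.inl h0) (Or.inl h1)]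
    refine le_iSup_of_le (f := fun l => w (i + l) * (M : ℝ≥0∞) ^ l) (j + l) ?_
    rw [pow_add, add_assoc]
    exact (by ring : _ = _).le

end

/-! ### Division with remainder. -/

noncomputable section

open scoped ENNReal

theorem HasSum.enorm_le_tsum {ι : Type*} {f : ι → ℂ} {s : ℂ} (h : HasSum f s) :
    ‖s‖ₑ ≤ ∑' i, ‖f i‖ₑ :=
  le_of_tendsto ((continuous_enorm.tendsto s).comp h)
    (Filter.Eventually.of_forall fun t => (enorm_sum_le t f).trans (ENNReal.sum_le_tsum t))

section

variable {n : ℕ}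

open PowerSeries.WithPiTopology MvPowerSeries.WithPiTopology in
/-- A linear operator on series that is contracting for a weighted norm and continuous
coefficientwise has `1 - E` surjective on the series of finite norm. -/
theorem exists_eq_add_of_contracting {u : ℕ → ℝ≥0∞} {θ : (Fin n →₀ ℕ) → ℝ≥0∞}
    (hu : ∀ j, u j ≠ 0) (hθ : ∀ α, θ α ≠ 0)
    (E : MvPowerSeries (Fin n) ℂ⟦X⟧ →+ MvPowerSeries (Fin n) ℂ⟦X⟧) (hE : Continuous E)
    (hE' : ∀ H, gnorm u θ (E H) ≤ 2⁻¹ * gnorm u θ H)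
    {G : MvPowerSeries (Fin n) ℂ⟦X⟧} (hG : gnorm u θ G ≠ ⊤) :
    ∃ H, gnorm u θ H ≠ ⊤ ∧ H = G + E H := by
  -- The terms of the Neumann series `∑ E^l G`.
  let g : ℕ → MvPowerSeries (Fin n) ℂ⟦X⟧ := fun l => E^[l] G
  have hg : ∀ l, gnorm u θ (g l) ≤ 2⁻¹ ^ l * gnorm u θ G := fun l => by
    induction l with
    | zero => simp [g]
    | succ l ih =>
      simp only [g, Function.iterate_succ_apply']
      refine (hE' _).trans ?_
      rw [pow_succ', mul_assoc]
      gcongr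
  have hsum : ∑' l, gnorm u θ (g l) ≠ ⊤ := by
    refine ne_top_of_le_ne_top ?_ (ENNReal.tsum_le_tsum hg)
    rw [ENNReal.tsum_mul_right, ENNReal.tsum_geometric, ENNReal.one_sub_inv_two, inv_inv]
    exact ENNReal.mul_ne_top (by simp) hG
  -- Nonvanishing weights turn summability of the norms into summability of every coefficient, that
  -- is, convergence in the product topology, where `E` is continuous and may be applied termwise.
  have hcoeff : ∀ α j, Summable fun l => PowerSeries.coeff j (MvPowerSeries.coeff α (g l)) := by
    intro α j
    have h1 : (∑' l, ‖PowerSeries.coeff j (MvPowerSeries.coeff α (g l))‖ₑ) * (u j * θ α) ≠ ⊤ := by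
      rw [← ENNReal.tsum_mul_right]
      refine ne_top_of_le_ne_top hsum (ENNReal.tsum_le_tsum fun l => ?_)
      rw [← mul_assoc]
      exact enorm_coeff_le_gnorm _ _ _
    have h2 := ENNReal.lt_top_of_mul_ne_top_left h1 (mul_ne_zero (hu j) (hθ α))
    have h3 : Summable fun l => ‖PowerSeries.coeff j (MvPowerSeries.coeff α (g l))‖₊ :=
      ENNReal.tsum_coe_ne_top_iff_summable.1 h2.ne
    exact h3.of_nnnorm
  have hs : Summable g := by
    rw [MvPowerSeries.WithPiTopology.summable_iff_summable_coeff]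
    intro α
    rw [PowerSeries.WithPiTopology.summable_iff_summable_coeff]
    exact hcoeff α
  obtain ⟨H, hH⟩ := hs
  have hH' : ∀ α j, HasSum (fun l => PowerSeries.coeff j (MvPowerSeries.coeff α (g l)))
      (PowerSeries.coeff j (MvPowerSeries.coeff α H)) := fun α j =>
    (PowerSeries.WithPiTopology.hasSum_iff_hasSum_coeff ℂ).1
      (MvPowerSeries.WithPiTopology.hasSum_iff_hasSum_coeff.1 hH α) j
  refine ⟨H, ne_top_of_le_ne_top hsum ?_, ?_⟩
  · simp_rw [gnorm_eq_tsum_prod]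
    rw [ENNReal.tsum_comm]
    refine ENNReal.tsum_le_tsum fun p => ?_
    simp_rw [ENNReal.tsum_mul_right]
    gcongr
    exact (hH' p.1 p.2).enorm_le_tsum
  · have h1 : HasSum (fun l => g (l + 1)) (E H) := by
      simp only [g, Function.iterate_succ_apply']
      exact hH.map E hE
    have h2 := (hasSum_nat_add_iff (f := g) 1).1 h1
    refine (hH.unique h2).trans ?_
    simp [g, add_comm]

/-- `a` is the least exponent (for the order given by `primeMonomial`) of `F` modulo `t`. -/
def IsLeadingExponent (F : MvPowerSeries (Fin n) ℂ⟦X⟧) (a : Fin n →₀ ℕ) : Prop :=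
  PowerSeries.constantCoeff (MvPowerSeries.coeff a F) ≠ 0 ∧
    ∀ β, primeMonomial β < primeMonomial a →
      PowerSeries.constantCoeff (MvPowerSeries.coeff β F) = 0

theorem exists_isLeadingExponent {F : MvPowerSeries (Fin n) ℂ⟦X⟧}
    (h : ∃ α, PowerSeries.constantCoeff (MvPowerSeries.coeff α F) ≠ 0) :
    ∃ a, IsLeadingExponent F a := by
  obtain ⟨a, ha, hmin⟩ := (measure (primeMonomial (n := n))).wf.has_min
    {α | PowerSeries.constantCoeff (MvPowerSeries.coeff α F) ≠ 0} h
  exact ⟨a, ha, fun β hβ => by_contra fun h => hmin β h hβ⟩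

/-- The weights by which the norm `renorm w M` is multiplied under multiplication by `t ^ j`. -/
def shiftWeight (w : ℕ → ℝ≥0∞) (M j : ℕ) : ℝ≥0∞ := min (w j) (((M : ℝ≥0∞) ^ j)⁻¹)

theorem shiftWeight_le (w : ℕ → ℝ≥0∞) (M : ℕ) : shiftWeight w M ≤ w := fun _ => min_le_left _ _

/-- Separates the part free of `t`, which only small radii can control, from the part divisible by
`t`, which a large `M` controls. -/
theorem gnorm_shiftWeight_le (w : ℕ → ℝ≥0∞) (M : ℕ) (θ : (Fin n →₀ ℕ) → ℝ≥0∞)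
    (F : MvPowerSeries (Fin n) ℂ⟦X⟧) :
    gnorm (shiftWeight w M) θ F ≤
      ∑' α, ‖PowerSeries.constantCoeff (MvPowerSeries.coeff α F)‖ₑ * θ α +
      gnorm (fun j => if j = 0 then 0 else shiftWeight w M j) θ F := by
  simp_rw [gnorm, ← ENNReal.tsum_add, ← add_mul]
  refine ENNReal.tsum_le_tsum fun α => ?_
  gcongr
  rw [wnorm, wnorm, ← tsum_ite_eq (0 : ℕ) fun _ =>
    ‖PowerSeries.constantCoeff (MvPowerSeries.coeff α F)‖ₑ, ← ENNReal.tsum_add]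
  refine ENNReal.tsum_le_tsum fun j => ?_
  rcases eq_or_ne j 0 with rfl | hj
  · have h : shiftWeight w M 0 ≤ 1 := (min_le_right _ _).trans (by simp)
    simpa using mul_le_of_le_one_right' h
  · simp [hj]

/-- For `j ≥ 1` the weight is at most `M^{-j}`, hence tends to zero, while it stays below `w j`:
dominated convergence over all pairs `(α, j)`. -/
theorem tendsto_gnorm_shiftWeight {w : ℕ → ℝ≥0∞} (hw : ∀ j, w j ≠ 0) (hw' : ∀ j, w j ≠ ⊤)
    {θ : (Fin n →₀ ℕ) → ℝ≥0∞} {F : MvPowerSeries (Fin n) ℂ⟦X⟧} (hF : gnorm w θ F ≠ ⊤) :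
    Filter.Tendsto (fun M => gnorm (fun j => if j = 0 then 0 else shiftWeight w M j) θ F)
      Filter.atTop (𝓝 0) := by
  rw [gnorm_eq_tsum_prod] at hF
  have h := ENNReal.tendsto_tsum_mul_zero hF
    (c := fun M p => (if p.2 = 0 then 0 else shiftWeight w M p.2) / w p.2)
    (fun M p _ => by
      refine ENNReal.div_le_of_le_mul ?_
      split_ifs
      · simp
      · simpa using shiftWeight_le w M p.2)
    (fun p _ => by
      by_cases hp : p.2 = 0
      · simp [hp]
      · simp only [hp, if_false]
        have h0 : Filter.Tendsto (fun M : ℕ => ((M : ℝ≥0∞) ^ p.2)⁻¹) Filter.atTop (𝓝 0) := by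
          simpa [ENNReal.inv_pow, hp, Function.comp_def] using
            ((ENNReal.continuous_pow p.2).tendsto 0).comp ENNReal.tendsto_inv_nat_nhds_zero
        have h1 : Filter.Tendsto (fun M : ℕ => shiftWeight w M p.2) Filter.atTop (𝓝 0) :=
          tendsto_of_tendsto_of_tendsto_of_le_of_le tendsto_const_nhds h0 (fun _ => zero_le)
            (fun _ => min_le_right _ _)
        simpa using ENNReal.Tendsto.div_const h1 (Or.inr (hw p.2)))
  refine h.congr fun M => ?_
  rw [gnorm_eq_tsum_prod]
  refine tsum_congr fun p => ?_
  rw [div_eq_mul_inv, mul_right_comm]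
  congr 1
  rw [mul_mul_mul_comm, mul_assoc, ENNReal.mul_inv_cancel (hw _) (hw' _), mul_one]

/-- For a suitable choice of norms, the series `e i` all of whose exponents modulo `t` lie beyond
`a i` are small compared with `z ^ a i`. -/
theorem exists_gnorm_shiftWeight_le {w : ℕ → ℝ≥0∞} (hw : ∀ j, w j ≠ 0) (hw' : ∀ j, w j ≠ ⊤)
    {ι : Type*} [Finite ι] {e : ι → MvPowerSeries (Fin n) ℂ⟦X⟧} {a : ι → Fin n →₀ ℕ} {s : ℕ}
    (he : ∀ i, gnorm w (primeWeight s) (e i) ≠ ⊤)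
    (hea : ∀ i α, PowerSeries.constantCoeff (MvPowerSeries.coeff α (e i)) ≠ 0 →
      primeMonomial (a i) < primeMonomial α) {δ : ℝ≥0∞} (hδ : δ ≠ 0) :
    ∃ s' M, s ≤ s' ∧ M ≠ 0 ∧
      ∀ i, gnorm (shiftWeight w M) (primeWeight s') (e i) ≤ δ * primeWeight s' (a i) := by
  have hδ2 : 0 < δ / 2 := ENNReal.half_pos hδ
  -- The radii are fixed first: the part free of `t` does not involve `M`, whereas the choice of `M`
  -- below depends on the radii.
  have h1 : ∀ i, ∀ᶠ m in Filter.atTop,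
      ∑' α, ‖PowerSeries.constantCoeff (MvPowerSeries.coeff α (e i))‖ₑ * primeWeight (s + m) α
        ≤ δ / 2 * primeWeight (s + m) (a i) := fun i => by
    have hfin : ∑' α, ‖PowerSeries.constantCoeff (MvPowerSeries.coeff α (e i))‖ₑ *
        primeWeight s α ≠ ⊤ := by
      have : (∑' α, ‖PowerSeries.constantCoeff (MvPowerSeries.coeff α (e i))‖ₑ *
          primeWeight s α) * w 0 ≠ ⊤ := by
        rw [← ENNReal.tsum_mul_right]
        refine ne_top_of_le_ne_top (he i) (ENNReal.tsum_le_tsum fun α => ?_)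
        rw [mul_right_comm]
        gcongr
        rw [← PowerSeries.coeff_zero_eq_constantCoeff_apply]
        exact ENNReal.le_tsum (f := fun j =>
          ‖PowerSeries.coeff j (MvPowerSeries.coeff α (e i))‖ₑ * w j) 0
      exact (ENNReal.lt_top_of_mul_ne_top_left this (hw 0)).ne
    have := tendsto_tsum_primeWeight_div (a i) hfin fun α hα => hea i α (by simpa using hα)
    filter_upwards [this.eventually_lt_const hδ2] with m hm
    simp_rw [div_eq_mul_inv] at hm
    rw [ENNReal.tsum_mul_right, ← div_eq_mul_inv] at hm
    exact (ENNReal.div_le_iff (primeWeight_ne_zero _ _) (primeWeight_ne_top _ _)).1 hm.le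
  obtain ⟨m, hm⟩ := (Filter.eventually_all.2 h1).exists
  have h2 : ∀ i, ∀ᶠ M in Filter.atTop,
      gnorm (fun j => if j = 0 then 0 else shiftWeight w M j) (primeWeight (s + m)) (e i)
        ≤ δ / 2 * primeWeight (s + m) (a i) := fun i =>
    (tendsto_gnorm_shiftWeight hw hw' (ne_top_of_le_ne_top (he i)
      (gnorm_mono le_rfl (primeWeight_anti (s.le_add_right m)) _))).eventually_le_const
      (ENNReal.mul_pos hδ2.ne' (primeWeight_ne_zero _ _))
  obtain ⟨M, hM, hM0⟩ := ((Filter.eventually_all.2 h2).and (Filter.eventually_ne_atTop 0)).exists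
  refine ⟨s + m, M, s.le_add_right m, hM0, fun i => ?_⟩
  refine (gnorm_shiftWeight_le w M _ _).trans ((add_le_add (hm i) (hM i)).trans ?_)
  rw [← add_mul, ENNReal.add_halves]

/-- The quotient by `z ^ a` of the part of a series supported on the exponents in
`p ∩ (a + ℕⁿ)`. -/
def quotMonomial (p : (Fin n →₀ ℕ) → Prop) [DecidablePred p] (a : Fin n →₀ ℕ) :
    MvPowerSeries (Fin n) ℂ⟦X⟧ →+ MvPowerSeries (Fin n) ℂ⟦X⟧ where
  toFun H := fun β => if p (β + a) then MvPowerSeries.coeff (β + a) H else 0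
  map_zero' := by
    funext β
    split_ifs <;> rfl
  map_add' G H := by
    funext β
    change _ = (if p (β + a) then MvPowerSeries.coeff (β + a) G else 0) +
      (if p (β + a) then MvPowerSeries.coeff (β + a) H else 0)
    split_ifs
    · rfl
    · rw [add_zero]

section

variable (p : (Fin n →₀ ℕ) → Prop) [DecidablePred p] (a : Fin n →₀ ℕ)

theorem coeff_quotMonomial (H : MvPowerSeries (Fin n) ℂ⟦X⟧) (β : Fin n →₀ ℕ) :
    MvPowerSeries.coeff β (quotMonomial p a H) =
      if p (β + a) then MvPowerSeries.coeff (β + a) H else 0 := rfl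

open PowerSeries.WithPiTopology MvPowerSeries.WithPiTopology in
theorem continuous_quotMonomial : Continuous (quotMonomial p a) := by
  refine continuous_pi fun β => ?_
  change Continuous fun H => if p (β + a) then MvPowerSeries.coeff (β + a) H else 0
  split_ifs
  · exact MvPowerSeries.WithPiTopology.continuous_coeff _ _
  · exact continuous_const

theorem gnorm_quotMonomial_le (u : ℕ → ℝ≥0∞) (s : ℕ) (H : MvPowerSeries (Fin n) ℂ⟦X⟧) :
    gnorm u (primeWeight s) (quotMonomial p a H) ≤
      gnorm u (primeWeight s) H / primeWeight s a := by
  rw [ENNReal.le_div_iff_mul_le (Or.inl (primeWeight_ne_zero _ _))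
    (Or.inl (primeWeight_ne_top _ _)), gnorm, ← ENNReal.tsum_mul_right]
  refine (ENNReal.tsum_le_tsum fun β => ?_).trans
    (ENNReal.tsum_comp_le_tsum_of_injective (add_left_injective a) _)
  rw [mul_assoc, ← primeWeight_add, coeff_quotMonomial]
  gcongr
  split_ifs <;> simp

end

/-- Division with remainder by finitely many series, at a fixed level of convergence in `t`. -/
theorem exists_division {w : ℕ → ℝ≥0∞} (hw : ∀ j, w j ≠ 0) (hw' : ∀ j, w j ≠ ⊤)
    (hmul : ∀ i j, w (i + j) ≤ w i * w j) (hren : ∀ M, renorm w M 0 ≠ ⊤)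
    {ι : Type*} [Fintype ι] {F : ι → MvPowerSeries (Fin n) ℂ⟦X⟧} {a : ι → Fin n →₀ ℕ} {s : ℕ}
    (hF : ∀ i, gnorm w (primeWeight s) (F i) ≠ ⊤) (ha : ∀ i, IsLeadingExponent (F i) (a i))
    {G : MvPowerSeries (Fin n) ℂ⟦X⟧} (hG : gnorm w (primeWeight s) G ≠ ⊤) :
    ∃ (s' : ℕ) (Q : ι → MvPowerSeries (Fin n) ℂ⟦X⟧) (r : MvPowerSeries (Fin n) ℂ⟦X⟧),
      (∀ i, gnorm w (primeWeight s') (Q i) ≠ ⊤) ∧ gnorm w (primeWeight s') r ≠ ⊤ ∧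
      G = ∑ i, Q i * F i + r ∧ ∀ i α, a i ≤ α → MvPowerSeries.coeff α r = 0 := by
  classical
  let c : ι → ℂ := fun i => PowerSeries.constantCoeff (MvPowerSeries.coeff (a i) (F i))
  have hc : ∀ i, c i ≠ 0 := fun i => (ha i).1
  let C : ι → MvPowerSeries (Fin n) ℂ⟦X⟧ := fun i =>
    MvPowerSeries.monomial 0 (PowerSeries.C (c i)⁻¹)
  have hCfin : ∀ i s, gnorm w (primeWeight s) (C i) ≠ ⊤ := fun i s => by
    rw [gnorm_monomial, wnorm_C]
    exact ENNReal.mul_ne_top (ENNReal.mul_ne_top enorm_ne_top (hw' 0)) (primeWeight_ne_top _ _)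
  have hmulfin : ∀ s (f g : MvPowerSeries (Fin n) ℂ⟦X⟧), gnorm w (primeWeight s) f ≠ ⊤ →
      gnorm w (primeWeight s) g ≠ ⊤ → gnorm w (primeWeight s) (f * g) ≠ ⊤ := fun s f g hf hg =>
    ne_top_of_le_ne_top (ENNReal.mul_ne_top hf hg)
      (gnorm_mul_le hmul (fun α β => (primeWeight_add s α β).le) f g)
  -- Modulo `F i`, the monomial `z^{a i}` may be replaced by `e i`. Normalising the leading
  -- coefficient cancels the term at `a i`, so modulo `t` only later exponents remain.
  let e : ι → MvPowerSeries (Fin n) ℂ⟦X⟧ := fun i => MvPowerSeries.monomial (a i) 1 - C i * F i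
  have hefin : ∀ i, gnorm w (primeWeight s) (e i) ≠ ⊤ := fun i => by
    simp only [e, sub_eq_add_neg]
    refine ne_top_of_le_ne_top (ENNReal.add_ne_top.2 ⟨?_, ?_⟩) (gnorm_add_le _ _)
    · rw [gnorm_monomial, ← map_one (PowerSeries.C (R := ℂ)), wnorm_C]
      exact ENNReal.mul_ne_top (ENNReal.mul_ne_top enorm_ne_top (hw' 0)) (primeWeight_ne_top _ _)
    · rw [gnorm_neg]
      exact hmulfin s _ _ (hCfin i s) (hF i)
  have hecoeff : ∀ i α, PowerSeries.constantCoeff (MvPowerSeries.coeff α (e i)) =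
      (if α = a i then 1 else 0) -
        (c i)⁻¹ * PowerSeries.constantCoeff (MvPowerSeries.coeff α (F i)) := fun i α => by
    simp only [e, C, map_sub, MvPowerSeries.coeff_monomial, apply_ite PowerSeries.constantCoeff,
      map_one, map_zero]
    congr 1
    have := MvPowerSeries.coeff_add_monomial_mul 0 α (F i) (PowerSeries.C (c i)⁻¹)
    rw [zero_add] at this
    rw [this, map_mul, PowerSeries.constantCoeff_C]
  have hea : ∀ i α, PowerSeries.constantCoeff (MvPowerSeries.coeff α (e i)) ≠ 0 →
      primeMonomial (a i) < primeMonomial α := fun i α hα => by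
    rw [hecoeff] at hα
    by_contra hlt
    rcases (not_lt.1 hlt).lt_or_eq with hlt | heq
    · rw [(ha i).2 α hlt, if_neg (by rintro rfl; exact hlt.ne rfl)] at hα
      simp at hα
    · rw [primeMonomial_injective heq, if_pos rfl] at hα
      exact hα (by rw [inv_mul_cancel₀ (hc i), sub_self])
  -- With this constant the `card ι` summands of `E` add up to a contraction by `1/2`. For empty `ι`
  -- it is `⊤`, which is harmless.
  have hδ : (2⁻¹ / (Fintype.card ι : ℝ≥0∞)) ≠ 0 :=
    (ENNReal.div_pos (by simp) (ENNReal.natCast_ne_top _)).ne'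
  obtain ⟨s', M, hs', hM, he⟩ := exists_gnorm_shiftWeight_le hw hw' hefin hea hδ
  let u := renorm w M
  have hwu : w ≤ u := le_renorm w M
  have hfinu : ∀ f : MvPowerSeries (Fin n) ℂ⟦X⟧, gnorm w (primeWeight s') f ≠ ⊤ →
      gnorm u (primeWeight s') f ≠ ⊤ := fun f hf => by
    refine ne_top_of_le_ne_top ?_ (gnorm_mono (renorm_le hmul M) le_rfl f)
    rw [gnorm_const_mul]
    exact ENNReal.mul_ne_top (hren M) hf
  have hfinw : ∀ f : MvPowerSeries (Fin n) ℂ⟦X⟧, gnorm u (primeWeight s') f ≠ ⊤ →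
      gnorm w (primeWeight s') f ≠ ⊤ := fun f hf =>
    ne_top_of_le_ne_top hf (gnorm_mono hwu le_rfl f)
  -- `P i` is the set of exponents that are reduced with the help of `F i`
  let P : ι → (Fin n →₀ ℕ) → Prop := fun i α =>
    ∃ h : ∃ i, a i ≤ α, h.choose = i
  -- Rewrites every reducible monomial `z^{β + a i}` of `H` as `z^β * e i`; each exponent is
  -- assigned to only one `i`.
  let E : MvPowerSeries (Fin n) ℂ⟦X⟧ →+ MvPowerSeries (Fin n) ℂ⟦X⟧ :=
    ∑ i, (AddMonoidHom.mulRight (e i)).comp (quotMonomial (P i) (a i))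
  have hEapp : ∀ H, E H = ∑ i, quotMonomial (P i) (a i) H * e i := fun H => by
    simp [E, AddMonoidHom.finsetSum_apply]
  obtain ⟨H, hHfin, hH⟩ := by
    refine exists_eq_add_of_contracting (u := u) (θ := primeWeight s')
      (fun j => (lt_of_lt_of_le (pos_iff_ne_zero.2 (hw j)) (hwu j)).ne')
      (primeWeight_ne_zero s') E ?_ (fun H => ?_) (hfinu G (ne_top_of_le_ne_top hG
        (gnorm_mono le_rfl (primeWeight_anti hs') G)))
    · rw [show (E : MvPowerSeries (Fin n) ℂ⟦X⟧ → MvPowerSeries (Fin n) ℂ⟦X⟧) = _ from funext hEapp]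
      open PowerSeries.WithPiTopology MvPowerSeries.WithPiTopology in
      exact continuous_finsetSum _ fun i _ =>
        (continuous_quotMonomial (P i) (a i)).mul continuous_const
    · rw [hEapp]
      refine (gnorm_sum_le _ _).trans ?_
      -- Dividing by `z^{a i}` costs the inverse of its weight, and the bound on `e i` carries
      -- exactly that weight as a factor.
      have h1 : ∀ i ∈ Finset.univ, gnorm u (primeWeight s') (quotMonomial (P i) (a i) H * e i) ≤
          2⁻¹ / (Fintype.card ι : ℝ≥0∞) * gnorm u (primeWeight s') H := fun i _ => by
        refine (gnorm_mul_le (renorm_add_le hmul hM) (fun α β => (primeWeight_add s' α β).le)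
          _ _).trans ((mul_le_mul' (gnorm_quotMonomial_le _ _ _ _ _) (he i)).trans ?_)
        rw [mul_left_comm, ENNReal.div_mul_cancel (primeWeight_ne_zero _ _)
          (primeWeight_ne_top _ _)]
      refine (Finset.sum_le_sum h1).trans ?_
      rw [Finset.sum_const, nsmul_eq_mul, Finset.card_univ, ← mul_assoc]
      gcongr
      exact ENNReal.mul_div_le
  -- The irreducible part of the fixed point `H`, not of `G`.
  let r : MvPowerSeries (Fin n) ℂ⟦X⟧ := fun α =>
    if ∃ i, a i ≤ α then 0 else MvPowerSeries.coeff α H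
  have hr : ∀ α, MvPowerSeries.coeff α r = if ∃ i, a i ≤ α then 0 else MvPowerSeries.coeff α H :=
    fun α => rfl
  have hdec : H = ∑ i, quotMonomial (P i) (a i) H * MvPowerSeries.monomial (a i) 1 + r := by
    ext α : 1
    have hterm : ∀ i, MvPowerSeries.coeff α
        (quotMonomial (P i) (a i) H * MvPowerSeries.monomial (a i) 1) =
        if P i α then MvPowerSeries.coeff α H else 0 := fun i => by
      rw [MvPowerSeries.coeff_mul_monomial]
      by_cases hi : a i ≤ α
      · rw [if_pos hi, mul_one, coeff_quotMonomial, tsub_add_cancel_of_le hi]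
      · rw [if_neg hi, if_neg]
        rintro ⟨h, rfl⟩
        exact hi h.choose_spec
    rw [map_add, map_sum, Finset.sum_congr rfl fun i _ => hterm i, hr]
    by_cases h : ∃ i, a i ≤ α
    · rw [if_pos h, Finset.sum_eq_single h.choose, if_pos ⟨h, rfl⟩, add_zero]
      · rintro i - hi
        exact if_neg fun ⟨h', h''⟩ => hi h''.symm
      · simp
    · rw [if_neg h, Finset.sum_eq_zero, zero_add]
      rintro i -
      exact if_neg fun ⟨h', _⟩ => h h'
  refine ⟨s', fun i => quotMonomial (P i) (a i) H * C i, r, fun i => ?_, ?_, ?_, fun i α hi => ?_⟩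
  · refine hmulfin s' _ _ (hfinw _ (ne_top_of_le_ne_top ?_ (gnorm_quotMonomial_le _ _ _ _ _)))
      (hCfin i s')
    exact ENNReal.div_ne_top hHfin (primeWeight_ne_zero _ _)
  · refine ne_top_of_le_ne_top (hfinw H hHfin) (ENNReal.tsum_le_tsum fun α => ?_)
    gcongr
    rw [hr]
    split_ifs <;> simp
  -- With `q_i` the quotients of `H`, `G = H - E H = ∑ q_i (z^{a i} - e i) + r`, and `z^{a i} - e i
  -- = C i * F i`.
  · rw [← sub_eq_iff_eq_add.2 hH, hEapp]
    nth_rewrite 1 [hdec]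
    rw [add_sub_right_comm, ← Finset.sum_sub_distrib]
    congr 1
    refine Finset.sum_congr rfl fun i _ => ?_
    simp only [e]
    ring
  · rw [hr, if_pos ⟨i, hi⟩]

end

end

/-! ### The ring of convergent series is local and Noetherian. -/

noncomputable section

open scoped ENNReal

namespace LevelNorms

variable (N : LevelNorms)

/-- The norms `‖t ^ j‖_k`, as extended nonnegative real numbers. -/
def eweight (k : ℝ) (j : ℕ) : ℝ≥0∞ := ENNReal.ofReal (N.w k j)

section

variable {k : ℝ} (hk : k ∈ Set.Ioo 0 N.S)
include hk

theorem eweight_ne_zero (j : ℕ) : N.eweight k j ≠ 0 :=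
  (ENNReal.ofReal_pos.2 (N.pos k hk j)).ne'

omit hk in
theorem eweight_ne_top (j : ℕ) : N.eweight k j ≠ ⊤ := ENNReal.ofReal_ne_top

theorem eweight_add_le (i j : ℕ) : N.eweight k (i + j) ≤ N.eweight k i * N.eweight k j := by
  rw [eweight, eweight, eweight, ← ENNReal.ofReal_mul (N.pos k hk i).le]
  exact ENNReal.ofReal_le_ofReal (N.banach_algebra k hk i j)

/-- Since the ratios of consecutive weights tend to zero, `∑ ‖t^l‖_k M^l` converges by the ratio
test, so its terms are bounded. The ratio test needs nonzero terms, which is why `M = 0` is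
separate. -/
theorem renorm_eweight_ne_top (M : ℕ) : renorm (N.eweight k) M 0 ≠ ⊤ := by
  rcases eq_or_ne M 0 with rfl | hM
  · refine ne_top_of_le_ne_top (ENNReal.one_ne_top) (iSup_le fun l => ?_)
    refine mul_le_one' (ENNReal.ofReal_le_one.2 (N.le_one k hk _)) ?_
    exact pow_le_one₀ (by simp) (by simp)
  · have hM' : (0 : ℝ) < M := by exact_mod_cast Nat.pos_of_ne_zero hM
    have hpos : ∀ j, 0 < N.w k j * (M : ℝ) ^ j := fun j => mul_pos (N.pos k hk j) (pow_pos hM' j)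
    have hs : Summable fun j => N.w k j * (M : ℝ) ^ j := by
      refine summable_of_ratio_test_tendsto_lt_one zero_lt_one
        (Filter.Eventually.of_forall fun j => (hpos j).ne') ?_
      have := (N.locality k hk).mul_const (M : ℝ)
      rw [zero_mul] at this
      refine this.congr fun j => ?_
      rw [Real.norm_of_nonneg (hpos _).le, Real.norm_of_nonneg (hpos _).le]
      have := N.pos k hk j
      field_simp
      ring
    obtain ⟨C, hC⟩ := hs.tendsto_atTop_zero.bddAbove_range
    refine ne_top_of_le_ne_top (ENNReal.ofReal_ne_top (r := C)) (iSup_le fun l => ?_)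
    rw [zero_add, eweight, ← ENNReal.ofReal_natCast, ← ENNReal.ofReal_pow hM'.le,
      ← ENNReal.ofReal_mul (N.pos k hk l).le]
    exact ENNReal.ofReal_le_ofReal (hC (Set.mem_range_self l))

end

theorem exists_eweight_le {h k : ℝ} (hh : h ∈ Set.Ioo 0 N.S) (hk : k ∈ Set.Ioo 0 N.S)
    (hhk : h ≤ k) : ∃ K : ℝ≥0∞, K ≠ ⊤ ∧ ∀ j, N.eweight h j ≤ K * N.eweight k j := by
  obtain ⟨K, hK, H⟩ := N.exists_le_mul hh hk hhk
  refine ⟨ENNReal.ofReal K, ENNReal.ofReal_ne_top, fun j => ?_⟩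
  rw [eweight, eweight, ← ENNReal.ofReal_mul hK.le]
  exact ENNReal.ofReal_le_ofReal (H j)

/-- The bound by `R(k, j) ‖t^j‖_k = ‖t^{j+1}‖_k` in controlled nuclearity. It makes division by `t`
possible at the price of lowering the level. -/
theorem exists_eweight_le_succ {h k : ℝ} (hh : h ∈ Set.Ioo 0 N.S) (hk : k ∈ Set.Ioo 0 N.S)
    (hhk : h < k) : ∃ K : ℝ≥0∞, K ≠ ⊤ ∧ ∀ j, N.eweight h j ≤ K * N.eweight k (j + 1) := by
  obtain ⟨K, hK, H⟩ := N.controlled_nuclearity h hh k hk hhk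
  refine ⟨ENNReal.ofReal K, ENNReal.ofReal_ne_top, fun j => ?_⟩
  rw [eweight, eweight, ← ENNReal.ofReal_mul hK.le]
  refine ENNReal.ofReal_le_ofReal ((H j).2.trans_eq ?_)
  rw [mul_assoc, div_mul_cancel₀ _ (N.pos k hk j).ne']

theorem gnorm_eweight_ne_top {n : ℕ} {h k : ℝ} (hh : h ∈ Set.Ioo 0 N.S) (hk : k ∈ Set.Ioo 0 N.S)
    (hhk : h ≤ k) {s s' : ℕ} (hs : s ≤ s') {F : MvPowerSeries (Fin n) ℂ⟦X⟧}
    (hF : gnorm (N.eweight k) (primeWeight s) F ≠ ⊤) :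
    gnorm (N.eweight h) (primeWeight s') F ≠ ⊤ := by
  obtain ⟨K, hK, H⟩ := N.exists_eweight_le hh hk hhk
  refine ne_top_of_le_ne_top ?_ (gnorm_mono H (primeWeight_anti hs) F)
  rw [gnorm_const_mul]
  exact ENNReal.mul_ne_top hK hF

/-- The filter of levels `k > h` tending to `h` and polyradii `p_i ^ (-s)` tending to zero. -/
def germFilter (h : Set.Ico 0 N.S) : Filter (ℝ × ℕ) := 𝓝[>] (h : ℝ) ×ˢ Filter.atTop

instance (h : Set.Ico 0 N.S) : (N.germFilter h).NeBot := by
  unfold germFilter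
  infer_instance

theorem eventually_germFilter (h : Set.Ico 0 N.S) :
    ∀ᶠ p in N.germFilter h, (h : ℝ) < p.1 ∧ p.1 ∈ Set.Ioo 0 N.S := by
  have : ∀ᶠ k in 𝓝[>] (h : ℝ), (h : ℝ) < k ∧ k ∈ Set.Ioo 0 N.S := by
    filter_upwards [Ioo_mem_nhdsGT h.2.2] with k hk
    exact ⟨hk.1, h.2.1.trans_lt hk.1, hk.2⟩
  exact this.prod_inl _

/-- The series in `z` with coefficients in `ℂ⟦t⟧` which converge in some level `k > h` and on some
polydisc. -/
def germSeries (h : Set.Ico 0 N.S) (n : ℕ) : Subring (MvPowerSeries (Fin n) ℂ⟦X⟧) where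
  carrier := {F | ∀ᶠ p in N.germFilter h, gnorm (N.eweight p.1) (primeWeight p.2) F ≠ ⊤}
  zero_mem' := by simp
  one_mem' := by
    rw [Set.mem_ofPred_eq]
    refine Filter.Eventually.of_forall fun p => ?_
    rw [← MvPowerSeries.monomial_zero_one, gnorm_monomial, ← map_one (PowerSeries.C (R := ℂ)),
      wnorm_C]
    exact ENNReal.mul_ne_top (ENNReal.mul_ne_top enorm_ne_top (N.eweight_ne_top _))
      (primeWeight_ne_top _ _)
  add_mem' hF hG := by
    rw [Set.mem_ofPred_eq] at hF hG ⊢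
    filter_upwards [hF, hG] with p hF hG
    exact ne_top_of_le_ne_top (ENNReal.add_ne_top.2 ⟨hF, hG⟩) (gnorm_add_le _ _)
  neg_mem' hF := by
    rw [Set.mem_ofPred_eq] at hF ⊢
    filter_upwards [hF] with p hF
    rwa [gnorm_neg]
  mul_mem' hF hG := by
    rw [Set.mem_ofPred_eq] at hF hG ⊢
    filter_upwards [hF, hG, N.eventually_germFilter h] with p hF hG hp
    exact ne_top_of_le_ne_top (ENNReal.mul_ne_top hF hG) (gnorm_mul_le (N.eweight_add_le hp.2)
      (fun α β => (primeWeight_add _ α β).le) _ _)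

section

variable {N} {h : Set.Ico 0 N.S} {n : ℕ}

theorem mem_germSeries {F : MvPowerSeries (Fin n) ℂ⟦X⟧} : F ∈ N.germSeries h n ↔
    ∀ᶠ p in N.germFilter h, gnorm (N.eweight p.1) (primeWeight p.2) F ≠ ⊤ := Iff.rfl

/-- Lowering the level changes the norm by at most a constant factor and shrinking the radii
decreases it, so convergence at one pair persists along the whole filter. -/
theorem mem_germSeries_of_ne_top {k : ℝ} (hk : k ∈ Set.Ioo 0 N.S) (hhk : (h : ℝ) < k) {s : ℕ}
    {F : MvPowerSeries (Fin n) ℂ⟦X⟧} (hF : gnorm (N.eweight k) (primeWeight s) F ≠ ⊤) :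
    F ∈ N.germSeries h n := by
  have : ∀ᶠ p in N.germFilter h, p.1 ≤ k ∧ s ≤ p.2 :=
    (Filter.Eventually.prod_inl (show ∀ᶠ k' in 𝓝[>] (h : ℝ), k' ≤ k by
      filter_upwards [Ioc_mem_nhdsGT hhk] with k' hk' using hk'.2) _).and
      (Filter.Eventually.prod_inr (Filter.eventually_ge_atTop s) _)
  filter_upwards [this, N.eventually_germFilter h] with p hp hp'
  exact N.gnorm_eweight_ne_top hp'.2 hk hp.1 hp.2 hF

theorem monomial_mem_germSeries (α : Fin n →₀ ℕ) {f : ℂ⟦X⟧} {M : ℕ}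
    (hf : ∀ j, M ≤ j → PowerSeries.coeff j f = 0) :
    MvPowerSeries.monomial α f ∈ N.germSeries h n := by
  refine mem_germSeries.2 (Filter.Eventually.of_forall fun p => ?_)
  rw [gnorm_monomial]
  refine ENNReal.mul_ne_top ?_ (primeWeight_ne_top _ _)
  rw [wnorm, tsum_eq_sum (s := Finset.range M)]
  · exact ENNReal.sum_ne_top.2 fun j _ => ENNReal.mul_ne_top enorm_ne_top (N.eweight_ne_top _)
  · intro j hj
    rw [hf j (by simpa using hj)]
    simp

variable (N h n) in
/-- The variable `t`. -/
def germT : N.germSeries h n :=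
  ⟨MvPowerSeries.monomial 0 PowerSeries.X, monomial_mem_germSeries 0 (M := 2) fun j hj => by
    rw [PowerSeries.coeff_X, if_neg (by omega)]⟩

variable (N h n) in
/-- The variable `z_i`. -/
def germZ (i : Fin n) : N.germSeries h n :=
  ⟨MvPowerSeries.monomial (Finsupp.single i 1) 1, monomial_mem_germSeries _ (M := 1) fun j hj => by
    rw [PowerSeries.coeff_one, if_neg (by omega)]⟩

theorem coeff_germT_mul (α : Fin n →₀ ℕ) (F : N.germSeries h n) :
    MvPowerSeries.coeff α ((germT N h n * F : N.germSeries h n) : MvPowerSeries (Fin n) ℂ⟦X⟧) =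
      PowerSeries.X * MvPowerSeries.coeff α (F : MvPowerSeries (Fin n) ℂ⟦X⟧) := by
  have := MvPowerSeries.coeff_add_monomial_mul 0 α (F : MvPowerSeries (Fin n) ℂ⟦X⟧) PowerSeries.X
  rwa [zero_add] at this

theorem exists_eq_germT_mul (F : N.germSeries h n)
    (hF : ∀ α, PowerSeries.constantCoeff
      (MvPowerSeries.coeff α (F : MvPowerSeries (Fin n) ℂ⟦X⟧)) = 0) :
    ∃ G, F = germT N h n * G := by
  let g : MvPowerSeries (Fin n) ℂ⟦X⟧ := fun α => PowerSeries.mk fun j =>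
    PowerSeries.coeff (j + 1) (MvPowerSeries.coeff α (F : MvPowerSeries (Fin n) ℂ⟦X⟧))
  have hg : ∀ α, MvPowerSeries.coeff α g = PowerSeries.mk fun j =>
    PowerSeries.coeff (j + 1) (MvPowerSeries.coeff α (F : MvPowerSeries (Fin n) ℂ⟦X⟧)) :=
    fun _ => rfl
  obtain ⟨p, hp, hhp, hpS⟩ := ((mem_germSeries.1 F.2).and (N.eventually_germFilter h)).exists
  -- Shifting the coefficients lowers the level, and the midpoint is still above `h`.
  have hk' : (h + p.1) / 2 ∈ Set.Ioo 0 N.S := by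
    have := h.2.1
    constructor <;> linarith [hpS.2]
  obtain ⟨K, hK, H⟩ := N.exists_eweight_le_succ hk' hpS (by linarith)
  refine ⟨⟨g, mem_germSeries_of_ne_top hk' (by linarith) (s := p.2) ?_⟩, ?_⟩
  · refine ne_top_of_le_ne_top (ENNReal.mul_ne_top hK hp) ?_
    rw [gnorm, gnorm, ← ENNReal.tsum_mul_left]
    refine ENNReal.tsum_le_tsum fun α => ?_
    rw [← mul_assoc]
    gcongr
    rw [hg, wnorm, wnorm, ← ENNReal.tsum_mul_left]
    refine le_trans (ENNReal.tsum_le_tsum fun j => ?_)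
      (ENNReal.tsum_comp_le_tsum_of_injective (add_left_injective 1) _)
    rw [PowerSeries.coeff_mk, mul_left_comm]
    gcongr
    exact H j
  · ext α j : 3
    rw [coeff_germT_mul]
    cases j with
    | zero => simpa using hF α
    | succ j => rw [PowerSeries.coeff_succ_X_mul, hg, PowerSeries.coeff_mk]

theorem germSeries_division {ι : Type*} [Fintype ι] (F : ι → N.germSeries h n)
    {a : ι → Fin n →₀ ℕ} (ha : ∀ i, IsLeadingExponent (F i : MvPowerSeries (Fin n) ℂ⟦X⟧) (a i))
    (G : N.germSeries h n) :
    ∃ (Q : ι → N.germSeries h n) (r : N.germSeries h n), G = ∑ i, Q i * F i + r ∧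
      ∀ i α, a i ≤ α → MvPowerSeries.coeff α (r : MvPowerSeries (Fin n) ℂ⟦X⟧) = 0 := by
  obtain ⟨p, hG, hF, hhp, hpS⟩ := ((mem_germSeries.1 G.2).and ((Filter.eventually_all.2
    fun i => mem_germSeries.1 (F i).2).and (N.eventually_germFilter h))).exists
  obtain ⟨s', Q, r, hQ, hr, heq, hr0⟩ := exists_division (N.eweight_ne_zero hpS)
    N.eweight_ne_top (N.eweight_add_le hpS) (N.renorm_eweight_ne_top hpS) hF ha hG
  refine ⟨fun i => ⟨Q i, mem_germSeries_of_ne_top hpS hhp (hQ i)⟩,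
    ⟨r, mem_germSeries_of_ne_top hpS hhp hr⟩, Subtype.ext ?_, hr0⟩
  rw [heq]
  simp [AddSubmonoidClass.coe_finsetSum]

variable (N h n) in
/-- The value at the origin. -/
def germConst : N.germSeries h n →+* ℂ :=
  (PowerSeries.constantCoeff.comp MvPowerSeries.constantCoeff).comp (N.germSeries h n).subtype

theorem germConst_apply (F : N.germSeries h n) : germConst N h n F =
    PowerSeries.constantCoeff (MvPowerSeries.coeff 0 (F : MvPowerSeries (Fin n) ℂ⟦X⟧)) := by
  rw [MvPowerSeries.coeff_zero_eq_constantCoeff_apply]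
  rfl

/-- If the constant term of `F` is nonzero, its leading exponent is `0`, which lies below every
exponent. Dividing `1` by `F` therefore leaves no remainder. -/
instance : IsLocalHom (germConst N h n) where
  map_nonunit F hF := by
    have hF0 : germConst N h n F ≠ 0 := hF.ne_zero
    obtain ⟨Q, r, heq, hr⟩ := germSeries_division (fun _ : Unit => F) (a := fun _ => 0)
      (fun _ => ⟨by rwa [← germConst_apply], fun β hβ => absurd hβ (by
        rw [primeMonomial_zero]
        exact not_lt.2 (primeMonomial_pos β))⟩) 1
    have hr0 : r = 0 := Subtype.ext (MvPowerSeries.ext fun α => hr () α zero_le)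
    rw [hr0, add_zero, Fintype.sum_unique] at heq
    exact IsUnit.of_mul_eq_one (Q ()) (by rw [heq, mul_comm])

instance : IsLocalRing (N.germSeries h n) := RingHom.domain_isLocalRing (germConst N h n)

theorem mem_maximalIdeal_germSeries {F : N.germSeries h n} :
    F ∈ IsLocalRing.maximalIdeal (N.germSeries h n) ↔ germConst N h n F = 0 := by
  rw [IsLocalRing.mem_maximalIdeal, mem_nonunits_iff, ← isUnit_map_iff (germConst N h n),
    isUnit_iff_ne_zero, not_not]

theorem isLeadingExponent_germZ (i : Fin n) :
    IsLeadingExponent (germZ N h n i : MvPowerSeries (Fin n) ℂ⟦X⟧) (Finsupp.single i 1) := by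
  classical
  constructor
  · simp [germZ]
  · intro β hβ
    rw [germZ, MvPowerSeries.coeff_monomial, if_neg (by rintro rfl; exact hβ.ne rfl), map_zero]

/-- Division by the `z_i` leaves a remainder that involves `t` only; if the value at the origin
vanishes, this remainder is a multiple of `t`. -/
theorem maximalIdeal_germSeries : IsLocalRing.maximalIdeal (N.germSeries h n) =
    Ideal.span (insert (germT N h n) (Set.range (germZ N h n))) := by
  classical
  refine le_antisymm (fun F hF => ?_) (Ideal.span_le.2 ?_)
  · rw [mem_maximalIdeal_germSeries] at hF
    obtain ⟨Q, r, heq, hr⟩ := germSeries_division (germZ N h n) isLeadingExponent_germZ F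
    have hZ : ∑ i, Q i * germZ N h n i ∈
        Ideal.span (insert (germT N h n) (Set.range (germZ N h n))) :=
      Ideal.sum_mem _ fun i _ => Ideal.mul_mem_left _ _
        (Ideal.subset_span (Set.mem_insert_of_mem _ (Set.mem_range_self i)))
    obtain ⟨G, hG⟩ := exists_eq_germT_mul r fun α => by
      rcases eq_or_ne α 0 with rfl | hα
      · rw [← germConst_apply]
        rw [heq, map_add, map_sum, Finset.sum_eq_zero, zero_add] at hF
        · exact hF
        · intro i _
          rw [map_mul, germConst_apply (germZ N h n i), germZ, MvPowerSeries.coeff_monomial,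
            if_neg (by simp [eq_comm])]
          simp
      · obtain ⟨i, hi⟩ := Finsupp.ne_iff.1 hα
        rw [hr i α (Finsupp.single_le_iff.2 (Nat.one_le_iff_ne_zero.2 hi)), map_zero]
    rw [heq, hG]
    exact add_mem hZ (Ideal.mul_mem_right _ _ (Ideal.subset_span (Set.mem_insert _ _)))
  · rintro F (rfl | ⟨i, rfl⟩)
    · rw [SetLike.mem_coe, mem_maximalIdeal_germSeries, germConst_apply]
      simp [germT]
    · rw [SetLike.mem_coe, mem_maximalIdeal_germSeries, germConst_apply, germZ,
        MvPowerSeries.coeff_monomial, if_neg (by simp [eq_comm]), map_zero]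

/-- By Cohen's theorem only prime ideals `P` need be treated. Division by elements of `P` realising
the minimal leading exponents leaves a remainder in `P` that vanishes modulo `t`. Either `t ∈ P`,
and `t` is added to the generators, or primality lets `t` be cancelled indefinitely and the
remainder is zero. -/
instance : IsNoetherianRing (N.germSeries h n) := by
  refine IsNoetherianRing.of_prime fun P hP => ?_
  let D : Set (Fin n →₀ ℕ) :=
    {a | ∃ f ∈ P, IsLeadingExponent (f : MvPowerSeries (Fin n) ℂ⟦X⟧) a}
  let M : Set (Fin n →₀ ℕ) := {a | Minimal (· ∈ D) a}
  -- Dickson's lemma: the minimal elements form an antichain in the well-quasi-ordered `ℕⁿ`.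
  have hM : M.Finite := WellQuasiOrderedLE.finite_of_isAntichain (setOfPred_minimal_antichain _)
  have _ : Fintype M := hM.fintype
  have hDM : ∀ a ∈ D, ∃ m : M, (m : Fin n →₀ ℕ) ≤ a := fun a ha => by
    obtain ⟨m, hma, hm⟩ := (Set.isPWO_of_wellQuasiOrderedLE D).exists_le_minimal ha
    exact ⟨⟨m, hm⟩, hma⟩
  choose f hfP hf using fun m : M => m.2.prop
  -- An element of `P` that is nonzero modulo `t` has a leading exponent, which lies in `D` by
  -- definition and carries a nonzero coefficient.
  have hred : ∀ r ∈ P, (∀ a ∈ D, MvPowerSeries.coeff a (r : MvPowerSeries (Fin n) ℂ⟦X⟧) = 0) →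
      ∃ G, r = germT N h n * G := fun r hr hrD => by
    refine exists_eq_germT_mul r fun α => ?_
    by_contra hα
    obtain ⟨a, ha⟩ := exists_isLeadingExponent ⟨α, hα⟩
    exact ha.1 (by rw [hrD a ⟨r, hr, ha⟩, map_zero])
  have hdiv : ∀ g ∈ P, ∃ r ∈ P, g - r ∈ Ideal.span (Set.range f) ∧
      ∀ a ∈ D, MvPowerSeries.coeff a (r : MvPowerSeries (Fin n) ℂ⟦X⟧) = 0 := fun g hg => by
    obtain ⟨Q, r, heq, hr⟩ := germSeries_division f hf g
    have hQ : ∑ m, Q m * f m ∈ P := P.sum_mem fun m _ => P.mul_mem_left _ (hfP m)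
    refine ⟨r, ?_, ?_, fun a ha => ?_⟩
    · rw [heq] at hg
      exact (P.add_mem_iff_right hQ).1 hg
    · rw [heq, add_sub_cancel_right]
      exact Ideal.sum_mem _ fun m _ => Ideal.mul_mem_left _ _
        (Ideal.subset_span (Set.mem_range_self m))
    · obtain ⟨m, hm⟩ := hDM a ha
      exact hr m a hm
  have hfP' : Set.range f ⊆ P := by
    rintro _ ⟨m, rfl⟩
    exact hfP m
  by_cases hT : germT N h n ∈ P
  · have : P = Ideal.span (insert (germT N h n) (Set.range f)) := by
      refine le_antisymm (fun g hg => ?_) (Ideal.span_le.2 (Set.insert_subset hT hfP'))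
      obtain ⟨r, hr, hgr, hrD⟩ := hdiv g hg
      obtain ⟨G, rfl⟩ := hred r hr hrD
      rw [← sub_add_cancel g (germT N h n * G)]
      exact add_mem (Ideal.span_mono (Set.subset_insert _ _) hgr)
        (Ideal.mul_mem_right _ _ (Ideal.subset_span (Set.mem_insert _ _)))
    rw [this]
    exact Submodule.fg_span ((Set.finite_range f).insert _)
  -- When `t ∉ P`, the cofactor of `t` in `r` is again in `P` and again has no coefficients on `D`,
  -- so induction on the power of `t` applies.
  · have hzero : ∀ j, ∀ r ∈ P,
        (∀ a ∈ D, MvPowerSeries.coeff a (r : MvPowerSeries (Fin n) ℂ⟦X⟧) = 0) → ∀ α,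
        PowerSeries.coeff j (MvPowerSeries.coeff α (r : MvPowerSeries (Fin n) ℂ⟦X⟧)) = 0 := by
      intro j
      induction j with
      | zero =>
        intro r hr hrD α
        obtain ⟨G, rfl⟩ := hred r hr hrD
        rw [coeff_germT_mul, PowerSeries.coeff_zero_X_mul]
      | succ j ih =>
        intro r hr hrD α
        obtain ⟨G, rfl⟩ := hred r hr hrD
        rw [coeff_germT_mul, PowerSeries.coeff_succ_X_mul]
        refine ih G ((hP.mem_or_mem hr).resolve_left hT) (fun a ha => ?_) α
        have := hrD a ha
        rw [coeff_germT_mul] at this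
        exact (mul_eq_zero.1 this).resolve_left PowerSeries.X_ne_zero
    have : P = Ideal.span (Set.range f) := by
      refine le_antisymm (fun g hg => ?_) (Ideal.span_le.2 hfP')
      obtain ⟨r, hr, hgr, hrD⟩ := hdiv g hg
      have hr0 : r = 0 := Subtype.ext (MvPowerSeries.ext fun α => PowerSeries.ext fun j => by
        simpa using hzero j r hr hrD α)
      rwa [hr0, sub_zero] at hgr
    rw [this]
    exact Submodule.fg_span (Set.finite_range f)

end

end LevelNorms

/-! ### A chain of primes, and regularity. -/

/-- Setting the first `i` variables equal to zero. -/
def killVariables {n : ℕ} (i : ℕ) : MvPowerSeries (Fin n) ℂ →+* MvPowerSeries (Fin n) ℂ := by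
  classical exact
  { toFun := fun F α => if ∀ l : Fin n, (l : ℕ) < i → α l = 0 then MvPowerSeries.coeff α F else 0
    map_zero' := by
      funext α
      split_ifs <;> rfl
    map_one' := by
      funext α
      change _ = MvPowerSeries.coeff α 1
      split_ifs with hα
      · rfl
      · rw [MvPowerSeries.coeff_one, if_neg]
        rintro rfl
        exact hα fun _ _ => rfl
    map_add' := fun F G => by
      funext α
      change _ = (if ∀ l : Fin n, (l : ℕ) < i → α l = 0 then MvPowerSeries.coeff α F else 0) +
        (if ∀ l : Fin n, (l : ℕ) < i → α l = 0 then MvPowerSeries.coeff α G else 0)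
      split_ifs
      · rfl
      · rw [add_zero]
    map_mul' := fun F G => by
      refine MvPowerSeries.ext fun α => Eq.trans ?_ (MvPowerSeries.coeff_mul _ _ _).symm
      change (if ∀ l : Fin n, (l : ℕ) < i → α l = 0 then MvPowerSeries.coeff α (F * G) else 0) =
        ∑ p ∈ Finset.HasAntidiagonal.antidiagonal α,
          (if ∀ l : Fin n, (l : ℕ) < i → p.1 l = 0 then MvPowerSeries.coeff p.1 F else 0) *
          (if ∀ l : Fin n, (l : ℕ) < i → p.2 l = 0 then MvPowerSeries.coeff p.2 G else 0)
      split_ifs with hα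
      · rw [MvPowerSeries.coeff_mul]
        refine Finset.sum_congr rfl fun p hp => ?_
        have hp := Finset.HasAntidiagonal.mem_antidiagonal.1 hp
        have h1 : ∀ l : Fin n, (l : ℕ) < i → p.1 l = 0 ∧ p.2 l = 0 := fun l hl => by
          have := hα l hl
          rw [← hp, Finsupp.add_apply] at this
          omega
        rw [if_pos fun l hl => (h1 l hl).1, if_pos fun l hl => (h1 l hl).2]
      · refine (Finset.sum_eq_zero fun p hp => ?_).symm
        have hp := Finset.HasAntidiagonal.mem_antidiagonal.1 hp
        by_contra hne
        rw [mul_eq_zero, not_or] at hne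
        simp only [ite_eq_right_iff, not_forall, exists_prop] at hne
        refine hα fun l hl => ?_
        rw [← hp, Finsupp.add_apply, hne.1.1 l hl, hne.2.1 l hl] }

open Classical in
theorem coeff_killVariables {n : ℕ} (i : ℕ) (F : MvPowerSeries (Fin n) ℂ) (α : Fin n →₀ ℕ) :
    MvPowerSeries.coeff α (killVariables i F) =
      if ∀ l : Fin n, (l : ℕ) < i → α l = 0 then MvPowerSeries.coeff α F else 0 := rfl

namespace LevelNorms

section

variable {N : LevelNorms} {h : Set.Ico 0 N.S} {n : ℕ}

variable (N h n) in
/-- The prime ideal generated by `t` and the first `i` variables `z`. -/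
def germPrime (i : ℕ) : PrimeSpectrum (N.germSeries h n) :=
  ⟨RingHom.ker (((killVariables i).comp (MvPowerSeries.map PowerSeries.constantCoeff)).comp
    (N.germSeries h n).subtype), by
    have := (inferInstance : NoZeroDivisors (MvPowerSeries (Fin n) ℂ))
    have := NoZeroDivisors.to_isDomain (MvPowerSeries (Fin n) ℂ)
    exact RingHom.ker_isPrime _⟩

theorem mem_germPrime {i : ℕ} {F : N.germSeries h n} : F ∈ (germPrime N h n i).asIdeal ↔
    ∀ α : Fin n →₀ ℕ, (∀ l : Fin n, (l : ℕ) < i → α l = 0) →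
      PowerSeries.constantCoeff (MvPowerSeries.coeff α (F : MvPowerSeries (Fin n) ℂ⟦X⟧)) = 0 := by
  classical
  rw [germPrime, RingHom.mem_ker, MvPowerSeries.ext_iff]
  refine forall_congr' fun α => ?_
  simp [coeff_killVariables]

/-- The chain is `0 ⊂ (t) ⊂ (t, z_1) ⊂ … ⊂ (t, z_1, …, z_n)`, with `n + 2` members; `t` and then
each `z_i` witness strictness. -/
theorem le_ringKrullDim_germSeries : ((n + 1 : ℕ) : WithBot ℕ∞) ≤ ringKrullDim (N.germSeries h n) := by
  classical
  let c : Fin (n + 2) → PrimeSpectrum (N.germSeries h n) :=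
    Fin.cons ⟨⊥, Ideal.isPrime_bot⟩ fun i => germPrime N h n i
  have hc : StrictMono c := by
    rw [Fin.strictMono_iff_lt_succ]
    intro i
    induction i using Fin.cases with
    | zero =>
      rw [← PrimeSpectrum.asIdeal_lt_asIdeal]
      change ⊥ < (germPrime N h n 0).asIdeal
      rw [bot_lt_iff_ne_bot, Submodule.ne_bot_iff]
      refine ⟨germT N h n, mem_germPrime.2 fun α _ => ?_, fun h0 => ?_⟩
      · rw [germT, MvPowerSeries.coeff_monomial]
        split_ifs <;> simp
      · have := congrArg (fun F : N.germSeries h n =>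
          MvPowerSeries.coeff 0 (F : MvPowerSeries (Fin n) ℂ⟦X⟧)) h0
        simp [germT] at this
    | succ i =>
      rw [← PrimeSpectrum.asIdeal_lt_asIdeal]
      change (germPrime N h n i).asIdeal < (germPrime N h n (i + 1)).asIdeal
      refine lt_of_le_of_ne (fun F hF => mem_germPrime.2 fun α hα =>
        mem_germPrime.1 hF α fun l hl => hα l (hl.trans (Nat.lt_succ_self _))) fun heq => ?_
      have h1 : germZ N h n i ∈ (germPrime N h n (i + 1)).asIdeal := mem_germPrime.2 fun α hα => by
        rw [germZ, MvPowerSeries.coeff_monomial, if_neg, map_zero]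
        rintro rfl
        simpa using hα i (Nat.lt_succ_self _)
      rw [← heq] at h1
      refine (isLeadingExponent_germZ (N := N) (h := h) i).1
        (mem_germPrime.1 h1 _ fun l hl => Finsupp.single_eq_of_ne ?_)
      rintro rfl
      exact lt_irrefl _ hl
  exact Order.LTSeries.length_le_krullDim (LTSeries.mk (n + 1) c hc)

/-- The `n + 1` generators of the maximal ideal do not exceed the dimension. -/
instance : IsRegularLocalRing (N.germSeries h n) := by
  refine IsRegularLocalRing.of_spanFinrank_maximalIdeal_le _ (le_trans ?_ le_ringKrullDim_germSeries)
  rw [maximalIdeal_germSeries]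
  have hfin : (insert (germT N h n) (Set.range (germZ N h n))).Finite :=
    (Set.finite_range _).insert _
  have h1 := Submodule.spanFinrank_span_le_ncard_of_finite (R := N.germSeries h n) hfin
  have h2 : (Set.range (germZ N h n)).ncard ≤ n := by
    rw [← Set.image_univ]
    exact (Set.ncard_image_le Set.finite_univ).trans (by simp [Set.ncard_univ])
  have h3 := Set.ncard_insert_le (germT N h n) (Set.range (germZ N h n))
  exact_mod_cast h1.trans (h3.trans (Nat.add_le_add_right h2 1))

end

end LevelNorms

end

/-! ### Cauchy expansion of holomorphic functions on polydiscs. -/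

noncomputable section

open Real (circleAverage)

/-- The coefficients of the power series expansion of a holomorphic function on the polydisc with
radii `r`, given by iterated Cauchy integrals. -/
def cauchyCoeff : {n : ℕ} → (Fin n → ℝ) → ((Fin n → ℂ) → ℂ) → (Fin n → ℕ) → ℂ
  | 0, _, f, _ => f 0
  | _ + 1, r, f, α => circleAverage
      (fun ζ => (ζ⁻¹) ^ α 0 * cauchyCoeff (Fin.tail r) (fun z => f (Fin.cons ζ z)) (Fin.tail α)) 0 (r 0)

theorem norm_circleAverage_le {f : ℂ → ℂ} {r C : ℝ} (h : ∀ θ, ‖f (circleMap 0 r θ)‖ ≤ C) :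
    ‖circleAverage f 0 r‖ ≤ C := by
  rw [Real.circleAverage_def, norm_smul, Real.norm_of_nonneg (by positivity)]
  have := intervalIntegral.norm_integral_le_of_norm_le_const (a := 0) (b := 2 * Real.pi)
    (f := fun θ => f (circleMap 0 r θ)) (C := C) fun θ _ => h θ
  rw [sub_zero, abs_of_pos Real.two_pi_pos] at this
  calc _ ≤ (2 * Real.pi)⁻¹ * (C * (2 * Real.pi)) := by gcongr
    _ = C := by field_simp

theorem norm_cons_le {n : ℕ} {r : Fin (n + 1) → ℝ} {ζ : ℂ} (hζ : ‖ζ‖ ≤ r 0) {z : Fin n → ℂ}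
    (hz : ∀ i, ‖z i‖ ≤ Fin.tail r i) (i : Fin (n + 1)) :
    ‖(Fin.cons ζ z : Fin (n + 1) → ℂ) i‖ ≤ r i := by
  induction i using Fin.cases with
  | zero => simpa using hζ
  | succ i => rw [Fin.cons_succ]; exact hz i

theorem norm_cauchyCoeff_le {n : ℕ} {r : Fin n → ℝ} (hr : ∀ i, 0 < r i) {f : (Fin n → ℂ) → ℂ}
    {b : ℝ} (hb : ∀ z, (∀ i, ‖z i‖ ≤ r i) → ‖f z‖ ≤ b) (α : Fin n → ℕ) :
    ‖cauchyCoeff r f α‖ ≤ b * ∏ i, ((r i)⁻¹) ^ α i := by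
  induction n with
  | zero => simpa [cauchyCoeff] using hb 0 (fun i => i.elim0)
  | succ n ih =>
    refine norm_circleAverage_le fun θ => ?_
    have hζ : ‖circleMap 0 (r 0) θ‖ = r 0 := by simp [abs_of_pos (hr 0)]
    have h1 := ih (r := Fin.tail r) (fun i => hr i.succ)
      (fun z hz => hb (Fin.cons (circleMap 0 (r 0) θ) z) (norm_cons_le hζ.le hz)) (Fin.tail α)
    rw [norm_mul, norm_pow, norm_inv, hζ, Fin.prod_univ_succ, mul_left_comm]
    have := hr 0
    gcongr
    exact h1

/-- The point of the torus with radii `r` and angles `θ`. -/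
def torusPoint {n : ℕ} (r : Fin n → ℝ) (θ : Fin n → ℝ) (i : Fin n) : ℂ := circleMap 0 (r i) (θ i)

theorem cons_torusPoint {n : ℕ} (r : Fin (n + 1) → ℝ) (θ₀ : ℝ) (θ : Fin n → ℝ) :
    (Fin.cons (circleMap 0 (r 0) θ₀) (torusPoint (Fin.tail r) θ) : Fin (n + 1) → ℂ) =
      torusPoint r (Fin.cons θ₀ θ) := by
  funext i
  induction i using Fin.cases with
  | zero => simp [torusPoint]
  | succ i => simp [torusPoint, Fin.tail]

/-- Supplies measurability for the exchange of sum and integral below. The parameter space is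
arbitrary because each inductive step adds one angle to it, and continuity is needed only on the
torus of integration. -/
theorem continuous_cauchyCoeff {n : ℕ} {r : Fin n → ℝ} (hr : ∀ i, 0 < r i) {T : Type}
    [TopologicalSpace T] {F : T → (Fin n → ℂ) → ℂ}
    (hF : Continuous fun p : T × (Fin n → ℝ) => F p.1 (torusPoint r p.2)) (α : Fin n → ℕ) :
    Continuous fun t => cauchyCoeff r (F t) α := by
  induction n generalizing T with
  | zero =>
    have : Continuous fun t => F t (torusPoint r 0) := 
      hF.comp (continuous_id.prodMk continuous_const)
    simpa only [cauchyCoeff, Subsingleton.elim (torusPoint r 0) 0] using this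
  | succ n ih =>
    have h1 := ih (r := Fin.tail r) (fun i => hr i.succ) (T := T × ℝ)
      (F := fun p z => F p.1 (Fin.cons (circleMap 0 (r 0) p.2) z)) (by
        simp only [cons_torusPoint]
        exact hF.comp ((continuous_fst.comp continuous_fst).prodMk
          ((continuous_snd.comp continuous_fst).finCons continuous_snd))) (Fin.tail α)
    simp only [cauchyCoeff, Real.circleAverage_def]
    refine Continuous.const_smul (intervalIntegral.continuous_parametric_intervalIntegral_of_continuous'
      (f := fun t θ => (circleMap 0 (r 0) θ)⁻¹ ^ α 0 * cauchyCoeff (Fin.tail r)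
        (fun z => F t (Fin.cons (circleMap 0 (r 0) θ) z)) (Fin.tail α)) ?_ _ _) _
    refine Continuous.mul ?_ h1
    refine Continuous.pow (Continuous.inv₀ ((continuous_circleMap 0 (r 0)).comp continuous_snd)
      fun p => ?_) _
    exact circleMap_ne_center (hr 0).ne'

theorem summable_prod_pow {n : ℕ} {x : Fin n → ℝ} (hx : ∀ i, 0 ≤ x i) (hx' : ∀ i, x i < 1) :
    Summable fun α : Fin n → ℕ => ∏ i, x i ^ α i := by
  induction n with
  | zero => exact (hasSum_fintype _).summable
  | succ n ih =>
    rw [← (Fin.consEquiv fun _ => ℕ).summable_iff]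
    have := (summable_geometric_of_lt_one (hx 0) (hx' 0)).mul_of_nonneg
      (ih (fun i => hx i.succ) fun i => hx' i.succ) (fun k => pow_nonneg (hx 0) k)
      (fun α => Finset.prod_nonneg fun i _ => pow_nonneg (hx i.succ) _)
    refine this.congr fun p => ?_
    simp [Fin.prod_univ_succ, Fin.consEquiv]

theorem HasSum.mul_complex {ι κ : Type*} {f : ι → ℂ} {g : κ → ℂ} {s t : ℂ} (hf : HasSum f s)
    (hg : HasSum g t) : HasSum (fun p : ι × κ => f p.1 * g p.2) (s * t) :=
  hf.mul hg (summable_mul_of_summable_norm hf.summable.norm hg.summable.norm)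

/-- A function that is holomorphic on a neighbourhood of a closed polydisc is the sum of its power
series on the open polydisc. -/
theorem hasSum_cauchyCoeff {n : ℕ} {r : Fin n → ℝ} (hr : ∀ i, 0 < r i) {f : (Fin n → ℂ) → ℂ}
    (hf : ∀ z, (∀ i, ‖z i‖ ≤ r i) → DifferentiableAt ℂ f z) {z : Fin n → ℂ}
    (hz : ∀ i, ‖z i‖ < r i) :
    HasSum (fun α : Fin n → ℕ => cauchyCoeff r f α * ∏ i, z i ^ α i) (f z) := by
  induction n with
  | zero =>
    rw [Subsingleton.elim z 0]
    simp [cauchyCoeff]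
  | succ n ih =>
    obtain ⟨b, hb⟩ : ∃ b, ∀ z, (∀ i, ‖z i‖ ≤ r i) → ‖f z‖ ≤ b := by
      have hK : IsCompact (Set.univ.pi fun i => Metric.closedBall (0 : ℂ) (r i)) :=
        isCompact_univ_pi fun i => isCompact_closedBall _ _
      obtain ⟨b, hb⟩ := hK.exists_bound_of_continuousOn (f := f) fun w hw =>
        (hf w fun i => by simpa using hw i (Set.mem_univ i)).continuousAt.continuousWithinAt
      exact ⟨b, fun w hw => hb w fun i _ => by simpa using hw i⟩
    have hnorm : ∀ θ, ‖circleMap 0 (r 0) θ‖ = r 0 := fun θ => by simp [abs_of_pos (hr 0)]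
    have hcons : ∀ {ζ : ℂ}, ‖ζ‖ ≤ r 0 → ∀ w : Fin n → ℂ, (∀ i, ‖w i‖ ≤ Fin.tail r i) →
        DifferentiableAt ℂ (fun w => f (Fin.cons ζ w)) w := fun hζ w hw => by
      refine DifferentiableAt.comp w (hf _ (norm_cons_le hζ hw)) ?_
      rw [differentiableAt_pi]
      intro i
      induction i using Fin.cases with
      | zero => simp
      | succ i => simpa using differentiableAt_apply i w
    -- For the first variable on its circle, the Cauchy kernel is a geometric series and the
    -- induction hypothesis expands the other variables. Averaging the product over the circle gives
    -- the claim.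
    have hsum : ∀ θ, HasSum (fun p : ℕ × (Fin n → ℕ) =>
        (z 0 / circleMap 0 (r 0) θ) ^ p.1 * (cauchyCoeff (Fin.tail r)
          (fun w => f (Fin.cons (circleMap 0 (r 0) θ) w)) p.2 * ∏ i : Fin n, z i.succ ^ p.2 i))
        ((1 - z 0 / circleMap 0 (r 0) θ)⁻¹ * f (Fin.cons (circleMap 0 (r 0) θ) (fun i => z i.succ))) := by
      intro θ
      have hlt : ‖z 0 / circleMap 0 (r 0) θ‖ < 1 := by
        rw [norm_div, hnorm, div_lt_one (hr 0)]
        exact hz 0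
      have h1 : HasSum (fun k : ℕ => (z 0 / circleMap 0 (r 0) θ) ^ k) _ :=
        hasSum_geometric_of_norm_lt_one hlt
      have h2 : HasSum (fun α : Fin n → ℕ => cauchyCoeff (Fin.tail r)
          (fun w => f (Fin.cons (circleMap 0 (r 0) θ) w)) α * ∏ i : Fin n, z i.succ ^ α i)
          (f (Fin.cons (circleMap 0 (r 0) θ) (fun i => z i.succ))) :=
        ih (r := Fin.tail r) (fun i => hr i.succ) (hcons (hnorm θ).le) fun i => hz i.succ
      have h3 := h1.mul_complex h2
      exact h3
    let g : ℕ × (Fin n → ℕ) → ℝ → ℂ := fun p θ =>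
      (z 0 / circleMap 0 (r 0) θ) ^ p.1 * (cauchyCoeff (Fin.tail r)
        (fun w => f (Fin.cons (circleMap 0 (r 0) θ) w)) p.2 * ∏ i : Fin n, z i.succ ^ p.2 i)
    -- Cauchy estimates give this majorant, independent of the angle.
    let B : ℕ × (Fin n → ℕ) → ℝ := fun p =>
      (‖z 0‖ / r 0) ^ p.1 * (b * ∏ i, (‖z i.succ‖ / r i.succ) ^ p.2 i)
    have hcont : ∀ p, Continuous (g p) := fun p => by
      have h1 := continuous_cauchyCoeff (r := Fin.tail r) (fun i => hr i.succ) (T := ℝ)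
        (F := fun θ w => f (Fin.cons (circleMap 0 (r 0) θ) w)) (by
          simp only [cons_torusPoint]
          rw [continuous_iff_continuousAt]
          intro p
          have h2 : ContinuousAt f (torusPoint r (Fin.cons p.1 p.2)) :=
            (hf _ fun i => by simp [torusPoint, abs_of_pos (hr i)]).continuousAt
          have h3 : Continuous fun p : ℝ × (Fin n → ℝ) => torusPoint r (Fin.cons p.1 p.2) :=
            continuous_pi fun i => (continuous_circleMap 0 (r i)).comp
              ((continuous_apply i).comp (Continuous.finCons (A := fun _ => ℝ)
                continuous_fst continuous_snd))
          exact ContinuousAt.comp (f := fun p : ℝ × (Fin n → ℝ) => torusPoint r (Fin.cons p.1 p.2))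
            h2 h3.continuousAt) p.2
      refine Continuous.mul (Continuous.pow (Continuous.div continuous_const
        (continuous_circleMap 0 (r 0)) fun θ => circleMap_ne_center (hr 0).ne') _)
        (h1.mul continuous_const)
    have hbound : ∀ p θ, ‖g p θ‖ ≤ B p := fun p θ => by
      simp only [g, B]
      rw [norm_mul, norm_pow, norm_div, hnorm, norm_mul, norm_prod]
      have h1 := norm_cauchyCoeff_le (r := Fin.tail r) (fun i => hr i.succ)
        (fun w hw => hb (Fin.cons (circleMap 0 (r 0) θ) w) (norm_cons_le (hnorm θ).le hw)) p.2
      refine mul_le_mul_of_nonneg_left ?_ (pow_nonneg (div_nonneg (norm_nonneg _) (hr 0).le) _)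
      refine (mul_le_mul_of_nonneg_right h1 (Finset.prod_nonneg fun i _ => norm_nonneg _)).trans_eq ?_
      rw [mul_assoc, ← Finset.prod_mul_distrib]
      congr 1
      refine Finset.prod_congr rfl fun i _ => ?_
      rw [norm_pow, ← mul_pow, div_eq_inv_mul]
      rfl
    have hB : Summable B := by
      have hx : ∀ i, 0 ≤ ‖z i‖ / r i := fun i => div_nonneg (norm_nonneg _) (hr i).le
      have hx' : ∀ i, ‖z i‖ / r i < 1 := fun i => (div_lt_one (hr i)).2 (hz i)
      have hb0 : 0 ≤ b := (norm_nonneg _).trans (hb z fun i => (hz i).le)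
      have h1 := (summable_prod_pow (fun i : Fin n => hx i.succ) fun i => hx' i.succ).mul_left b
      have h2 := (summable_geometric_of_lt_one (hx 0) (hx' 0)).mul_of_nonneg h1
        (fun k => pow_nonneg (hx 0) k)
        (fun α => mul_nonneg hb0 (Finset.prod_nonneg fun i _ => pow_nonneg (hx i.succ) _))
      exact h2
    have hint : HasSum (fun p => ∫ θ in (0)..(2 * Real.pi), g p θ)
        (∫ θ in (0)..(2 * Real.pi), (1 - z 0 / circleMap 0 (r 0) θ)⁻¹ *
          f (Fin.cons (circleMap 0 (r 0) θ) (fun i => z i.succ))) :=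
      intervalIntegral.hasSum_integral_of_dominated_convergence (fun p _ => B p)
        (fun p => (hcont p).aestronglyMeasurable)
        (fun p => Filter.Eventually.of_forall fun θ _ => hbound p θ)
        (Filter.Eventually.of_forall fun θ _ => hB) intervalIntegrable_const
        (Filter.Eventually.of_forall fun θ _ => hsum θ)
    rw [← (Fin.consEquiv fun _ => ℕ).hasSum_iff]
    have hmain := hint.const_smul (2 * Real.pi)⁻¹
    -- The kernel `(1 - z_0/ζ)⁻¹` equals `ζ / (ζ - z_0)`, so this is the Cauchy integral formula in
    -- the first variable.
    have hval : (2 * Real.pi)⁻¹ • ∫ θ in (0)..(2 * Real.pi), (1 - z 0 / circleMap 0 (r 0) θ)⁻¹ *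
        f (Fin.cons (circleMap 0 (r 0) θ) (fun i => z i.succ)) = f z := by
      have hd : DiffContOnCl ℂ (fun ζ => f (Fin.cons ζ (fun i => z i.succ))) (Metric.ball 0 |r 0|) := by
        refine DifferentiableOn.diffContOnCl fun ζ hζ => DifferentiableAt.differentiableWithinAt ?_
        rw [closure_ball _ (abs_pos.2 (hr 0).ne').ne', abs_of_pos (hr 0),
          mem_closedBall_zero_iff] at hζ
        refine DifferentiableAt.comp ζ (hf _ (norm_cons_le hζ fun i => (hz i.succ).le)) ?_
        rw [differentiableAt_pi]
        intro i
        induction i using Fin.cases with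
        | zero => simp
        | succ i => simp
      have := hd.circleAverage_smul_div (w := z 0) (by
        rw [mem_ball_zero_iff, abs_of_pos (hr 0)]
        exact hz 0)
      rw [show (Fin.cons (z 0) (fun i => z i.succ) : Fin (n + 1) → ℂ) = z from
        Fin.cons_self_tail z, Real.circleAverage_def] at this
      rw [← this]
      congr 2
      funext θ
      have h0 : circleMap 0 (r 0) θ ≠ 0 := circleMap_ne_center (hr 0).ne'
      rw [sub_zero, smul_eq_mul, one_sub_div h0, inv_div]
    rw [hval] at hmain
    refine hmain.congr_fun fun p => ?_
    simp only [Function.comp_apply, Fin.consEquiv, Equiv.coe_fn_mk, Fin.prod_univ_succ,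
      Fin.cons_zero, Fin.cons_succ, cauchyCoeff, Fin.tail_cons, Real.circleAverage_def, g]
    rw [smul_mul_assoc, ← intervalIntegral.integral_mul_const]
    congr 2
    funext θ
    rw [div_eq_mul_inv, mul_pow]
    ring

end

/-! ### Bounded sets and Banach steps of the direct limit. -/

noncomputable section

open Asymptotics in
theorem DifferentiableAt.clm_comp_tvs {E V W : Type*} [NormedAddCommGroup E] [NormedSpace ℂ E]
    [AddCommGroup V] [Module ℂ V] [TopologicalSpace V] [AddCommGroup W] [Module ℂ W]
    [TopologicalSpace W] (L : V →L[ℂ] W) {f : E → V} {x : E} (hf : DifferentiableAt ℂ f x) :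
    DifferentiableAt ℂ (fun y => L (f y)) x := by
  obtain ⟨f', hf⟩ := hf
  refine ⟨L.comp f', ?_⟩
  rw [hasFDerivAt_iff_isLittleOTVS] at hf ⊢
  refine (L.isBigOTVS_fun_comp.trans_isLittleOTVS hf).congr_left fun y => ?_
  simp

/-- The one-variable Cauchy estimate on the complex line `z + t v`, over the circle of radius `δ /
‖v‖`. -/
theorem norm_fderiv_le_of_forall_mem_closedBall {E F : Type*} [NormedAddCommGroup E]
    [NormedSpace ℂ E] [NormedAddCommGroup F] [NormedSpace ℂ F] {f : E → F} {z : E} {δ C : ℝ}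
    (hδ : 0 < δ) (hf : Differentiable ℂ f) (hC : ∀ w ∈ Metric.closedBall z δ, ‖f w‖ ≤ C) :
    ‖fderiv ℂ f z‖ ≤ C / δ := by
  have hC0 : 0 ≤ C := (norm_nonneg _).trans (hC z (Metric.mem_closedBall_self hδ.le))
  refine ContinuousLinearMap.opNorm_le_bound _ (by positivity) fun v => ?_
  rcases eq_or_ne v 0 with rfl | hv
  · simp
  have hv' : 0 < ‖v‖ := norm_pos_iff.2 hv
  have hline : ∀ t : ℂ, HasDerivAt (fun t : ℂ => z + t • v) v t := fun t => by
    simpa using ((hasDerivAt_id t).smul_const v).const_add z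
  have hd : ∀ t : ℂ, HasDerivAt (fun t : ℂ => f (z + t • v)) (fderiv ℂ f (z + t • v) v) t :=
    fun t => (hf _).hasFDerivAt.comp_hasDerivAt t (hline t)
  have h0 := (hd 0).deriv
  rw [zero_smul, add_zero] at h0
  rw [← h0]
  have := Complex.norm_deriv_le_of_forall_mem_sphere_norm_le (c := 0) (R := δ / ‖v‖) (C := C)
    (f := fun t : ℂ => f (z + t • v)) (by positivity)
    (Differentiable.diffContOnCl fun t => (hd t).differentiableAt) (fun t ht => hC _ (by
      rw [mem_sphere_zero_iff_norm] at ht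
      rw [Metric.mem_closedBall, dist_eq_norm, add_sub_cancel_left, norm_smul, ht,
        div_mul_cancel₀ _ hv'.ne']))
  refine this.trans_eq ?_
  field_simp

theorem differentiableAt_tsum_of_summable_norm {ι E F : Type*} [NormedAddCommGroup E]
    [NormedSpace ℂ E] [NormedAddCommGroup F] [NormedSpace ℂ F] [CompleteSpace F]
    {f : ι → E → F} {u : ι → ℝ} {z : E} {δ : ℝ} (hδ : 0 < δ) (hu : Summable u)
    (hf : ∀ i, Differentiable ℂ (f i)) (hb : ∀ i, ∀ w ∈ Metric.ball z δ, ‖f i w‖ ≤ u i) :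
    DifferentiableAt ℂ (fun w => ∑' i, f i w) z := by
  have hz : z ∈ Metric.ball z (δ / 2) := Metric.mem_ball_self (half_pos hδ)
  -- Radius `δ/3` for the Cauchy estimate keeps points of the ball of radius `δ/2` inside the ball
  -- of radius `δ`.
  refine (hasFDerivAt_tsum_of_isPreconnected (hu.div_const (δ / 3)) Metric.isOpen_ball
    (convex_ball z (δ / 2)).isPreconnected (fun i w _ => (hf i w).hasFDerivAt)
    (fun i w hw => ?_) hz (Summable.of_norm_bounded hu fun i => ?_) hz).differentiableAt
  · refine norm_fderiv_le_of_forall_mem_closedBall (by positivity) (hf i) fun y hy => hb i y ?_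
    rw [Metric.mem_ball] at hw ⊢
    rw [Metric.mem_closedBall] at hy
    linarith [dist_triangle y w z]
  · exact hb i z (Metric.mem_ball_self hδ)

namespace LevelNorms

variable (N : LevelNorms)

/-- The weighted ℓ¹-seminorm with weights `v` is continuous on each level because `v` is dominated
there. This is the source of test seminorms for the limit topology. -/
theorem exists_limitSeminorm_ge (h : Set.Ico 0 N.S) {v : ℕ → ℝ} (hv : ∀ j, 0 ≤ v j)
    (H : ∀ k : Set.Ioo 0 N.S, (h : ℝ) < k → ∃ C : ℝ, ∀ j, v j ≤ C * N.w k j) :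
    ∃ p ∈ N.limitSeminorms h, ∀ (f : N.dirLim h) j,
      ‖PowerSeries.coeff j (f : ℂ⟦X⟧)‖ * v j ≤ p f := by
  have hle : ∀ k : Set.Ioo 0 N.S, (h : ℝ) < k → ∃ C : ℝ, ∀ f : ℂ⟦X⟧, f ∈ N.level k →
      (Summable fun j => ‖PowerSeries.coeff j f‖ * v j) ∧
      ∑' j, ‖PowerSeries.coeff j f‖ * v j ≤ C * N.norm k f := by
    intro k hk
    obtain ⟨C, hC⟩ := H k hk
    refine ⟨C, fun f hf => ?_⟩
    have hf' : Summable fun j => ‖PowerSeries.coeff j f‖ * N.w k j := hf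
    have hle : ∀ j, ‖PowerSeries.coeff j f‖ * v j ≤
        C * (‖PowerSeries.coeff j f‖ * N.w k j) := fun j => by
      calc _ ≤ ‖PowerSeries.coeff j f‖ * (C * N.w k j) := by gcongr; exact hC j
        _ = _ := by ring
    have hs := Summable.of_nonneg_of_le (fun j => mul_nonneg (norm_nonneg _) (hv j)) hle
      (hf'.mul_left C)
    refine ⟨hs, ?_⟩
    unfold norm
    rw [← tsum_mul_left]
    exact hs.tsum_le_tsum hle (hf'.mul_left C)
  have hsum : ∀ f : N.dirLim h, Summable fun j => ‖PowerSeries.coeff j (f : ℂ⟦X⟧)‖ * v j := by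
    intro f
    obtain ⟨k, hk, hf⟩ := f.2
    obtain ⟨C, hC⟩ := hle k hk
    exact (hC f hf).1
  refine ⟨Seminorm.of
    (fun f => ∑' j, ‖PowerSeries.coeff j (f : ℂ⟦X⟧)‖ * v j)
    (fun f g => (weighted_summable_add hv (hsum f) (hsum g)).2)
    (fun c f => by
      rw [← tsum_mul_left]
      refine tsum_congr fun j => ?_
      change ‖PowerSeries.coeff j (c • (f : ℂ⟦X⟧))‖ * v j = _
      rw [PowerSeries.coeff_smul, norm_smul, mul_assoc]), fun k hk => ?_, fun f j => ?_⟩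
  · obtain ⟨C, hC⟩ := hle k hk
    exact ⟨C, fun f hf => (hC f hf).2⟩
  · exact (hsum f).le_tsum j fun i _ => mul_nonneg (norm_nonneg _) (hv i)

/-- The `j`-th coefficient, as a continuous linear functional. -/
def coeffCLM (h : Set.Ico 0 N.S) (j : ℕ) : N.dirLim h →L[ℂ] ℂ where
  toLinearMap := (PowerSeries.coeff j).comp (N.dirLim h).toSubmodule.subtype
  cont := by
    obtain ⟨p, hp, hle⟩ := N.exists_limitSeminorm_ge h (v := Pi.single j 1)
      (show (0 : ℕ → ℝ) ≤ Pi.single j 1 from Pi.single_nonneg.2 zero_le_one) fun k hk => ⟨(N.w k j)⁻¹, fun i => by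
        rcases eq_or_ne i j with rfl | hij
        · rw [Pi.single_eq_same, inv_mul_cancel₀ (N.pos k k.2 i).ne']
        · rw [Pi.single_eq_of_ne hij]
          exact mul_nonneg (inv_nonneg.2 (N.pos k k.2 j).le) (N.pos k k.2 i).le⟩
    refine WithSeminorms.continuous_normedSpace_rng ℂ (N.withSeminorms h) _
      ⟨{⟨p, hp⟩}, 1, fun f => ?_⟩
    have := hle f j
    rw [Pi.single_eq_same, mul_one] at this
    simp only [Finset.sup_singleton, one_smul]
    exact this

theorem coeffCLM_apply {h : Set.Ico 0 N.S} (j : ℕ) (f : N.dirLim h) :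
    N.coeffCLM h j f = PowerSeries.coeff j (f : ℂ⟦X⟧) := rfl

/-- Gliding hump: if every level failed, one could choose levels `u m` decreasing to `h` and
elements `f m` of `K` with a huge coefficient at some `j m`. A weight concentrated at the indices `j
m` then defines a continuous seminorm unbounded on `K`. -/
theorem exists_level_bound (h : Set.Ico 0 N.S) {K : Set (N.dirLim h)}
    (hK : ∀ p ∈ N.limitSeminorms h, ∃ B : ℝ, ∀ f ∈ K, p f ≤ B) :
    ∃ k ∈ Set.Ioo 0 N.S, (h : ℝ) < k ∧
      ∃ B : ℝ, ∀ f ∈ K, ∀ j, ‖PowerSeries.coeff j (f : ℂ⟦X⟧)‖ * N.w k j ≤ B := by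
  by_contra! H
  obtain ⟨u, hanti, hmem, hlim⟩ := exists_seq_strictAnti_tendsto' h.2.2
  have hu : ∀ m, u m ∈ Set.Ioo 0 N.S := fun m => ⟨h.2.1.trans_lt (hmem m).1, (hmem m).2⟩
  have hC : ∀ l m, ∃ C : ℝ, 0 < C ∧ (l ≤ m → ∀ j, N.w (u m) j ≤ C * N.w (u l) j) := fun l m => by
    by_cases hlm : l ≤ m
    · obtain ⟨C, hC, hC'⟩ := N.exists_le_mul (hu m) (hu l) (hanti.antitone hlm)
      exact ⟨C, hC, fun _ => hC'⟩
    · exact ⟨1, one_pos, fun h => absurd h hlm⟩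
  choose C hC0 hC using hC
  -- `D m` dominates all constants comparing the norm at `u m` with those at the earlier levels `u
  -- l`, `l ≤ m`.
  let D : ℕ → ℝ := fun m => 1 + ∑ l ∈ Finset.range (m + 1), C l m
  have hD1 : ∀ m, 1 ≤ D m := fun m => by
    have : 0 ≤ ∑ l ∈ Finset.range (m + 1), C l m := Finset.sum_nonneg fun l _ => (hC0 l m).le
    simp only [D]; linarith
  have hD : ∀ l m, l ≤ m → C l m ≤ D m := fun l m hlm => by
    have := Finset.single_le_sum (f := fun l => C l m) (fun l _ => (hC0 l m).le)
      (Finset.mem_range.2 (Nat.lt_succ_of_le hlm))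
    simp only [D]; linarith
  have hD0 : ∀ m, 0 < D m := fun m => zero_lt_one.trans_le (hD1 m)
  choose f hf j hj using fun m : ℕ => H (u m) (hu m) (hmem m).1 (m * 2 ^ m * D m)
  have hw : ∀ m i, 0 < N.w (u m) i := fun m i => N.pos _ (hu m) i
  -- Small enough to be dominated in every level, yet `‖coeff (j m) (f m)‖ * a m > m` by the choice
  -- of `f m`.
  let a : ℕ → ℝ := fun m => (1 / 2) ^ m * ((D m)⁻¹ * N.w (u m) (j m))
  have ha0 : ∀ m, 0 ≤ a m := fun m =>
    mul_nonneg (by positivity) (mul_nonneg (inv_nonneg.2 (hD0 m).le) (hw m _).le)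
  have ha1 : ∀ m, a m ≤ (1 / 2) ^ m * N.w (u m) (j m) := fun m => by
    have := mul_le_of_le_one_left (hw m (j m)).le (inv_le_one_of_one_le₀ (hD1 m))
    simp only [a]
    gcongr
  have hgeom : Summable fun m : ℕ => (1 / 2 : ℝ) ^ m := summable_geometric_two
  have has : ∀ i, Summable fun m => if j m = i then a m else 0 := fun i => by
    refine Summable.of_nonneg_of_le (fun m => ?_) (fun m => ?_) hgeom
    · split_ifs
      exacts [ha0 m, le_rfl]
    · split_ifs
      · exact (ha1 m).trans (mul_le_of_le_one_right (by positivity) (N.le_one _ (hu m) _))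
      · positivity
  have hite : ∀ i m, 0 ≤ if j m = i then a m else 0 := fun i m => by
    split_ifs
    exacts [ha0 m, le_rfl]
  obtain ⟨p, hp, hpv⟩ := N.exists_limitSeminorm_ge h
    (v := fun i => ∑' m, if j m = i then a m else 0) (fun i => tsum_nonneg (hite i)) (by
      intro k hk
      obtain ⟨l, hl⟩ := (hlim.eventually (Iio_mem_nhds hk)).exists
      obtain ⟨K', hK', hK''⟩ := N.exists_le_mul (hu l) k.2 (le_of_lt hl)
      -- Takes care of the finitely many `m < l`; for `m ≥ l` the factor `(D m)⁻¹` already suffices.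
      let E : ℝ := 1 + ∑ m ∈ Finset.range l, N.w (u m) (j m) / N.w (u l) (j m)
      have hq : ∀ m, 0 ≤ N.w (u m) (j m) / N.w (u l) (j m) := fun m =>
        div_nonneg (hw m _).le (hw l _).le
      have hE1 : 1 ≤ E := by
        have : 0 ≤ ∑ m ∈ Finset.range l, N.w (u m) (j m) / N.w (u l) (j m) :=
          Finset.sum_nonneg fun m _ => hq m
        simp only [E]; linarith
      have hE : ∀ m < l, N.w (u m) (j m) / N.w (u l) (j m) ≤ E := fun m hm => by
        have := Finset.single_le_sum (f := fun m => N.w (u m) (j m) / N.w (u l) (j m))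
          (fun m _ => hq m) (Finset.mem_range.2 hm)
        simp only [E]; linarith
      refine ⟨2 * E * K', fun i => ?_⟩
      have hterm : ∀ m, (if j m = i then a m else 0) ≤ (1 / 2) ^ m * (E * N.w (u l) i) := by
        intro m
        have h0 : 0 ≤ E * N.w (u l) i := mul_nonneg (zero_le_one.trans hE1) (hw l i).le
        split_ifs with hji
        · subst hji
          rcases lt_or_ge m l with hml | hml
          · refine (ha1 m).trans ?_
            gcongr
            exact (div_le_iff₀ (hw l _)).1 (hE m hml)
          · simp only [a]
            refine mul_le_mul_of_nonneg_left ?_ (by positivity)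
            rw [inv_mul_le_iff₀ (hD0 m)]
            calc N.w (u m) (j m) ≤ C l m * N.w (u l) (j m) := hC l m hml _
              _ ≤ D m * N.w (u l) (j m) := by
                  gcongr
                  · exact (hw l _).le
                  · exact hD l m hml
              _ ≤ D m * (E * N.w (u l) (j m)) := by
                  gcongr
                  · exact (hD0 m).le
                  · exact le_mul_of_one_le_left (hw l _).le hE1
        · positivity
      calc ∑' m, (if j m = i then a m else 0) ≤ ∑' m : ℕ, (1 / 2 : ℝ) ^ m * (E * N.w (u l) i) :=
            (has i).tsum_le_tsum hterm (hgeom.mul_right _)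
        _ = 2 * (E * N.w (u l) i) := by rw [tsum_mul_right, tsum_geometric_two]
        _ ≤ 2 * (E * (K' * N.w k i)) := by
            gcongr
            exact hK'' i
        _ = _ := by ring)
  obtain ⟨B, hB⟩ := hK p hp
  obtain ⟨m, hm⟩ := exists_nat_gt B
  have h1 : a m ≤ ∑' m', if j m' = j m then a m' else 0 := by
    have := (has (j m)).le_tsum m fun i _ => hite (j m) i
    rwa [if_pos rfl] at this
  have h2 := hpv (f m) (j m)
  have h3 := mul_le_mul_of_nonneg_left h1 (norm_nonneg (PowerSeries.coeff (j m) (f m : ℂ⟦X⟧)))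
  have h4 : (m : ℝ) < ‖PowerSeries.coeff (j m) (f m : ℂ⟦X⟧)‖ * a m := by
    have h5 : 0 < (1 / 2 : ℝ) ^ m * (D m)⁻¹ := mul_pos (by positivity) (inv_pos.2 (hD0 m))
    have h6 := mul_lt_mul_of_pos_right (hj m) h5
    calc (m : ℝ) = m * 2 ^ m * D m * ((1 / 2) ^ m * (D m)⁻¹) := by
          have := (hD0 m).ne'
          rw [one_div, inv_pow]
          field_simp
      _ < _ := h6
      _ = _ := by simp only [a]; ring
  linarith [hB (f m) (hf m)]

/-- Inserting an intermediate level uses the factor `1/j` of nuclearity twice, so the quotient is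
`O(1/j²)`. -/
theorem summable_w_div {h k : ℝ} (hh : h ∈ Set.Ioo 0 N.S) (hk : k ∈ Set.Ioo 0 N.S)
    (hhk : h < k) : Summable fun j => N.w h j / N.w k j := by
  obtain ⟨l, hl1, hl2⟩ := exists_between hhk
  have hl : l ∈ Set.Ioo 0 N.S := ⟨hh.1.trans hl1, hl2.trans hk.2⟩
  obtain ⟨K, hK, HK⟩ := N.controlled_nuclearity h hh l hl hl1
  obtain ⟨K', hK', HK'⟩ := N.controlled_nuclearity l hl k hk hl2
  -- The term `j = 0` is dropped, since the bound by `1/j` is available only for `j ≠ 0`.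
  rw [← summable_nat_add_iff 1]
  have hs : Summable fun j : ℕ => 1 / ((j + 1 : ℕ) : ℝ) ^ 2 :=
    (summable_nat_add_iff 1).2 (Real.summable_one_div_nat_pow.2 one_lt_two)
  refine Summable.of_nonneg_of_le (fun j => div_nonneg (N.pos h hh _).le (N.pos k hk _).le)
    (fun j => ?_) (hs.mul_left (K * K'))
  rw [div_le_iff₀ (N.pos k hk _)]
  calc N.w h (j + 1) ≤ K * ((j + 1 : ℕ) : ℝ)⁻¹ * N.w l (j + 1) := (HK _).1 (Nat.succ_ne_zero j)
    _ ≤ K * ((j + 1 : ℕ) : ℝ)⁻¹ * (K' * ((j + 1 : ℕ) : ℝ)⁻¹ * N.w k (j + 1)) := by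
        gcongr
        exact (HK' _).1 (Nat.succ_ne_zero j)
    _ = _ := by
        rw [one_div, ← inv_pow]
        ring

theorem norm_coeff_mk_div {k : ℝ} (hk : k ∈ Set.Ioo 0 N.S) (x : lp (fun _ : ℕ => ℂ) 1) (j : ℕ) :
    ‖PowerSeries.coeff j (PowerSeries.mk fun j => x j / (N.w k j : ℂ))‖ * N.w k j = ‖x j‖ := by
  have := N.pos k hk j
  rw [PowerSeries.coeff_mk, norm_div, Complex.norm_real, Real.norm_of_nonneg this.le,
    div_mul_cancel₀ _ this.ne']

theorem mk_div_mem_level (k : Set.Ioo 0 N.S) (x : lp (fun _ : ℕ => ℂ) 1) :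
    (PowerSeries.mk fun j => x j / (N.w k j : ℂ)) ∈ N.level k := by
  have := (lp.memℓp x).summable (by simp)
  simp only [ENNReal.toReal_one, Real.rpow_one] at this
  exact this.congr fun j => (N.norm_coeff_mk_div k.2 x j).symm

/-- The map `x ↦ ∑ (x_j / ‖t ^ j‖_k) t ^ j`, as a linear map. -/
def ofLpLinear (h : Set.Ico 0 N.S) (k : Set.Ioo 0 N.S) (hk : (h : ℝ) < k) :
    lp (fun _ : ℕ => ℂ) 1 →ₗ[ℂ] N.dirLim h where
  toFun x := ⟨PowerSeries.mk fun j => x j / (N.w k j : ℂ), k, hk, N.mk_div_mem_level k x⟩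
  map_add' x y := by
    refine Subtype.ext (PowerSeries.ext fun j => ?_)
    simp [add_div]
  map_smul' c x := by
    refine Subtype.ext (PowerSeries.ext fun j => ?_)
    simp [mul_div_assoc]

theorem coeff_ofLpLinear (h : Set.Ico 0 N.S) (k : Set.Ioo 0 N.S) (hk : (h : ℝ) < k)
    (x : lp (fun _ : ℕ => ℂ) 1) (j : ℕ) :
    PowerSeries.coeff j (N.ofLpLinear h k hk x : ℂ⟦X⟧) = x j / N.w k j := by
  change PowerSeries.coeff j (PowerSeries.mk fun j => x j / (N.w k j : ℂ)) = _
  rw [PowerSeries.coeff_mk]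

theorem norm_ofLpLinear (h : Set.Ico 0 N.S) (k : Set.Ioo 0 N.S) (hk : (h : ℝ) < k)
    (x : lp (fun _ : ℕ => ℂ) 1) : N.norm k (N.ofLpLinear h k hk x : ℂ⟦X⟧) = ‖x‖ := by
  rw [lp.norm_eq_tsum_rpow (by simp), norm]
  simp only [ENNReal.toReal_one, Real.rpow_one, div_one]
  refine tsum_congr fun j => ?_
  have := N.norm_coeff_mk_div k.2 x j
  rw [PowerSeries.coeff_mk] at this
  rw [coeff_ofLpLinear, this]

theorem limitSeminorm_ofLpLinear_le {h : Set.Ico 0 N.S} {k : Set.Ioo 0 N.S} (hk : (h : ℝ) < k)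
    {p : Seminorm ℂ (N.dirLim h)} (hp : p ∈ N.limitSeminorms h) :
    ∃ C : ℝ≥0, ∀ x, p (N.ofLpLinear h k hk x) ≤ C * ‖x‖ := by
  obtain ⟨C, hC⟩ := hp k hk
  refine ⟨C.toNNReal, fun x => ?_⟩
  have h1 := hC (N.ofLpLinear h k hk x) (N.mk_div_mem_level k x)
  rw [N.norm_ofLpLinear] at h1
  exact h1.trans (mul_le_mul_of_nonneg_right (Real.le_coe_toNNReal C) (norm_nonneg x))

/-- The embedding `x ↦ ∑ (x_j / ‖t ^ j‖_k) t ^ j` of `ℓ¹` onto the Banach space `A_k ⊆ A_ȟ`. -/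
def ofLp (h : Set.Ico 0 N.S) (k : Set.Ioo 0 N.S) (hk : (h : ℝ) < k) :
    lp (fun _ : ℕ => ℂ) 1 →L[ℂ] N.dirLim h where
  toLinearMap := N.ofLpLinear h k hk
  cont := WithSeminorms.continuous_normedSpace_dom (lp (fun _ : ℕ => ℂ) 1) (N.withSeminorms h)
    (N.ofLpLinear h k hk) fun p => by
      obtain ⟨C, hC⟩ := N.limitSeminorm_ofLpLinear_le hk p.2
      exact ⟨C, fun x => hC x⟩

theorem coeff_ofLp (h : Set.Ico 0 N.S) (k : Set.Ioo 0 N.S) (hk : (h : ℝ) < k)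
    (x : lp (fun _ : ℕ => ℂ) 1) (j : ℕ) :
    PowerSeries.coeff j (N.ofLp h k hk x : ℂ⟦X⟧) = x j / N.w k j :=
  N.coeff_ofLpLinear h k hk x j

end LevelNorms

end

/-! ### Holomorphic functions near the origin and convergent series. -/

noncomputable section

open scoped ENNReal

theorem HasSum.sum_antidiagonal_mul {A : Type*} [AddCommMonoid A] [Finset.HasAntidiagonal A]
    {f g : A → ℂ} {s t : ℂ} (hf : HasSum f s) (hg : HasSum g t) :
    HasSum (fun a => ∑ p ∈ Finset.HasAntidiagonal.antidiagonal a, f p.1 * g p.2) (s * t) := by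
  have h1 := hf.mul_complex hg
  rw [← Finset.HasAntidiagonal.sigmaAntidiagonalEquivProd.hasSum_iff] at h1
  refine h1.sigma fun a => ?_
  have := hasSum_fintype fun p : Finset.HasAntidiagonal.antidiagonal a => f p.1.1 * g p.1.2
  rwa [Finset.sum_coe_sort (Finset.HasAntidiagonal.antidiagonal a) fun p => f p.1 * g p.2] at this

theorem HasSum.finsupp {n : ℕ} {g : (Fin n → ℕ) → ℂ} {s : ℂ} (hg : HasSum g s) :
    HasSum (fun α : Fin n →₀ ℕ => g α) s :=
  (Equiv.hasSum_iff (Finsupp.equivFunOnFinite : (Fin n →₀ ℕ) ≃ (Fin n → ℕ))).2 hg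

section Expansion

variable {n : ℕ}

/-- The value at the point `z` of the series `F`, with coefficients in `ℂ⟦t⟧`, is `f`. -/
def HasExpansion (F : MvPowerSeries (Fin n) ℂ⟦X⟧) (f : ℂ⟦X⟧) (z : Fin n → ℂ) : Prop :=
  ∀ j, HasSum (fun α : Fin n →₀ ℕ => PowerSeries.coeff j (MvPowerSeries.coeff α F) * ∏ i, z i ^ α i)
    (PowerSeries.coeff j f)

variable {F G : MvPowerSeries (Fin n) ℂ⟦X⟧} {f g : ℂ⟦X⟧} {z : Fin n → ℂ}

theorem HasExpansion.unique (hf : HasExpansion F f z) (hg : HasExpansion F g z) : f = g :=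
  PowerSeries.ext fun j => (hf j).unique (hg j)

theorem HasExpansion.add (hf : HasExpansion F f z) (hg : HasExpansion G g z) :
    HasExpansion (F + G) (f + g) z := fun j => by
  simpa only [map_add, add_mul] using (hf j).add (hg j)

theorem HasExpansion.sub (hf : HasExpansion F f z) (hg : HasExpansion G g z) :
    HasExpansion (F - G) (f - g) z := fun j => by
  simpa only [map_sub, sub_mul] using (hf j).sub (hg j)

/-- A coefficient in `t` of a product involves finitely many coefficients of the factors, and
summable families in `ℂ` are absolutely summable, so Cauchy products in `z` suffice. -/
theorem HasExpansion.mul (hf : HasExpansion F f z) (hg : HasExpansion G g z) :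
    HasExpansion (F * G) (f * g) z := fun j => by
  have h1 := hasSum_sum fun (p : ℕ × ℕ) (_ : p ∈ Finset.HasAntidiagonal.antidiagonal j) =>
    (hf p.1).sum_antidiagonal_mul (hg p.2)
  rw [PowerSeries.coeff_mul]
  refine h1.congr_fun fun α => ?_
  rw [MvPowerSeries.coeff_mul, map_sum, Finset.sum_mul, Finset.sum_comm]
  refine Finset.sum_congr rfl fun q hq => ?_
  rw [PowerSeries.coeff_mul, Finset.sum_mul]
  refine Finset.sum_congr rfl fun p _ => ?_
  rw [← Finset.HasAntidiagonal.mem_antidiagonal.1 hq]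
  simp only [Finsupp.add_apply, pow_add, Finset.prod_mul_distrib]
  ring

end Expansion

/-- The radii `p_i ^ (-s)`, where `p_i` is the `i`-th prime number. -/
def primeRadius {n : ℕ} (s : ℕ) (i : Fin n) : ℝ := ((Nat.nth Nat.Prime i : ℝ) ^ s)⁻¹

section

variable {n : ℕ}

theorem primeRadius_pos (s : ℕ) (i : Fin n) : 0 < primeRadius s i :=
  inv_pos.2 (pow_pos (Nat.cast_pos.2 (prime_nth i).pos) s)

theorem primeRadius_le (s : ℕ) (i : Fin n) : primeRadius s i ≤ (1 / 2) ^ s := by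
  rw [primeRadius, one_div, inv_pow]
  gcongr
  exact_mod_cast (prime_nth i).two_le

theorem prod_primeRadius_pow (s : ℕ) (α : Fin n →₀ ℕ) :
    ∏ i, primeRadius s i ^ α i = ((primeMonomial α : ℝ) ^ s)⁻¹ := by
  rw [primeMonomial, Nat.cast_prod, ← Finset.prod_pow, ← Finset.prod_inv_distrib]
  refine Finset.prod_congr rfl fun i _ => ?_
  rw [primeRadius, inv_pow, ← pow_mul, Nat.cast_pow, ← pow_mul, mul_comm]

theorem ofReal_prod_primeRadius_pow (s : ℕ) (α : Fin n →₀ ℕ) :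
    ENNReal.ofReal (∏ i, primeRadius s i ^ α i) = primeWeight s α := by
  rw [prod_primeRadius_pow, primeWeight, ENNReal.ofReal_inv_of_pos
    (pow_pos (Nat.cast_pos.2 (primeMonomial_pos α)) s), ENNReal.ofReal_pow (Nat.cast_nonneg _),
    ENNReal.ofReal_natCast]

theorem toReal_primeWeight (s : ℕ) (α : Fin n →₀ ℕ) :
    (primeWeight s α).toReal = ∏ i, primeRadius s i ^ α i := by
  rw [← ofReal_prod_primeRadius_pow,
    ENNReal.toReal_ofReal (Finset.prod_nonneg fun i _ => (pow_pos (primeRadius_pos s i) _).le)]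

theorem eventually_norm_lt_primeRadius (s : ℕ) :
    ∀ᶠ z : Fin n → ℂ in 𝓝 0, ∀ i, ‖z i‖ < primeRadius s i := by
  refine Filter.eventually_all.2 fun i => ?_
  have : Filter.Tendsto (fun z : Fin n → ℂ => ‖z i‖) (𝓝 0) (𝓝 0) := by
    have : Continuous fun z : Fin n → ℂ => ‖z i‖ := by fun_prop
    simpa using this.tendsto 0
  exact this.eventually_lt_const (primeRadius_pos s i)

theorem tendsto_primeRadius :
    Filter.Tendsto (fun (s : ℕ) (i : Fin n) => (primeRadius s i : ℂ)) Filter.atTop (𝓝 0) := by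
  refine tendsto_pi_nhds.2 fun i => ?_
  refine squeeze_zero_norm (fun s => ?_)
    (tendsto_pow_atTop_nhds_zero_of_lt_one (by norm_num : (0 : ℝ) ≤ 1 / 2) (by norm_num))
  rw [Complex.norm_real, Real.norm_of_nonneg (primeRadius_pos s i).le]
  exact primeRadius_le s i

theorem exists_primeRadius_forall {p : (Fin n → ℂ) → Prop} (hp : ∀ᶠ z in 𝓝 0, p z) :
    ∃ s : ℕ, ∀ z : Fin n → ℂ, (∀ i, ‖z i‖ ≤ primeRadius s i) → p z := by
  obtain ⟨ε, hε, H⟩ := Metric.eventually_nhds_iff.1 hp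
  obtain ⟨s, hs⟩ := exists_pow_lt_of_lt_one hε (by norm_num : (1 / 2 : ℝ) < 1)
  refine ⟨s, fun z hz => H ?_⟩
  rw [dist_zero_right, pi_norm_lt_iff hε]
  exact fun i => ((hz i).trans (primeRadius_le s i)).trans_lt hs

end

namespace LevelNorms

variable {N : LevelNorms} {h : Set.Ico 0 N.S} {n : ℕ}

theorem exists_gnorm_ne_top {F : MvPowerSeries (Fin n) ℂ⟦X⟧} (hF : F ∈ N.germSeries h n) :
    ∃ k : Set.Ioo 0 N.S, (h : ℝ) < k ∧ ∃ s, gnorm (N.eweight k) (primeWeight s) F ≠ ⊤ := by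
  obtain ⟨p, hp, hp'⟩ := ((mem_germSeries.1 hF).and (N.eventually_germFilter h)).exists
  exact ⟨⟨p.1, hp'.2⟩, hp'.1, p.2, hp⟩

/-- For fixed `j`, evaluate at the points `z_i = p_i^{-s}`. As `s → ∞` the term with the least
`primeMonomial` dominates the sum of the others, so its coefficient must vanish. -/
theorem eq_zero_of_hasExpansion {F : MvPowerSeries (Fin n) ℂ⟦X⟧} (hF : F ∈ N.germSeries h n)
    (hz : ∀ᶠ z in 𝓝 0, HasExpansion F 0 z) : F = 0 := by
  obtain ⟨k, hk, s, hs⟩ := exists_gnorm_ne_top hF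
  refine MvPowerSeries.ext fun α => PowerSeries.ext fun j => ?_
  rw [map_zero, map_zero]
  by_contra hne
  let P : ℕ → Prop := fun m => ∃ α : Fin n →₀ ℕ, primeMonomial α = m ∧
    PowerSeries.coeff j (MvPowerSeries.coeff α F) ≠ 0
  have hP : ∃ m, P m := ⟨_, α, rfl, hne⟩
  classical
  obtain ⟨a, ha, ha0⟩ := Nat.find_spec hP
  have hmin : ∀ β : Fin n →₀ ℕ, PowerSeries.coeff j (MvPowerSeries.coeff β F) ≠ 0 →
      primeMonomial a ≤ primeMonomial β := fun β hβ => by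
    rw [ha]
    exact Nat.find_min' hP ⟨β, rfl, hβ⟩
  let c : (Fin n →₀ ℕ) → ℝ≥0∞ := fun β =>
    if β = a then 0 else ‖PowerSeries.coeff j (MvPowerSeries.coeff β F)‖ₑ
  have hc : ∑' β, c β * primeWeight s β ≠ ⊤ := by
    have h1 : ∑' β, c β * primeWeight s β * N.eweight k j ≤
        gnorm (N.eweight k) (primeWeight s) F := by
      refine ENNReal.tsum_le_tsum fun β => ?_
      have h2 : c β ≤ ‖PowerSeries.coeff j (MvPowerSeries.coeff β F)‖ₑ := by
        simp only [c]
        split_ifs <;> simp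
      rw [mul_right_comm]
      gcongr
      refine (mul_le_mul_left h2 _).trans ?_
      exact ENNReal.le_tsum (f := fun j =>
        ‖PowerSeries.coeff j (MvPowerSeries.coeff β F)‖ₑ * N.eweight k j) j
    rw [ENNReal.tsum_mul_right] at h1
    intro htop
    rw [htop, ENNReal.top_mul (N.eweight_ne_zero k.2 j)] at h1
    exact hs (top_le_iff.1 h1)
  have hlim := tendsto_tsum_primeWeight_div a hc fun β hβ => by
    have hβa : β ≠ a := fun h => hβ (by simp [c, h])
    refine (hmin β fun h => hβ ?_).lt_of_ne fun h => hβa (primeMonomial_injective h).symm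
    simp only [c, h, enorm_zero, ite_self]
  have hev : ∀ᶠ m : ℕ in Filter.atTop, HasExpansion F 0 fun i => (primeRadius (s + m) i : ℂ) :=
    (tendsto_primeRadius.comp (Filter.tendsto_add_atTop_nat s)).eventually hz |>.mono
      fun m hm => by simpa only [Function.comp, add_comm] using hm
  have hle : ∀ᶠ m : ℕ in Filter.atTop, ‖PowerSeries.coeff j (MvPowerSeries.coeff a F)‖ₑ ≤
      ∑' β, c β * primeWeight (s + m) β / primeWeight (s + m) a := by
    filter_upwards [hev] with m hm
    have hprod : ∀ β : Fin n →₀ ℕ,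
        ‖∏ i, (primeRadius (s + m) i : ℂ) ^ β i‖ₑ = primeWeight (s + m) β := fun β => by
      rw [← ofReal_prod_primeRadius_pow, ← ofReal_norm, norm_prod]
      congr 1
      refine Finset.prod_congr rfl fun i _ => ?_
      rw [norm_pow, Complex.norm_real, Real.norm_of_nonneg (primeRadius_pos _ i).le]
    have h1 := hm j
    -- Replacing the term at `a` by zero gives a sum equal to minus that term, which is thus bounded
    -- by the others.
    have h2 := (h1.update a 0).enorm_le_tsum
    simp only [map_zero, zero_sub, add_zero, enorm_neg, enorm_mul, hprod] at h2
    simp_rw [div_eq_mul_inv]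
    rw [ENNReal.tsum_mul_right, ← div_eq_mul_inv]
    rw [ENNReal.le_div_iff_mul_le (Or.inl (primeWeight_ne_zero _ _))
      (Or.inl (primeWeight_ne_top _ _))]
    refine h2.trans (ENNReal.tsum_le_tsum fun β => ?_)
    by_cases hβ : β = a
    · subst hβ
      simp
    · simp [c, hβ, hprod, enorm_mul]
  have := le_of_tendsto_of_tendsto tendsto_const_nhds hlim hle
  exact ha0 (by simpa using this)

theorem hasExpansion_unique_series {F G : MvPowerSeries (Fin n) ℂ⟦X⟧} (hF : F ∈ N.germSeries h n)
    (hG : G ∈ N.germSeries h n) {f : (Fin n → ℂ) → ℂ⟦X⟧}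
    (hFf : ∀ᶠ z in 𝓝 0, HasExpansion F (f z) z) (hGf : ∀ᶠ z in 𝓝 0, HasExpansion G (f z) z) :
    F = G := by
  refine sub_eq_zero.1 (eq_zero_of_hasExpansion (h := h) (sub_mem hF hG) ?_)
  filter_upwards [hFf, hGf] with z h1 h2
  simpa using h1.sub h2

theorem exists_hasExpansion {f : (Fin n → ℂ) → N.dirLim h}
    (hc : ∀ᶠ z in 𝓝 0, ContinuousAt f z)
    (hd : ∀ᶠ z in 𝓝 0, ∀ j, DifferentiableAt ℂ (fun z => PowerSeries.coeff j (f z : ℂ⟦X⟧)) z) :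
    ∃ F ∈ N.germSeries h n, ∀ᶠ z in 𝓝 0, HasExpansion F (f z) z := by
  obtain ⟨s, hs⟩ := exists_primeRadius_forall (hc.and hd)
  have hr : ∀ i : Fin n, 0 < primeRadius s i := primeRadius_pos s
  let P : Set (Fin n → ℂ) := Set.univ.pi fun i => Metric.closedBall (0 : ℂ) (primeRadius s i)
  have hP : ∀ z, z ∈ P ↔ ∀ i, ‖z i‖ ≤ primeRadius s i := fun z => by simp [P, Set.mem_pi]
  have hPc : IsCompact P := isCompact_univ_pi fun i => isCompact_closedBall _ _
  -- Continuous seminorms are bounded on the compact image of the polydisc, so a single level bounds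
  -- all coefficients of the values.
  obtain ⟨k, hk, hhk, B, hB⟩ := N.exists_level_bound h (K := f '' P) fun p hp => by
    have hcont : ContinuousOn (fun z => p (f z)) P := fun z hz =>
      (((N.withSeminorms h).continuous_seminorm ⟨p, hp⟩).continuousAt.comp
        (hs z ((hP z).1 hz)).1).continuousWithinAt
    obtain ⟨B, hB⟩ := hPc.exists_bound_of_continuousOn hcont
    refine ⟨B, ?_⟩
    rintro _ ⟨z, hz, rfl⟩
    exact (le_abs_self _).trans (hB z hz)
  let c : ℕ → (Fin n → ℕ) → ℂ := fun j =>
    cauchyCoeff (primeRadius s) fun z => PowerSeries.coeff j (f z : ℂ⟦X⟧)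
  have hcb : ∀ j (α : Fin n →₀ ℕ), ‖c j α‖ ≤ B / N.w k j * (primeMonomial α : ℝ) ^ s := by
    intro j α
    have := norm_cauchyCoeff_le hr (f := fun z => PowerSeries.coeff j (f z : ℂ⟦X⟧))
      (b := B / N.w k j) (fun z hz => by
        rw [le_div_iff₀ (N.pos k hk j)]
        exact hB _ ⟨z, (hP z).2 hz, rfl⟩ j) α
    simpa only [inv_pow, Finset.prod_inv_distrib, prod_primeRadius_pow, inv_inv] using this
  -- Level `k` yields only bounds uniform in `j`; in the lower level `l` they become summable in
  -- `j`.
  obtain ⟨l, hl1, hl2⟩ := exists_between hhk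
  have hl : l ∈ Set.Ioo 0 N.S := ⟨h.2.1.trans_lt hl1, hl2.trans hk.2⟩
  let F : MvPowerSeries (Fin n) ℂ⟦X⟧ := fun α => PowerSeries.mk fun j => c j α
  have hF : ∀ α j, PowerSeries.coeff j (MvPowerSeries.coeff α F) = c j α := fun α j => by
    rw [MvPowerSeries.coeff_apply, PowerSeries.coeff_mk]
  -- The Cauchy estimate consumes `s` powers of the radii, and the two extra ones make the sum over
  -- `α` converge.
  refine ⟨F, mem_germSeries_of_ne_top hl hl1 (s := s + 2) ?_, ?_⟩
  · have hB0 : 0 ≤ B := by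
      refine le_trans ?_ (hB _ ⟨0, (hP 0).2 fun i => by simpa using (hr i).le, rfl⟩ 0)
      exact mul_nonneg (norm_nonneg _) (N.pos k hk 0).le
    have hterm : ∀ α j, ‖PowerSeries.coeff j (MvPowerSeries.coeff α F)‖ₑ * N.eweight l j *
        primeWeight (s + 2) α ≤
          ENNReal.ofReal B * ENNReal.ofReal (N.w l j / N.w k j) * primeWeight 2 α := by
      intro α j
      have h1 := hcb j α
      rw [hF, primeWeight_add_left, ← mul_assoc]
      refine mul_le_mul_left ?_ _
      have hM : (0 : ℝ) < (primeMonomial α : ℝ) ^ s :=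
        pow_pos (Nat.cast_pos.2 (primeMonomial_pos α)) s
      rw [← ofReal_norm, eweight, ← ofReal_prod_primeRadius_pow, prod_primeRadius_pow,
        ← ENNReal.ofReal_mul (norm_nonneg _),
        ← ENNReal.ofReal_mul (mul_nonneg (norm_nonneg _) (N.pos l hl j).le),
        ← ENNReal.ofReal_mul hB0]
      refine ENNReal.ofReal_le_ofReal ?_
      rw [← div_eq_mul_inv, div_le_iff₀ hM]
      calc ‖c j α‖ * N.w l j ≤ B / N.w k j * (primeMonomial α : ℝ) ^ s * N.w l j :=
            mul_le_mul_of_nonneg_right h1 (N.pos l hl j).le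
        _ = _ := by ring
    have hsum : ∑' j, ENNReal.ofReal (N.w l j / N.w k j) ≠ ⊤ := by
      rw [← ENNReal.ofReal_tsum_of_nonneg
        (fun j => div_nonneg (N.pos l hl j).le (N.pos k hk j).le) (N.summable_w_div hl hk hl2)]
      exact ENNReal.ofReal_ne_top
    rw [gnorm_eq_tsum_prod, ENNReal.tsum_prod']
    refine ne_top_of_le_ne_top ?_ (ENNReal.tsum_le_tsum fun α => ENNReal.tsum_le_tsum (hterm α))
    simp_rw [ENNReal.tsum_mul_right, ENNReal.tsum_mul_left]
    exact ENNReal.mul_ne_top (ENNReal.mul_ne_top ENNReal.ofReal_ne_top hsum)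
      tsum_primeWeight_two_ne_top
  · filter_upwards [eventually_norm_lt_primeRadius s] with z hz j
    simp_rw [hF]
    have := hasSum_cauchyCoeff hr (f := fun z => PowerSeries.coeff j (f z : ℂ⟦X⟧))
      (fun z hz => (hs z hz).2 j) hz
    exact this.finsupp

theorem exists_differentiableAt_hasExpansion {F : MvPowerSeries (Fin n) ℂ⟦X⟧}
    (hF : F ∈ N.germSeries h n) :
    ∃ (T : lp (fun _ : ℕ => ℂ) 1 →L[ℂ] N.dirLim h)
      (g : (Fin n → ℂ) → lp (fun _ : ℕ => ℂ) 1),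
      ∀ᶠ z in 𝓝 0, DifferentiableAt ℂ g z ∧ HasExpansion F (T (g z)) z := by
  obtain ⟨k, hk, s, hs⟩ := exists_gnorm_ne_top hF
  have hwn : ∀ α, wnorm (N.eweight k) (MvPowerSeries.coeff α F) ≠ ⊤ := fun α htop => by
    refine hs (top_le_iff.1 (le_trans ?_ (ENNReal.le_tsum α)))
    rw [htop, ENNReal.top_mul (primeWeight_ne_zero _ _)]
  have hcn : ∀ α j, ‖PowerSeries.coeff j (MvPowerSeries.coeff α F) * (N.w k j : ℂ)‖ =
      (‖PowerSeries.coeff j (MvPowerSeries.coeff α F)‖ₑ * N.eweight k j).toReal := fun α j => by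
    rw [norm_mul, Complex.norm_real, Real.norm_of_nonneg (N.pos k k.2 j).le, ENNReal.toReal_mul,
      toReal_enorm, eweight, ENNReal.toReal_ofReal (N.pos k k.2 j).le]
  have hmem : ∀ α, Memℓp (fun j =>
      PowerSeries.coeff j (MvPowerSeries.coeff α F) * (N.w k j : ℂ)) 1 := fun α => by
    refine memℓp_gen ?_
    simp only [ENNReal.toReal_one, Real.rpow_one, hcn]
    exact ENNReal.summable_toReal (hwn α)
  -- Multiplying by `‖t^j‖_k` identifies `A_k` isometrically with `ℓ¹`; `N.ofLp` divides by it
  -- again.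
  let c : (Fin n →₀ ℕ) → lp (fun _ : ℕ => ℂ) 1 := fun α => ⟨_, hmem α⟩
  have hc : ∀ α, ‖c α‖ = (wnorm (N.eweight k) (MvPowerSeries.coeff α F)).toReal := fun α => by
    rw [lp.norm_eq_tsum_rpow (by simp), wnorm, ENNReal.tsum_toReal_eq fun j =>
      ENNReal.mul_ne_top enorm_ne_top (N.eweight_ne_top j)]
    simp only [ENNReal.toReal_one, Real.rpow_one, div_one]
    exact tsum_congr fun j => hcn α j
  let m : (Fin n →₀ ℕ) → (Fin n → ℂ) → lp (fun _ : ℕ => ℂ) 1 := fun α z => (∏ i, z i ^ α i) • c α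
  let u : (Fin n →₀ ℕ) → ℝ := fun α =>
    (wnorm (N.eweight k) (MvPowerSeries.coeff α F) * primeWeight s α).toReal
  have hu : Summable u := ENNReal.summable_toReal hs
  have hmu : ∀ α z, (∀ i, ‖z i‖ < primeRadius s i) → ‖m α z‖ ≤ u α := fun α z hz => by
    simp only [m, u]
    rw [norm_smul, hc, ENNReal.toReal_mul, toReal_primeWeight, mul_comm, norm_prod]
    gcongr with i
    rw [norm_pow]
    gcongr
    exact (hz i).le
  refine ⟨N.ofLp h k hk, fun z => ∑' α, m α z, ?_⟩
  have hopen := eventually_norm_lt_primeRadius (n := n) s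
  filter_upwards [hopen.eventually_nhds] with z hz
  refine ⟨?_, fun j => ?_⟩
  · obtain ⟨δ, hδ, hb⟩ := Metric.eventually_nhds_iff_ball.1 hz
    refine differentiableAt_tsum_of_summable_norm hδ hu (fun α => ?_)
      fun α w hw => hmu α w (hb w hw)
    simp only [m]
    fun_prop
  · have h1 : HasSum (fun α => m α z) (∑' α, m α z) :=
      (Summable.of_norm_bounded hu fun α => hmu α z hz.self_of_nhds).hasSum
    have h2 := h1.mapL ((N.coeffCLM h j).comp (N.ofLp h k hk))
    refine h2.congr_fun fun α => ?_
    rw [ContinuousLinearMap.comp_apply, coeffCLM_apply, coeff_ofLp]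
    have : (N.w k j : ℂ) ≠ 0 := by exact_mod_cast (N.pos k k.2 j).ne'
    change _ = (∏ i, z i ^ α i) * (PowerSeries.coeff j (MvPowerSeries.coeff α F) * (N.w k j : ℂ)) / _
    field_simp

end LevelNorms

end

/-! ### Transfer to a complex manifold by charts. -/

noncomputable section

section Charts

variable {n : ℕ} {X : Type u} [TopologicalSpace X] [ChartedSpace (EuclideanSpace ℂ (Fin n)) X]

variable (n) in
/-- The coordinates centred at `x` given by the preferred chart at `x`. -/
def chartCoord (x y : X) : Fin n → ℂ := EuclideanSpace.equiv (Fin n) ℂ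
  (chartAt (EuclideanSpace ℂ (Fin n)) x y - chartAt (EuclideanSpace ℂ (Fin n)) x x)

/-- The point with given coordinates. -/
def chartPoint (x : X) (z : Fin n → ℂ) : X := (chartAt (EuclideanSpace ℂ (Fin n)) x).symm
  ((EuclideanSpace.equiv (Fin n) ℂ).symm z + chartAt (EuclideanSpace ℂ (Fin n)) x x)

theorem chartPoint_chartCoord {x y : X} (hy : y ∈ (chartAt (EuclideanSpace ℂ (Fin n)) x).source) :
    chartPoint x (chartCoord n x y) = y := by
  rw [chartPoint, chartCoord, ContinuousLinearEquiv.symm_apply_apply, sub_add_cancel,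
    OpenPartialHomeomorph.left_inv _ hy]

theorem chartCoord_chartPoint {x : X} {z : Fin n → ℂ}
    (hz : (EuclideanSpace.equiv (Fin n) ℂ).symm z + chartAt (EuclideanSpace ℂ (Fin n)) x x ∈
      (chartAt (EuclideanSpace ℂ (Fin n)) x).target) : chartCoord n x (chartPoint x z) = z := by
  rw [chartPoint, chartCoord, OpenPartialHomeomorph.right_inv _ hz, add_sub_cancel_right,
    ContinuousLinearEquiv.apply_symm_apply]

theorem tendsto_chartCoord (x : X) : Filter.Tendsto (chartCoord n x) (𝓝 x) (𝓝 0) := by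
  have h1 : ContinuousAt (chartCoord n x) x :=
    (EuclideanSpace.equiv (Fin n) ℂ).continuous.continuousAt.comp
      (((chartAt (EuclideanSpace ℂ (Fin n)) x).continuousAt
        (mem_chart_source _ x)).sub continuousAt_const)
  have h2 : chartCoord n x x = 0 := by rw [chartCoord, sub_self, map_zero]
  rw [ContinuousAt, h2] at h1
  exact h1

theorem eventually_mem_target (x : X) : ∀ᶠ z : Fin n → ℂ in 𝓝 0,
    (EuclideanSpace.equiv (Fin n) ℂ).symm z + chartAt (EuclideanSpace ℂ (Fin n)) x x ∈
      (chartAt (EuclideanSpace ℂ (Fin n)) x).target := by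
  have hc : Continuous fun z : Fin n → ℂ =>
    (EuclideanSpace.equiv (Fin n) ℂ).symm z + chartAt (EuclideanSpace ℂ (Fin n)) x x :=
    (EuclideanSpace.equiv (Fin n) ℂ).symm.continuous.add continuous_const
  refine hc.tendsto 0 ((chartAt (EuclideanSpace ℂ (Fin n)) x).open_target.mem_nhds ?_)
  rw [map_zero, zero_add]
  exact mem_chart_target _ x

theorem continuousAt_chartPoint {x : X} {z : Fin n → ℂ}
    (hz : (EuclideanSpace.equiv (Fin n) ℂ).symm z + chartAt (EuclideanSpace ℂ (Fin n)) x x ∈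
      (chartAt (EuclideanSpace ℂ (Fin n)) x).target) : ContinuousAt (chartPoint (n := n) x) z :=
  ContinuousAt.comp (f := fun z : Fin n → ℂ => (EuclideanSpace.equiv (Fin n) ℂ).symm z +
      chartAt (EuclideanSpace ℂ (Fin n)) x x)
    ((chartAt (EuclideanSpace ℂ (Fin n)) x).continuousAt_symm hz)
    (((EuclideanSpace.equiv (Fin n) ℂ).symm.continuous.add continuous_const).continuousAt)

theorem tendsto_chartPoint (x : X) :
    Filter.Tendsto (chartPoint (n := n) x) (𝓝 0) (𝓝 x) := by
  have h1 := continuousAt_chartPoint (eventually_mem_target (n := n) x).self_of_nhds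
  have h2 : chartPoint (n := n) x 0 = x := by
    rw [chartPoint, map_zero, zero_add, OpenPartialHomeomorph.left_inv _ (mem_chart_source _ x)]
  rwa [ContinuousAt, h2] at h1

section

variable {R : Type} [CommRing R] [Algebra ℂ R] [TopologicalSpace R] [IsTopologicalRing R]
  [ContinuousSMul ℂ R] {F : Type*} [NormedAddCommGroup F] [NormedSpace ℂ F]

theorem ComplexDifferentiableAt.continuousAt {g : X → R} {y : X}
    (hg : ComplexDifferentiableAt n g y) : ContinuousAt g y := by
  obtain ⟨g', hg⟩ := hg
  have hy := mem_chart_source (EuclideanSpace ℂ (Fin n)) y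
  have h1 := hg.continuousAt.comp ((chartAt (EuclideanSpace ℂ (Fin n)) y).continuousAt hy)
  refine h1.congr ?_
  filter_upwards [(chartAt (EuclideanSpace ℂ (Fin n)) y).open_source.mem_nhds hy] with w hw
  simp only [Function.comp, OpenPartialHomeomorph.left_inv _ hw]

theorem mdifferentiableAt_iff_comp_chartAt_symm {u : X → F} {y : X} :
    MDifferentiableAt 𝓘(ℂ, EuclideanSpace ℂ (Fin n)) 𝓘(ℂ, F) u y ↔ ContinuousAt u y ∧
      DifferentiableAt ℂ (u ∘ (chartAt (EuclideanSpace ℂ (Fin n)) y).symm)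
        (chartAt (EuclideanSpace ℂ (Fin n)) y y) := by
  rw [mdifferentiableAt_iff]
  simp [writtenInExtChartAt, chartAt_self_eq, Function.comp_def, differentiableWithinAt_univ]

/-- `ComplexDifferentiableAt` uses the preferred chart at `y`, while expansions use the fixed chart
at `x`. After composition with a map to a normed space, manifold differentiability mediates between
the charts. -/
theorem ComplexDifferentiableAt.mdifferentiableAt {g : X → R} {y : X}
    (hg : ComplexDifferentiableAt n g y) (L : R →L[ℂ] F) :
    MDifferentiableAt 𝓘(ℂ, EuclideanSpace ℂ (Fin n)) 𝓘(ℂ, F) (fun y => L (g y)) y :=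
  mdifferentiableAt_iff_comp_chartAt_symm.2
    ⟨L.continuous.continuousAt.comp hg.continuousAt, hg.clm_comp_tvs L⟩

omit [IsTopologicalRing R] [ContinuousSMul ℂ R] in
theorem MDifferentiableAt.complexDifferentiableAt {u : X → F} {y : X}
    (hu : MDifferentiableAt 𝓘(ℂ, EuclideanSpace ℂ (Fin n)) 𝓘(ℂ, F) u y) (T : F →L[ℂ] R) :
    ComplexDifferentiableAt n (fun y => T (u y)) y :=
  DifferentiableAt.clm_comp_tvs T (mdifferentiableAt_iff_comp_chartAt_symm.1 hu).2

end

variable [IsManifold 𝓘(ℂ, EuclideanSpace ℂ (Fin n)) ω X]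

theorem mdifferentiableAt_chartCoord {x y : X}
    (hy : y ∈ (chartAt (EuclideanSpace ℂ (Fin n)) x).source) :
    MDifferentiableAt 𝓘(ℂ, EuclideanSpace ℂ (Fin n)) 𝓘(ℂ, Fin n → ℂ) (chartCoord n x) y := by
  have : IsManifold 𝓘(ℂ, EuclideanSpace ℂ (Fin n)) 1 X := IsManifold.of_le (n := ω) le_top
  have h1 : DifferentiableAt ℂ (fun w => EuclideanSpace.equiv (Fin n) ℂ
      (w - chartAt (EuclideanSpace ℂ (Fin n)) x x)) (chartAt (EuclideanSpace ℂ (Fin n)) x y) := by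
    fun_prop
  exact h1.mdifferentiableAt.comp y
    (mdifferentiableAt_atlas (I := 𝓘(ℂ, EuclideanSpace ℂ (Fin n))) (chart_mem_atlas _ x) hy)

theorem mdifferentiableAt_chartPoint {x : X} {z : Fin n → ℂ}
    (hz : (EuclideanSpace.equiv (Fin n) ℂ).symm z + chartAt (EuclideanSpace ℂ (Fin n)) x x ∈
      (chartAt (EuclideanSpace ℂ (Fin n)) x).target) :
    MDifferentiableAt 𝓘(ℂ, Fin n → ℂ) 𝓘(ℂ, EuclideanSpace ℂ (Fin n)) (chartPoint x) z := by
  have : IsManifold 𝓘(ℂ, EuclideanSpace ℂ (Fin n)) 1 X := IsManifold.of_le (n := ω) le_top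
  have h1 : DifferentiableAt ℂ (fun z => (EuclideanSpace.equiv (Fin n) ℂ).symm z +
      chartAt (EuclideanSpace ℂ (Fin n)) x x) z := by
    fun_prop
  exact (mdifferentiableAt_atlas_symm (I := 𝓘(ℂ, EuclideanSpace ℂ (Fin n)))
    (chart_mem_atlas _ x) hz).comp z h1.mdifferentiableAt

end Charts

namespace LevelNorms

variable {N : LevelNorms} {h : Set.Ico 0 N.S} {n : ℕ} {X : Type u} [TopologicalSpace X]
  [ChartedSpace (EuclideanSpace ℂ (Fin n)) X] [IsManifold 𝓘(ℂ, EuclideanSpace ℂ (Fin n)) ω X]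

theorem exists_hasExpansion_chartCoord {x : X} {g : X → N.dirLim h}
    (hg : ∀ᶠ y in 𝓝 x, ComplexDifferentiableAt n g y) :
    ∃ F ∈ N.germSeries h n, ∀ᶠ y in 𝓝 x, HasExpansion F (g y) (chartCoord n x y) := by
  have hg' : ∀ᶠ z in 𝓝 0, ComplexDifferentiableAt n g (chartPoint (n := n) x z) :=
    (tendsto_chartPoint x).eventually hg
  obtain ⟨F, hF, hFz⟩ := exists_hasExpansion (h := h) (f := fun z : Fin n → ℂ => g (chartPoint x z))
    (by
      filter_upwards [hg', eventually_mem_target x] with z hz ht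
      exact ContinuousAt.comp (f := chartPoint (n := n) x) hz.continuousAt (continuousAt_chartPoint ht))
    (by
      filter_upwards [hg', eventually_mem_target x] with z hz ht j
      have h1 := MDifferentiableAt.comp z (hz.mdifferentiableAt (N.coeffCLM h j))
        (mdifferentiableAt_chartPoint ht)
      exact mdifferentiableAt_iff_differentiableAt.1 h1)
  refine ⟨F, hF, ?_⟩
  filter_upwards [(tendsto_chartCoord x).eventually hFz, (chartAt (EuclideanSpace ℂ (Fin n))
    x).open_source.mem_nhds (mem_chart_source _ x)] with y hy hy'
  rwa [chartPoint_chartCoord hy'] at hy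

/-- The sum of the series factors through the Banach space `ℓ¹`, where the change of chart is made
before the continuous linear map to `N.dirLim h` is applied. -/
theorem exists_complexDifferentiableAt_hasExpansion (x : X) {F : MvPowerSeries (Fin n) ℂ⟦X⟧}
    (hF : F ∈ N.germSeries h n) : ∃ g : X → N.dirLim h,
      ∀ᶠ y in 𝓝 x, ComplexDifferentiableAt n g y ∧ HasExpansion F (g y) (chartCoord n x y) := by
  obtain ⟨T, g, hg⟩ := exists_differentiableAt_hasExpansion hF
  refine ⟨fun y => T (g (chartCoord n x y)), ?_⟩
  filter_upwards [(tendsto_chartCoord x).eventually hg, (chartAt (EuclideanSpace ℂ (Fin n))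
    x).open_source.mem_nhds (mem_chart_source _ x)] with y hy hy'
  exact ⟨MDifferentiableAt.complexDifferentiableAt
    (MDifferentiableAt.comp y hy.1.mdifferentiableAt (mdifferentiableAt_chartCoord hy')) T, hy.2⟩

omit [IsManifold 𝓘(ℂ, EuclideanSpace ℂ (Fin n)) ω X] in
theorem hasExpansion_chartCoord_unique {x : X} {F G : MvPowerSeries (Fin n) ℂ⟦X⟧}
    (hF : F ∈ N.germSeries h n) (hG : G ∈ N.germSeries h n) {g : X → N.dirLim h}
    (hFg : ∀ᶠ y in 𝓝 x, HasExpansion F (g y) (chartCoord n x y))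
    (hGg : ∀ᶠ y in 𝓝 x, HasExpansion G (g y) (chartCoord n x y)) : F = G := by
  refine hasExpansion_unique_series (f := fun z => (g (chartPoint (n := n) x z) : ℂ⟦X⟧)) hF hG ?_ ?_
  · filter_upwards [(tendsto_chartPoint x).eventually hFg, eventually_mem_target x] with z hz ht
    rwa [chartCoord_chartPoint ht] at hz
  · filter_upwards [(tendsto_chartPoint x).eventually hGg, eventually_mem_target x] with z hz ht
    rwa [chartCoord_chartPoint ht] at hz

end LevelNorms

/-! ### Stalks as germs of functions. -/

section Germs

open TopologicalSpace CategoryTheory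

variable {n : ℕ} {X : Type u} [TopologicalSpace X] [ChartedSpace (EuclideanSpace ℂ (Fin n)) X]
  {R : Type} [CommRing R] [Algebra ℂ R] [TopologicalSpace R] [IsTopologicalRing R]
  [ContinuousSMul ℂ R]

/-- The germ at `x` of a holomorphic function on a neighbourhood `U` of `x`. -/
def holomorphicGerm {x : X} {U : Opens X} (hx : x ∈ U) :
    holomorphicSections n R U →+* (holomorphicSheaf n X R).presheaf.stalk x :=
  ((holomorphicSheaf n X R).presheaf.germ (X := TopCat.of X) U x hx).hom

/-- The extension by zero of a holomorphic function. -/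
def extendSection {U : Opens X} (f : holomorphicSections n R U) : X → R :=
  Function.extend ((↑) : U → X) f.1 0

theorem exists_holomorphicGerm_eq {x : X} (s : (holomorphicSheaf n X R).presheaf.stalk x) :
    ∃ (U : Opens X) (hx : x ∈ U) (f : holomorphicSections n R U), holomorphicGerm hx f = s :=
  (holomorphicSheaf n X R).presheaf.exists_germ_eq s

theorem holomorphicGerm_eq_iff {x : X} {U V : Opens X} {hU : x ∈ U} {hV : x ∈ V}
    {f : holomorphicSections n R U} {g : holomorphicSections n R V} :
    holomorphicGerm hU f = holomorphicGerm hV g ↔ extendSection f =ᶠ[𝓝 x] extendSection g := by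
  constructor
  · intro H
    obtain ⟨W, hW, iU, iV, e⟩ := (holomorphicSheaf n X R).presheaf.germ_eq x hU hV f g H
    filter_upwards [W.isOpen.mem_nhds hW] with y hy
    rw [extendSection, extendSection, extend_zero_apply _ (iU.le hy),
      extend_zero_apply _ (iV.le hy)]
    exact congrFun (congrArg Subtype.val e) ⟨y, hy⟩
  · intro H
    obtain ⟨W, hWH, hWo, hW⟩ := mem_nhds_iff.1 H
    refine (holomorphicSheaf n X R).presheaf.germ_ext (X := TopCat.of X) (⟨W, hWo⟩ ⊓ (U ⊓ V))
      ⟨hW, hU, hV⟩ (homOfLE (inf_le_right.trans inf_le_left))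
      (homOfLE (inf_le_right.trans inf_le_right)) (Subtype.ext (funext fun y => ?_))
    have h1 := hWH y.2.1
    rw [Set.mem_ofPred_eq, extendSection, extendSection, extend_zero_apply _ y.2.2.1,
      extend_zero_apply _ y.2.2.2] at h1
    exact h1

theorem exists_extendSection_eventuallyEq {x : X} {g : X → R}
    (hg : ∀ᶠ y in 𝓝 x, ComplexDifferentiableAt n g y) :
    ∃ (U : Opens X) (_ : x ∈ U) (f : holomorphicSections n R U), extendSection f =ᶠ[𝓝 x] g := by
  obtain ⟨W, hWg, hWo, hW⟩ := mem_nhds_iff.1 hg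
  have he : ∀ y ∈ W, Function.extend ((↑) : (⟨W, hWo⟩ : Opens X) → X)
      (fun y : (⟨W, hWo⟩ : Opens X) => g y) 0 =ᶠ[𝓝 y] g := fun y hy => by
    filter_upwards [hWo.mem_nhds hy] with z hz
    exact extend_zero_apply (U := ⟨W, hWo⟩) _ hz
  exact ⟨⟨W, hWo⟩, hW, ⟨fun y => g y, fun y => (hWg y.2).congr (he y y.2)⟩, he x hW⟩

theorem eventually_complexDifferentiableAt_extendSection {x : X} {U : Opens X} (hx : x ∈ U)
    (f : holomorphicSections n R U) :
    ∀ᶠ y in 𝓝 x, ComplexDifferentiableAt n (extendSection f) y := by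
  filter_upwards [U.isOpen.mem_nhds hx] with y hy using f.2 ⟨y, hy⟩

/-- The germ at `x` of a function that is holomorphic near `x`. -/
def IsGermOf {x : X} (s : (holomorphicSheaf n X R).presheaf.stalk x) (g : X → R) : Prop :=
  ∃ (U : Opens X) (hx : x ∈ U) (f : holomorphicSections n R U),
    holomorphicGerm hx f = s ∧ extendSection f =ᶠ[𝓝 x] g

variable {x : X} {s t : (holomorphicSheaf n X R).presheaf.stalk x} {g g' : X → R}

theorem IsGermOf.eventuallyEq (hg : IsGermOf s g) (hg' : IsGermOf s g') : g =ᶠ[𝓝 x] g' := by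
  obtain ⟨U, hU, f, hf, e⟩ := hg
  obtain ⟨V, hV, f', hf', e'⟩ := hg'
  exact e.symm.trans ((holomorphicGerm_eq_iff.1 (hf.trans hf'.symm)).trans e')

theorem IsGermOf.eq (hg : IsGermOf s g) (hg' : IsGermOf t g') (H : g =ᶠ[𝓝 x] g') : s = t := by
  obtain ⟨U, hU, f, rfl, e⟩ := hg
  obtain ⟨V, hV, f', rfl, e'⟩ := hg'
  exact holomorphicGerm_eq_iff.2 (e.trans (H.trans e'.symm))

theorem IsGermOf.exists_common (hg : IsGermOf s g) (hg' : IsGermOf t g') :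
    ∃ (U : Opens X) (hx : x ∈ U) (f f' : holomorphicSections n R U), holomorphicGerm hx f = s ∧
      holomorphicGerm hx f' = t ∧ (extendSection f =ᶠ[𝓝 x] g) ∧ (extendSection f' =ᶠ[𝓝 x] g') := by
  obtain ⟨U, hU, f, rfl, e⟩ := hg
  obtain ⟨V, hV, f', rfl, e'⟩ := hg'
  have e1 := extend_restrict_eventuallyEq (V := U ⊓ V) inf_le_left f.1 ⟨hU, hV⟩
  have e2 := extend_restrict_eventuallyEq (V := U ⊓ V) inf_le_right f'.1 ⟨hU, hV⟩
  exact ⟨U ⊓ V, ⟨hU, hV⟩,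
    ⟨_, (holomorphicLocalPredicate n X R).res (homOfLE inf_le_left) f.1 f.2⟩,
    ⟨_, (holomorphicLocalPredicate n X R).res (homOfLE inf_le_right) f'.1 f'.2⟩,
    holomorphicGerm_eq_iff.2 e1, holomorphicGerm_eq_iff.2 e2, e1.trans e, e2.trans e'⟩

theorem IsGermOf.add (hg : IsGermOf s g) (hg' : IsGermOf t g') : IsGermOf (s + t) (g + g') := by
  obtain ⟨U, hU, f, f', rfl, rfl, e, e'⟩ := hg.exists_common hg'
  refine ⟨U, hU, f + f', map_add _ _ _, ?_⟩
  filter_upwards [e, e', U.isOpen.mem_nhds hU] with y h1 h2 hy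
  rw [Pi.add_apply, ← h1, ← h2]
  simp only [extendSection, extend_zero_apply _ hy]
  rfl

theorem IsGermOf.mul (hg : IsGermOf s g) (hg' : IsGermOf t g') : IsGermOf (s * t) (g * g') := by
  obtain ⟨U, hU, f, f', rfl, rfl, e, e'⟩ := hg.exists_common hg'
  refine ⟨U, hU, f * f', map_mul _ _ _, ?_⟩
  filter_upwards [e, e', U.isOpen.mem_nhds hU] with y h1 h2 hy
  rw [Pi.mul_apply, ← h1, ← h2]
  simp only [extendSection, extend_zero_apply _ hy]
  rfl

theorem exists_isGermOf (s : (holomorphicSheaf n X R).presheaf.stalk x) :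
    ∃ g : X → R, IsGermOf s g ∧ ∀ᶠ y in 𝓝 x, ComplexDifferentiableAt n g y := by
  obtain ⟨U, hU, f, hf⟩ := exists_holomorphicGerm_eq s
  exact ⟨extendSection f, ⟨U, hU, f, hf, Filter.EventuallyEq.rfl⟩,
    eventually_complexDifferentiableAt_extendSection hU f⟩

theorem exists_isGermOf_of_eventually (hg : ∀ᶠ y in 𝓝 x, ComplexDifferentiableAt n g y) :
    ∃ s : (holomorphicSheaf n X R).presheaf.stalk x, IsGermOf s g := by
  obtain ⟨U, hU, f, hf⟩ := exists_extendSection_eventuallyEq hg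
  exact ⟨holomorphicGerm hU f, U, hU, f, rfl, hf⟩

end Germs

/-- Germs and series are matched through a representing function that is not canonical, so the
isomorphism is obtained from a relation instead of a map. -/
theorem RingEquiv.exists_of_rel {A B : Type*} [Ring A] [Ring B] (r : A → B → Prop)
    (left_total : ∀ a, ∃ b, r a b) (right_total : ∀ b, ∃ a, r a b)
    (left_unique : ∀ {a a' b}, r a b → r a' b → a = a')
    (right_unique : ∀ {a b b'}, r a b → r a b' → b = b')
    (add : ∀ {a a' b b'}, r a b → r a' b' → r (a + a') (b + b'))
    (mul : ∀ {a a' b b'}, r a b → r a' b' → r (a * a') (b * b')) : Nonempty (A ≃+* B) := by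
  choose φ hφ using left_total
  choose ψ hψ using right_total
  exact ⟨{ toFun := φ
           invFun := ψ
           left_inv := fun a => left_unique (hψ _) (hφ a)
           right_inv := fun b => right_unique (hφ _) (hψ b)
           map_add' := fun a b => right_unique (hφ _) (add (hφ a) (hφ b))
           map_mul' := fun a b => right_unique (hφ _) (mul (hφ a) (hφ b)) }⟩

/-! ### The stalk is the ring of convergent series. -/

namespace LevelNorms

variable (N : LevelNorms) (h : Set.Ico 0 N.S) {n : ℕ} {X : Type u} [TopologicalSpace X]
  [ChartedSpace (EuclideanSpace ℂ (Fin n)) X] [IsManifold 𝓘(ℂ, EuclideanSpace ℂ (Fin n)) ω X]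

/-- The relation is that the series expands a representative of the germ near `x`. Existence in both
directions is the analytic part; a series determines its sums, and by the identity theorem the sums
determine the series. -/
theorem nonempty_stalk_equiv_germSeries (x : X) :
    Nonempty ((holomorphicSheaf n X (N.dirLim h)).presheaf.stalk x ≃+* N.germSeries h n) := by
  refine RingEquiv.exists_of_rel (fun s F => ∃ g : X → N.dirLim h, IsGermOf s g ∧
    ∀ᶠ y in 𝓝 x, HasExpansion F.1 (g y) (chartCoord n x y)) (fun s => ?_) (fun F => ?_) ?_ ?_ ?_ ?_
  · obtain ⟨g, hsg, hg⟩ := exists_isGermOf s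
    obtain ⟨F, hF, hFg⟩ := exists_hasExpansion_chartCoord hg
    exact ⟨⟨F, hF⟩, g, hsg, hFg⟩
  · obtain ⟨g, hg⟩ := exists_complexDifferentiableAt_hasExpansion x F.2
    obtain ⟨s, hs⟩ := exists_isGermOf_of_eventually (hg.mono fun y hy => hy.1)
    exact ⟨s, g, hs, hg.mono fun y hy => hy.2⟩
  · rintro s s' F ⟨g, hg, hF⟩ ⟨g', hg', hF'⟩
    refine hg.eq hg' ?_
    filter_upwards [hF, hF'] with y h1 h2
    exact Subtype.ext (h1.unique h2)
  · rintro s F F' ⟨g, hg, hF⟩ ⟨g', hg', hF'⟩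
    refine Subtype.ext (hasExpansion_chartCoord_unique F.2 F'.2 hF ?_)
    filter_upwards [hF', hg.eventuallyEq hg'] with y h1 h2
    rwa [h2]
  · rintro s s' F F' ⟨g, hg, hF⟩ ⟨g', hg', hF'⟩
    refine ⟨g + g', hg.add hg', ?_⟩
    filter_upwards [hF, hF'] with y h1 h2 using h1.add h2
  · rintro s s' F F' ⟨g, hg, hF⟩ ⟨g', hg', hF'⟩
    refine ⟨g * g', hg.mul hg', ?_⟩
    filter_upwards [hF, hF'] with y h1 h2 using h1.mul h2

theorem isRegularLocalRing_stalk (x : X) :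
    IsRegularLocalRing ((holomorphicSheaf n X (N.dirLim h)).presheaf.stalk x) := by
  obtain ⟨e⟩ := N.nonempty_stalk_equiv_germSeries (n := n) h x
  exact IsRegularLocalRing.of_ringEquiv e.symm

end LevelNorms

end

theorem mainTheorem4 (N : LevelNorms) (n : ℕ) (X : Type u) [TopologicalSpace X]
    [ChartedSpace (EuclideanSpace ℂ (Fin n)) X]
    [IsManifold 𝓘(ℂ, EuclideanSpace ℂ (Fin n)) ω X] (x : X) :
    IsRegularLocalRing ((holomorphicSheaf n X N.A).presheaf.stalk x) ∧
    ∀ h : Set.Ioo 0 N.S,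
      IsRegularLocalRing ((holomorphicSheaf n X (N.Acheck h)).presheaf.stalk x) :=
  ⟨N.isRegularLocalRing_stalk (n := n) _ x, fun _ => N.isRegularLocalRing_stalk (n := n) _ x⟩
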